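/- Let $n\ge 2$, let $m>1$ be real, and let $|\cdot|$ be the Euclidean norm on $\mathbb C^n$. For a bounded domain $\Omega\subset\mathbb C^n$, $z\in\Omega$ and $0\ne v\in\mathbb C^n$ put $$\delta_\Omega(z)=\inf_{\xi\in\partial\Omega}|z-\xi|,\qquad \delta_\Omega(z;v)=\inf\{|z-\xi|:\xi\in\partial\Omega\cap(z+\mathbb Cv)\}.$$ A bounded convex domain $\Omega$ is called $m$-convex if there is $C>0$ with $\delta_\Omega(z;v)\le C\,\delta_\Omega(z)^{1/m}$ for all $z\in\Omega$ and $0\neq v\in\mathbb C^n$. The boundary of $\Omega$ is Dini-smooth if it is $C^1$ and every $p\in\partial\Omega$ has a neighbourhood $U$ such that $\int_0^1\frac{\omega(t)}{t}\,dt<\infty$, where $\omega(t)=\sup\{|\vec n(x)-\vec n(y)|: x,y\in\partial\Omega\cap U,\ |x-y|<t\}$ and $\vec n$ is the outer unit normal. The Kobayashi metric is $$K_\Omega(x;v)=\inf\{|\xi|:\ \xi\in\mathbb C,\ \varphi:\mathbb D\to\Omega \text{ holomorphic},\ \varphi(0)=x,\ \xi\,\varphi'(0)=v\},$$ and the Kobayashi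 distance $d_{K_\Omega}(x,y)$ is the infimum of $\int_0^1K_\Omega(\gamma(t);\dot\gamma(t))\,dt$ over all piecewise $C^1$ curves $\gamma:[0,1]\to\Omega$ from $x$ to $y$. Theorem. Let $\Omega_1,\Omega_2\subset\mathbb C^n$ be bounded $m$-convex domains with Dini-smooth boundary, and let $f:\Omega_1\to\Omega_2$ be an isometry for the Kobayashi distances, i.e. $d_{K_{\Omega_2}}(f(x),f(y))=d_{K_{\Omega_1}}(x,y)$ for all $x,y\in\Omega_1$. Then $f$ extends to a homeomorphism $\bar f:\overline{\Omega}_1\to\overline{\Omega}_2$ of the Euclidean closures which restricts to a bijection $\partial\Omega_1\to\partial\Omega_2$, and this boundary map is bi-Hölder in the Euclidean metric with exponents $m$ and $1/m$: there is a constant $\Lambda\ge1$ such that $$\Lambda^{-1}|a-b|^{m}\le|\bar f(a)-\bar f(b)|\le\Lambda|a-b|^{1/m}\qquad\text{for all }a,b\in\partial\Omega_1 .$$ -/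

import Mathlib

open scoped ENNReal

/-- Complex Euclidean space `ℂⁿ` with its Euclidean norm. -/
abbrev Cn (n : ℕ) : Type := EuclideanSpace ℂ (Fin n)

/-- `δ_Ω(z)`: the Euclidean distance from `z` to the boundary of `Ω`. -/
noncomputable def bdryDist {n : ℕ} (Ω : Set (Cn n)) (z : Cn n) : ℝ :=
  Metric.infDist z (frontier Ω)

/-- `δ_Ω(z; v)`: the Euclidean distance from `z` to the part of the boundary of `Ω` lying on
the complex line `z + ℂ v`. (For `Ω` bounded, `z ∈ Ω` and `v ≠ 0` this part is nonempty.) -/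
noncomputable def bdryDistDir {n : ℕ} (Ω : Set (Cn n)) (z v : Cn n) : ℝ :=
  Metric.infDist z (frontier Ω ∩ Set.range fun c : ℂ => z + c • v)

/-- `Ω` is a bounded `m`-convex domain: a bounded convex domain for which, with some `C > 0`,
`δ_Ω(z; v) ≤ C δ_Ω(z)^(1/m)` for all `z ∈ Ω` and all directions `v`; here `m > 1`. -/
structure IsMConvexDomain {n : ℕ} (m : ℝ) (Ω : Set (Cn n)) : Prop where
  isOpen : IsOpen Ω
  nonempty : Ω.Nonempty
  isBounded : Bornology.IsBounded Ω
  convex : Convex ℝ Ω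
  one_lt : 1 < m
  exists_bound : ∃ C : ℝ, 0 < C ∧
    ∀ z ∈ Ω, ∀ v : Cn n, v ≠ 0 → bdryDistDir Ω z v ≤ C * bdryDist Ω z ^ (1 / m)

/-- The real gradient `∇r = (∂r/∂x_j + i ∂r/∂y_j)_j` of a real function `r` on `ℂⁿ = ℝ²ⁿ`,
where `z_j = x_j + i y_j`. -/
noncomputable def realGradient {n : ℕ} (r : Cn n → ℝ) (x : Cn n) : Cn n :=
  WithLp.toLp 2 fun j : Fin n =>
    ((fderiv ℝ r x (EuclideanSpace.single j 1) : ℝ) : ℂ) +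
      Complex.I * ((fderiv ℝ r x (EuclideanSpace.single j Complex.I) : ℝ) : ℂ)

/-- The unit vector `∇r / |∇r|`; it is the outer unit normal to `∂Ω` when `r` is a local
defining function of `Ω = {r < 0}`. -/
noncomputable def unitNormal {n : ℕ} (r : Cn n → ℝ) (x : Cn n) : Cn n :=
  (‖realGradient r x‖⁻¹ : ℝ) • realGradient r x

/-- `r` is a `C¹` defining function of `Ω` on the open set `U`. -/
structure IsC1DefiningFunction {n : ℕ} (Ω U : Set (Cn n)) (r : Cn n → ℝ) : Prop where
  contDiffOn : ContDiffOn ℝ 1 r U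
  fderiv_ne_zero : ∀ x ∈ U, fderiv ℝ r x ≠ 0
  inter_eq : Ω ∩ U = {x ∈ U | r x < 0}

/-- The modulus of continuity `ω(N, S, t) = sup {|N x - N y| : |x - y| < t, x, y ∈ S}`. -/
noncomputable def modulusOfContinuity {n : ℕ} (N : Cn n → Cn n) (S : Set (Cn n)) (t : ℝ) :
    ℝ≥0∞ :=
  ⨆ (x ∈ S) (y ∈ S) (_ : dist x y < t), edist (N x) (N y)

/-- `p` is a Dini-smooth boundary point of `Ω`: the boundary is `C¹` near `p` and the modulus
of continuity `ω` of its outer unit normal near `p` satisfies `∫₀¹ ω(t)/t dt < ∞`. -/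
def IsDiniSmoothAt {n : ℕ} (Ω : Set (Cn n)) (p : Cn n) : Prop :=
  ∃ (U : Set (Cn n)) (r : Cn n → ℝ), IsOpen U ∧ p ∈ U ∧ IsC1DefiningFunction Ω U r ∧
    ∫⁻ t in Set.Ioc (0 : ℝ) 1,
      modulusOfContinuity (unitNormal r) (frontier Ω ∩ U) t / ENNReal.ofReal t < ∞

/-- Every boundary point of `Ω` is Dini-smooth. -/
def HasDiniSmoothBoundary {n : ℕ} (Ω : Set (Cn n)) : Prop :=
  ∀ p ∈ frontier Ω, IsDiniSmoothAt Ω p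

/-- The infinitesimal Kobayashi metric
`K_Ω(x; v) = inf {|ξ| : φ ∈ Hol(𝔻, Ω), φ(0) = x, φ'(0) ξ = v}`. -/
noncomputable def kobayashiMetric {n : ℕ} (Ω : Set (Cn n)) (x v : Cn n) : ℝ≥0∞ :=
  ⨅ (φ : ℂ → Cn n) (ξ : ℂ) (_ : DifferentiableOn ℂ φ (Metric.ball 0 1))
    (_ : Set.MapsTo φ (Metric.ball 0 1) Ω) (_ : φ 0 = x) (_ : ξ • deriv φ 0 = v), ‖ξ‖ₑ

/-- `γ` restricts to a piecewise `C¹` curve on `[0, 1]`: it is `C¹` on each closed piece of a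
finite subdivision (so in particular continuous on `[0, 1]`). -/
def IsPiecewiseC1 {n : ℕ} (γ : ℝ → Cn n) : Prop :=
  ∃ (N : ℕ) (t : ℕ → ℝ), Monotone t ∧ t 0 = 0 ∧ t N = 1 ∧
    ∀ i < N, ContDiffOn ℝ 1 γ (Set.Icc (t i) (t (i + 1)))

/-- The Kobayashi length `∫₀¹ K_Ω(γ(t); γ'(t)) dt` of a curve. -/
noncomputable def kobayashiLength {n : ℕ} (Ω : Set (Cn n)) (γ : ℝ → Cn n) : ℝ≥0∞ :=
  ∫⁻ t in Set.Icc (0 : ℝ) 1, kobayashiMetric Ω (γ t) (deriv γ t)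

/-- The Kobayashi distance: the infimum of the Kobayashi lengths of the piecewise `C¹` curves
in `Ω` from `x` to `y`. -/
noncomputable def kobayashiDist {n : ℕ} (Ω : Set (Cn n)) (x y : Cn n) : ℝ≥0∞ :=
  ⨅ (γ : ℝ → Cn n) (_ : IsPiecewiseC1 γ) (_ : Set.MapsTo γ (Set.Icc 0 1) Ω)
    (_ : γ 0 = x) (_ : γ 1 = y), kobayashiLength Ω γ

/-- `f` preserves the Kobayashi distances (surjectivity is not required). -/
def IsKobayashiIsometry {n : ℕ} {Ω₁ Ω₂ : Set (Cn n)} (f : Ω₁ → Ω₂) : Prop :=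
  ∀ x y : Ω₁, kobayashiDist Ω₂ (f x) (f y) = kobayashiDist Ω₁ x y

/-- `g` is `α`-bi-Hölder: a bijection with
`Λ⁻¹ d(x, y)^(1/α) ≤ d(g x, g y) ≤ Λ d(x, y)^α` for some `Λ ≥ 1`, where `0 < α < 1`. -/
def IsBiHolder {X Y : Type*} [MetricSpace X] [MetricSpace Y] (α : ℝ) (g : X → Y) : Prop :=
  0 < α ∧ α < 1 ∧ Function.Bijective g ∧ ∃ Λ : ℝ, 1 ≤ Λ ∧ ∀ x y : X,
    Λ⁻¹ * dist x y ^ (1 / α) ≤ dist (g x) (g y) ∧ dist (g x) (g y) ≤ Λ * dist x y ^ α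

/-!
In a convex domain with Dini-smooth boundary an inner normal segment has Kobayashi length
`½ log (s / δ) + O(1)` between depths `δ` and `s`: the Dini condition makes the errors, collected
over dyadic scales, summable. Lifting two points to the scale of their distance gives
`d(x, y) ≤ log (|x - y| + δ x + δ y) - ½ log δ x - ½ log δ y + O(1)`. Comparison with half-spaces
bounds `d(x, y)` from below by `½ |log δ x - log δ y|`, and `m`-convexity gives
`d(x, y) ≥ m log |x - y| - ½ log δ x - ½ log δ y - O(1)`.

An isometry therefore distorts the boundary distance by at most a factor, and comparing the upper
bound in one domain with the lower bound in the other yields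
`|f x - f y| ^ m ≤ C (|x - y| + δ x + δ y)`, and the same for the inverse. So `f` has boundary
limits, the error terms vanish there, and the extension is bi-Hölder on the boundary. It is onto
because the image of `f` is open, by invariance of domain, and relatively closed.
-/

open Set Metric MeasureTheory Filter Topology
open scoped RealInnerProductSpace

section NoRetraction

variable {V : Type*} [NormedAddCommGroup V] [NormedSpace ℝ V]

theorem injOn_add_smul_of_lipschitzOnWith {s : Set V} {h : V → V} {K : NNReal}
    (hh : LipschitzOnWith K h s) {t : ℝ} (ht : |t| * K < 1) : InjOn (fun x => x + t • h x) s := by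
  intro x hx y hy hxy
  have hsub : x - y = t • (h y - h x) := by
    rw [smul_sub, sub_eq_sub_iff_add_eq_add, add_comm _ y]
    exact hxy
  have hle : ‖x - y‖ ≤ |t| * (K * ‖x - y‖) := by
    conv_lhs => rw [hsub, norm_smul, Real.norm_eq_abs, norm_sub_rev]
    exact mul_le_mul_of_nonneg_left (hh.norm_sub_le hx hy) (abs_nonneg t)
  have hzero : ‖x - y‖ = 0 := by nlinarith [norm_nonneg (x - y)]
  exact sub_eq_zero.1 (norm_eq_zero.1 hzero)

theorem exists_nnreal_norm_fderiv_le_lipschitzOnWith {O s : Set V} (hO : IsOpen O) (hsO : s ⊆ O)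
    (hs : IsCompact s) (hsc : Convex ℝ s) {h : V → V} (hh : ContDiffOn ℝ 1 h O) :
    ∃ K : NNReal, (∀ x ∈ s, ‖fderiv ℝ h x‖ ≤ K) ∧ LipschitzOnWith K h s := by
  obtain ⟨C, hC⟩ := hs.exists_bound_of_continuousOn
    ((hh.continuousOn_fderiv_of_isOpen hO le_rfl).mono hsO)
  have hle : ∀ x ∈ s, ‖fderiv ℝ h x‖ ≤ C.toNNReal := fun x hx => by
    simpa using Or.inl (hC x hx)
  exact ⟨_, hle, hsc.lipschitzOnWith_of_nnnorm_fderiv_le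
    (fun x hx => (hh.contDiffAt (hO.mem_nhds (hsO hx))).differentiableAt one_ne_zero) hle⟩

variable [FiniteDimensional ℝ V]

theorem exists_polynomial_det_one_add_smul (A : V →L[ℝ] V) :
    ∃ P : Polynomial ℝ, P.natDegree ≤ Module.finrank ℝ V ∧
      ∀ t : ℝ, P.eval t = (1 + t • A : V →L[ℝ] V).det := by
  let b := Module.finBasis ℝ V
  let M := LinearMap.toMatrix b b (A : V →ₗ[ℝ] V)
  refine ⟨Matrix.det ((Polynomial.X : Polynomial ℝ) • M.map Polynomial.C +
    (1 : Matrix _ _ ℝ).map Polynomial.C), ?_, fun t => ?_⟩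
  · simpa using Polynomial.natDegree_det_X_add_C_le M 1
  · rw [← Polynomial.coe_evalRingHom, RingHom.map_det, ContinuousLinearMap.det,
      ← LinearMap.det_toMatrix b]
    congr 1
    ext i j
    simp [M, Matrix.one_apply, LinearMap.toMatrix_apply, apply_ite, add_comm,
      Finsupp.single_apply, eq_comm]
    ring

theorem det_one_add_smul_eq_sum (s : Finset ℝ) (hs : Module.finrank ℝ V < s.card)
    (A : V →L[ℝ] V) (t : ℝ) :
    (1 + t • A : V →L[ℝ] V).det =
      ∑ u ∈ s, (1 + u • A : V →L[ℝ] V).det * (Lagrange.basis s id u).eval t := by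
  obtain ⟨P, hP, hPe⟩ := exists_polynomial_det_one_add_smul A
  have hdeg : P.degree < s.card :=
    Polynomial.degree_le_natDegree.trans_lt (by exact_mod_cast hP.trans_lt hs)
  rw [← hPe t, Lagrange.eq_interpolate (injOn_id _) hdeg, Lagrange.interpolate_apply,
    Polynomial.eval_finsetSum]
  simp [hPe]

theorem det_one_add_pos (A : V →L[ℝ] V) (hA : ‖A‖ < 1) : 0 < (1 + A : V →L[ℝ] V).det := by
  have hne : ∀ t ∈ Icc (0 : ℝ) 1, (1 + t • A : V →L[ℝ] V).det ≠ 0 := by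
    intro t ht h0
    have hu : IsUnit (1 - (-(t • A)) : V →L[ℝ] V) := by
      apply isUnit_one_sub_of_norm_lt_one
      rw [norm_neg, norm_smul, Real.norm_of_nonneg ht.1]
      nlinarith [norm_nonneg A, ht.2]
    rw [sub_neg_eq_add] at hu
    have := hu.map (ContinuousLinearMap.toLinearMapRingHom : (V →L[ℝ] V) →+* (V →ₗ[ℝ] V))
    exact ((LinearMap.isUnit_iff_isUnit_det _).1 this).ne_zero h0
  have hc : Continuous fun t : ℝ => (1 + t • A : V →L[ℝ] V).det :=
    ContinuousLinearMap.continuous_det.comp (by fun_prop)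
  by_contra! hneg
  obtain ⟨t, ht, h0⟩ : (0 : ℝ) ∈ (fun t : ℝ => (1 + t • A : V →L[ℝ] V).det) '' Icc 0 1 :=
    intermediate_value_Icc' zero_le_one hc.continuousOn
      ⟨by simpa using hneg, by simp [ContinuousLinearMap.det]⟩
  exact hne t ht h0

theorem setIntegral_det_one_add_smul_eq_of_infinite {X : Type*} [MeasurableSpace X]
    {μ : Measure X} {s : Set X} {A : X → V →L[ℝ] V} {T : Set ℝ} {c : ℝ}
    (hint : ∀ t : ℝ, IntegrableOn (fun x => (1 + t • A x : V →L[ℝ] V).det) s μ)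
    (hT : T.Infinite) (hc : ∀ t ∈ T, ∫ x in s, (1 + t • A x : V →L[ℝ] V).det ∂μ = c) (t : ℝ) :
    ∫ x in s, (1 + t • A x : V →L[ℝ] V).det ∂μ = c := by
  obtain ⟨u, huT, hcard⟩ := hT.exists_subset_card_eq (Module.finrank ℝ V + 1)
  simp_rw [fun x => det_one_add_smul_eq_sum u (by omega) (A x) t]
  rw [integral_finsetSum _ fun v _ => (hint v).mul_const _]
  calc ∑ v ∈ u, ∫ x in s, (1 + v • A x : V →L[ℝ] V).det * (Lagrange.basis u id v).eval t ∂μ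
      = ∑ v ∈ u, c * (Lagrange.basis u id v).eval t :=
        Finset.sum_congr rfl fun v hv => by rw [integral_mul_const, hc v (huT hv)]
    _ = c := by
        rw [← Finset.mul_sum, ← Polynomial.eval_finsetSum,
          Lagrange.sum_basis (injOn_id _) (Finset.card_pos.1 (by omega)), Polynomial.eval_one,
          mul_one]

theorem isOpen_image_of_det_fderiv_ne_zero {U : Set V} (hU : IsOpen U) {g : V → V}
    (hg : ContDiffOn ℝ 1 g U) (hdet : ∀ x ∈ U, (fderiv ℝ g x).det ≠ 0) : IsOpen (g '' U) := by
  rw [isOpen_iff_mem_nhds]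
  rintro _ ⟨x, hx, rfl⟩
  have hst := (hg.contDiffAt (hU.mem_nhds hx)).hasStrictFDerivAt one_ne_zero
  rw [← ContinuousLinearMap.coe_toContinuousLinearEquivOfDetNeZero _ (hdet x hx)] at hst
  rw [← hst.map_nhds_eq_of_equiv]
  exact image_mem_map (hU.mem_nhds hx)

theorem image_ball_eq_of_fixes_sphere {g : V → V} (hg : ContinuousOn g (closedBall 0 1))
    (hmaps : MapsTo g (ball 0 1) (ball 0 1)) (hopen : IsOpen (g '' ball 0 1))
    (hfix : ∀ x, ‖x‖ = 1 → g x = x) : g '' ball 0 1 = ball 0 1 := by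
  have hball : IsPreconnected (ball (0 : V) 1) := (convex_ball _ _).isPreconnected
  refine hmaps.image_subset.antisymm (hball.subset_of_closure_inter_subset hopen
    ⟨g 0, hmaps (by simp), mem_image_of_mem g (by simp)⟩ ?_)
  rintro y ⟨hy, hy1⟩
  have hcl : closure (g '' ball 0 1) ⊆ g '' closedBall 0 1 :=
    closure_minimal (image_mono ball_subset_closedBall)
      ((isCompact_closedBall _ _).image_of_continuousOn hg).isClosed
  obtain ⟨x, hx, rfl⟩ := hcl hy
  rcases (mem_closedBall_zero_iff.1 hx).lt_or_eq with hlt | heq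
  · exact ⟨x, by simpa using hlt, rfl⟩
  · rw [hfix x heq, mem_ball_zero_iff] at hy1
    exact absurd heq hy1.ne

theorem det_eq_zero_of_norm_eventuallyEq_one {V : Type*} [NormedAddCommGroup V]
    [InnerProductSpace ℝ V] [FiniteDimensional ℝ V] {r : V → V} {A : V →L[ℝ] V} {x : V}
    (hr : HasFDerivAt r A x) (hnorm : ∀ᶠ y in 𝓝 x, ‖r y‖ = 1) : A.det = 0 := by
  by_contra hd
  obtain ⟨v, hv⟩ := (A.toContinuousLinearEquivOfDetNeZero hd).surjective (r x)
  rw [ContinuousLinearMap.toContinuousLinearEquivOfDetNeZero_apply] at hv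
  have hconst : (fun y => ‖r y‖ ^ 2) =ᶠ[𝓝 x] fun _ => (1 : ℝ) := by
    filter_upwards [hnorm] with y hy
    rw [hy, one_pow]
  have hzero := hr.norm_sq.unique ((hasFDerivAt_const (1 : ℝ) x).congr_of_eventuallyEq hconst)
  have happly := congrArg (fun L : V →L[ℝ] ℝ => L v) hzero
  simp only [smul_apply, ContinuousLinearMap.comp_apply, hv, innerSL_apply_apply,
    real_inner_self_eq_norm_sq, hnorm.self_of_nhds] at happly
  norm_num at happly

theorem image_ball_add_smul_sub {O : Set V} (hO : IsOpen O) (hB : closedBall (0 : V) 1 ⊆ O)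
    {r : V → V} (hr : ContDiffOn ℝ 1 r O) (hr1 : ∀ x ∈ closedBall (0 : V) 1, ‖r x‖ = 1)
    (hfix : ∀ x, ‖x‖ = 1 → r x = x) {t : ℝ} (ht : t ∈ Ico 0 1)
    (hdet : ∀ x ∈ ball (0 : V) 1, (1 + t • fderiv ℝ (fun y => r y - y) x : V →L[ℝ] V).det ≠ 0) :
    (fun x => x + t • (r x - x)) '' ball 0 1 = ball 0 1 := by
  have hg : ContDiffOn ℝ 1 (fun x => x + t • (r x - x)) O :=
    contDiffOn_id.add ((hr.sub contDiffOn_id).const_smul t)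
  have hball : ball (0 : V) 1 ⊆ O := ball_subset_closedBall.trans hB
  refine image_ball_eq_of_fixes_sphere (hg.continuousOn.mono hB) ?_ ?_ fun x hx => by
    simp [hfix x hx]
  · intro x hx
    rw [mem_ball_zero_iff] at hx ⊢
    calc ‖x + t • (r x - x)‖ = ‖(1 - t) • x + t • r x‖ := by congr 1; module
      _ ≤ ‖(1 - t) • x‖ + ‖t • r x‖ := norm_add_le _ _
      _ = (1 - t) * ‖x‖ + t := by
          rw [norm_smul, norm_smul, hr1 x (by simpa using hx.le), Real.norm_of_nonneg ht.1,
            Real.norm_of_nonneg (sub_nonneg.2 ht.2.le), mul_one]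
      _ < 1 := by nlinarith [ht.2]
  · refine isOpen_image_of_det_fderiv_ne_zero isOpen_ball (hg.mono hball) fun x hx => ?_
    have hd : DifferentiableAt ℝ (fun y => r y - y) x :=
      ((hr.sub contDiffOn_id).contDiffAt (hO.mem_nhds (hball hx))).differentiableAt one_ne_zero
    have hfd : HasFDerivAt (fun x => x + t • (r x - x))
        (1 + t • fderiv ℝ (fun y => r y - y) x : V →L[ℝ] V) x :=
      (hasFDerivAt_id x).add (hd.hasFDerivAt.const_smul t)
    rw [hfd.fderiv]
    exact hdet x hx

theorem setIntegral_det_one_add_smul_eq_measureReal_image [MeasurableSpace V] [BorelSpace V]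
    (μ : Measure V) [μ.IsAddHaarMeasure] {s : Set V} (hs : MeasurableSet s) {h : V → V}
    {h' : V → V →L[ℝ] V} {K : NNReal} (hh : LipschitzOnWith K h s)
    (hd : ∀ x ∈ s, HasFDerivAt h (h' x) x) (hh' : ∀ x ∈ s, ‖h' x‖ ≤ K) {t : ℝ}
    (ht : |t| * K < 1) :
    ∫ x in s, (1 + t • h' x : V →L[ℝ] V).det ∂μ = μ.real ((fun x => x + t • h x) '' s) := by
  have hcov := integral_image_eq_integral_abs_det_fderiv_smul μ hs
    (fun x hx => ((hasFDerivAt_id x).add ((hd x hx).const_smul t)).hasFDerivWithinAt)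
    (injOn_add_smul_of_lipschitzOnWith hh ht) fun _ => (1 : ℝ)
  rw [setIntegral_const, smul_eq_mul, mul_one] at hcov
  refine Eq.trans (setIntegral_congr_fun hs fun x hx => ?_) hcov.symm
  have hpos : 0 < (1 + t • h' x : V →L[ℝ] V).det := det_one_add_pos _ <| by
    rw [norm_smul]
    exact (mul_le_mul_of_nonneg_left (hh' x hx) (abs_nonneg t)).trans_lt ht
  simp only [smul_eq_mul, mul_one]
  exact (abs_of_pos hpos).symm

end NoRetraction

section Brouwer

variable {V : Type*} [NormedAddCommGroup V] [InnerProductSpace ℝ V]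

/- The maps `x + t (r x - x)` deform the identity into `r`. For small `t` they are diffeomorphisms
of the ball, so the integral of their Jacobian is the volume of the ball; this integral is
polynomial in `t`, hence constant, whereas at `t = 1` the Jacobian vanishes identically. -/
theorem not_exists_contDiffOn_retraction_sphere [FiniteDimensional ℝ V] {O : Set V}
    (hO : IsOpen O) (hB : closedBall (0 : V) 1 ⊆ O) :
    ¬ ∃ r : V → V, ContDiffOn ℝ 1 r O ∧ (∀ x ∈ closedBall (0 : V) 1, ‖r x‖ = 1) ∧
      ∀ x, ‖x‖ = 1 → r x = x := by
  rintro ⟨r, hr, hr1, hfix⟩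
  borelize V
  let h : V → V := fun x => r x - x
  have hcd : ContDiffOn ℝ 1 h O := hr.sub contDiffOn_id
  have hball : ball (0 : V) 1 ⊆ closedBall 0 1 := ball_subset_closedBall
  have hd : ∀ x ∈ closedBall (0 : V) 1, HasFDerivAt h (fderiv ℝ h x) x := fun x hx =>
    ((hcd.contDiffAt (hO.mem_nhds (hB hx))).differentiableAt one_ne_zero).hasFDerivAt
  have hcf : ContinuousOn (fderiv ℝ h) (closedBall 0 1) :=
    (hcd.continuousOn_fderiv_of_isOpen hO le_rfl).mono hB
  obtain ⟨C, hC, hLip⟩ := exists_nnreal_norm_fderiv_le_lipschitzOnWith hO hB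
    (isCompact_closedBall _ _) (convex_closedBall _ _) hcd
  have hsmall : ∀ t ∈ Ioo (0 : ℝ) (1 / (C + 1)), t < 1 ∧ |t| * C < 1 := by
    rintro t ⟨ht0, ht⟩
    rw [lt_div_iff₀ (by positivity)] at ht
    rw [abs_of_pos ht0]
    constructor <;> nlinarith [mul_nonneg ht0.le C.coe_nonneg]
  have hvol : ∀ t : ℝ, ∫ x in ball 0 1, (1 + t • fderiv ℝ h x : V →L[ℝ] V).det =
      volume.real (ball (0 : V) 1) := by
    refine setIntegral_det_one_add_smul_eq_of_infinite (fun t => ?_)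
      (Ioo_infinite (by positivity : (0 : ℝ) < 1 / (C + 1))) fun t ht => ?_
    · exact ((ContinuousLinearMap.continuous_det.comp_continuousOn (continuousOn_const.add
        (hcf.const_smul t))).integrableOn_compact (isCompact_closedBall _ _)).mono_set hball
    · obtain ⟨ht1, htC⟩ := hsmall t ht
      rw [setIntegral_det_one_add_smul_eq_measureReal_image _ measurableSet_ball
          (hLip.mono hball) (fun x hx => hd x (hball hx)) (fun x hx => hC x (hball hx)) htC,
        image_ball_add_smul_sub hO hB hr hr1 hfix ⟨ht.1.le, ht1⟩ fun x hx =>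
          (det_one_add_pos _ ?_).ne']
      rw [norm_smul]
      exact (mul_le_mul_of_nonneg_left (hC x (hball hx)) (abs_nonneg t)).trans_lt htC
  have hzero : ∫ x in ball 0 1, (1 + (1 : ℝ) • fderiv ℝ h x : V →L[ℝ] V).det = 0 := by
    refine setIntegral_eq_zero_of_forall_eq_zero fun x hx =>
      det_eq_zero_of_norm_eventuallyEq_one (r := r) ?_
        (eventually_of_mem (isOpen_ball.mem_nhds hx) fun y hy => hr1 y (hball hy))
    convert (hasFDerivAt_id x).add (hd x (hball hx)) using 1
    · ext y
      simp [h]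
    · rw [one_smul]
      rfl
  exact (ENNReal.toReal_pos (measure_ball_pos _ _ one_pos).ne' measure_ball_lt_top.ne).ne'
    ((hvol 1).symm.trans hzero)

/-- A quarter of the discriminant of the equation `‖x + s • u‖ = 1` in `s`. -/
noncomputable def sphereDiscrim (x u : V) : ℝ := ⟪x, u⟫ ^ 2 + ‖u‖ ^ 2 * (1 - ‖x‖ ^ 2)

/-- The point where the ray from `x` in direction `u` leaves the unit ball. -/
noncomputable def sphereExit (x u : V) : V :=
  x + ((-⟪x, u⟫ + √(sphereDiscrim x u)) / ‖u‖ ^ 2) • u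

theorem norm_sphereExit {x u : V} (hu : u ≠ 0) (hD : 0 ≤ sphereDiscrim x u) :
    ‖sphereExit x u‖ = 1 := by
  have hun : ‖u‖ ≠ 0 := norm_ne_zero_iff.2 hu
  have hsqrt : √(sphereDiscrim x u) ^ 2 = ⟪x, u⟫ ^ 2 + ‖u‖ ^ 2 * (1 - ‖x‖ ^ 2) :=
    Real.sq_sqrt hD
  rw [← sq_eq_sq₀ (norm_nonneg _) zero_le_one, sphereExit, norm_add_sq_real, norm_smul,
    inner_smul_right, mul_pow, Real.norm_eq_abs, sq_abs]
  field_simp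
  linear_combination hsqrt

theorem sphereExit_of_norm_eq_one {x u : V} (hx : ‖x‖ = 1) (hu : 0 ≤ ⟪x, u⟫) :
    sphereExit x u = x := by
  simp [sphereExit, sphereDiscrim, hx, Real.sqrt_sq hu]

theorem sphereDiscrim_pos {x u : V} (hx : ‖x‖ ≤ 1) (hu : u ≠ 0) (hxu : ‖x‖ = 1 → 0 < ⟪x, u⟫) :
    0 < sphereDiscrim x u := by
  have : 0 < ‖u‖ := norm_pos_iff.2 hu
  rcases hx.lt_or_eq with h | h
  · have : 0 < 1 - ‖x‖ ^ 2 := by nlinarith [norm_nonneg x]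
    unfold sphereDiscrim
    positivity
  · simpa [sphereDiscrim, h] using pow_pos (hxu h) 2

theorem contDiff_sphereDiscrim {u : V → V} (hu : ContDiff ℝ 1 u) :
    ContDiff ℝ 1 fun x => sphereDiscrim x (u x) :=
  ((contDiff_id.inner ℝ hu).pow 2).add
    ((hu.norm_sq ℝ).mul (contDiff_const.sub (contDiff_id.norm_sq ℝ)))

theorem contDiffAt_sphereExit {u : V → V} (hu : ContDiff ℝ 1 u) {x : V} (hx : u x ≠ 0)
    (hD : 0 < sphereDiscrim x (u x)) : ContDiffAt ℝ 1 (fun x => sphereExit x (u x)) x := by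
  have hsqrt : ContDiffAt ℝ 1 (fun x => √(sphereDiscrim x (u x))) x :=
    (contDiff_sphereDiscrim hu).contDiffAt.sqrt hD.ne'
  exact contDiffAt_id.add ((((contDiff_id.inner ℝ hu).contDiffAt.neg.add hsqrt).div
    (hu.norm_sq ℝ).contDiffAt (pow_ne_zero 2 (norm_ne_zero_iff.2 hx))).smul hu.contDiffAt)

theorem inner_sub_pos_of_norm_le_one {x y : V} (hx : ‖x‖ = 1) (hy : ‖y‖ ≤ 1) (hne : x ≠ y) :
    0 < ⟪x, x - y⟫ := by
  have hpos : 0 < ‖x - y‖ := norm_pos_iff.2 (sub_ne_zero.2 hne)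
  have hsq := norm_sub_sq_real x y
  rw [inner_sub_right, real_inner_self_eq_norm_sq]
  nlinarith [norm_nonneg y]

variable [FiniteDimensional ℝ V]

/- Otherwise the ray from `f x` through `x` leaves the ball at a point that depends on `x` in a `C¹`
way and equals `x` on the sphere. -/
theorem exists_fixedPoint_closedBall_of_contDiff {f : V → V} (hf : ContDiff ℝ 1 f)
    (hm : MapsTo f (closedBall 0 1) (closedBall 0 1)) : ∃ x ∈ closedBall (0 : V) 1, f x = x := by
  by_contra! hne
  have hu : ContDiff ℝ 1 fun x => x - f x := contDiff_id.sub hf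
  have hune : ∀ x ∈ closedBall (0 : V) 1, x - f x ≠ 0 := fun x hx =>
    sub_ne_zero.2 (hne x hx).symm
  have hinner : ∀ x, ‖x‖ = 1 → 0 < ⟪x, x - f x⟫ := fun x hx =>
    have hxB : x ∈ closedBall (0 : V) 1 := by simp [hx]
    inner_sub_pos_of_norm_le_one hx (by simpa using hm hxB) (hne x hxB).symm
  have hD : ∀ x ∈ closedBall (0 : V) 1, 0 < sphereDiscrim x (x - f x) := fun x hx =>
    sphereDiscrim_pos (by simpa using hx) (hune x hx) (hinner x)
  refine not_exists_contDiffOn_retraction_sphere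
    (O := {x | 0 < sphereDiscrim x (x - f x)} ∩ {x | x - f x ≠ 0})
    ((isOpen_lt continuous_const (contDiff_sphereDiscrim hu).continuous).inter
      (isOpen_ne_fun hu.continuous continuous_const)) (fun x hx => ⟨hD x hx, hune x hx⟩)
    ⟨fun x => sphereExit x (x - f x), ?_, ?_, ?_⟩
  · exact fun x hx => (contDiffAt_sphereExit hu hx.2 hx.1).contDiffWithinAt
  · exact fun x hx => norm_sphereExit (hune x hx) (hD x hx).le
  · exact fun x hx => sphereExit_of_norm_eq_one hx (hinner x hx).le

theorem exists_contDiff_dist_lt_of_mapsTo_closedBall {f : V → V}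
    (hf : ContinuousOn f (closedBall 0 1)) (hm : MapsTo f (closedBall 0 1) (closedBall 0 1))
    {ε : ℝ} (hε : 0 < ε) :
    ∃ g : V → V, ContDiff ℝ 1 g ∧ MapsTo g (closedBall 0 1) (closedBall 0 1) ∧
      ∀ x ∈ closedBall (0 : V) 1, dist (g x) (f x) < ε := by
  have : TietzeExtension V := .of_tvs ℝ
  obtain ⟨F, hF⟩ := ContinuousMap.exists_restrict_eq isClosed_closedBall
    (⟨(closedBall (0 : V) 1).domRestrict f, hf.domRestrict⟩ : C(closedBall (0 : V) 1, V))
  have hFf : ∀ x ∈ closedBall (0 : V) 1, F x = f x := fun x hx =>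
    congrArg (fun G : C(closedBall (0 : V) 1, V) => G ⟨x, hx⟩) hF
  let c := 1 + ε / 2
  obtain ⟨g, hg, hgF, -⟩ := F.continuous.exists_contDiff_approx 1 (ε := fun _ => ε / 2)
    continuous_const fun _ => half_pos hε
  have hgf : ∀ x ∈ closedBall (0 : V) 1, ‖g x - f x‖ < ε / 2 := fun x hx => by
    simpa [hFf x hx, dist_eq_norm] using hgF x
  have hgc : ∀ x ∈ closedBall (0 : V) 1, ‖g x‖ ≤ c := fun x hx => by
    calc ‖g x‖ ≤ ‖f x‖ + ‖g x - f x‖ := norm_le_norm_add_norm_sub' _ _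
      _ ≤ 1 + ε / 2 := add_le_add (mem_closedBall_zero_iff.1 (hm hx)) (hgf x hx).le
  have hc : 0 < c := by positivity
  refine ⟨fun x => c⁻¹ • g x, hg.const_smul _, fun x hx => ?_, fun x hx => ?_⟩
  · rw [mem_closedBall_zero_iff, norm_smul, Real.norm_of_nonneg (by positivity),
      inv_mul_le_iff₀ hc, mul_one]
    exact hgc x hx
  · have hscale : ‖c⁻¹ • g x - g x‖ ≤ ε / 2 := by
      have hmul : c⁻¹ • g x - g x = (1 - c) • c⁻¹ • g x := by
        rw [sub_smul, one_smul, smul_inv_smul₀ hc.ne']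
      rw [hmul, norm_smul, norm_smul, norm_inv, Real.norm_of_nonneg hc.le, sub_add_cancel_left,
        norm_neg, Real.norm_of_nonneg (half_pos hε).le]
      exact mul_le_of_le_one_right (half_pos hε).le (inv_mul_le_one_of_le₀ (hgc x hx) hc.le)
    rw [dist_eq_norm]
    linarith [norm_sub_le_norm_sub_add_norm_sub (c⁻¹ • g x) (g x) (f x), hgf x hx]

/-- **Brouwer's fixed point theorem** for the closed unit ball. -/
theorem exists_fixedPoint_closedBall_of_continuousOn {f : V → V}
    (hf : ContinuousOn f (closedBall 0 1)) (hm : MapsTo f (closedBall 0 1) (closedBall 0 1)) :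
    ∃ x ∈ closedBall (0 : V) 1, f x = x := by
  by_contra! hne
  obtain ⟨x₀, hx₀, hmin⟩ := (isCompact_closedBall (0 : V) 1).exists_isMinOn ⟨0, by simp⟩
    (continuousOn_id.sub hf).norm
  obtain ⟨g, hg, hgm, hgf⟩ := exists_contDiff_dist_lt_of_mapsTo_closedBall hf hm
    (norm_pos_iff.2 (sub_ne_zero.2 (hne x₀ hx₀).symm))
  obtain ⟨x, hx, hfix⟩ := exists_fixedPoint_closedBall_of_contDiff hg hgm
  have hlt := hgf x hx
  rw [hfix, dist_eq_norm] at hlt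
  exact absurd (hmin hx) (not_le.2 hlt)

end Brouwer

section InvarianceOfDomain

variable {V : Type*} [NormedAddCommGroup V]

section

variable [NormedSpace ℝ V]

/-- The map that pushes the punctured ball of radius `ε` about `c` radially onto the sphere and
fixes its complement. -/
noncomputable def pushOut (c : V) (ε : ℝ) (y : V) : V := c + max (ε / dist y c) 1 • (y - c)

theorem pushOut_of_le_dist {c y : V} {ε : ℝ} (hε : 0 < ε) (hy : ε ≤ dist y c) :
    pushOut c ε y = y := by
  rw [pushOut, max_eq_right ((div_le_one (hε.trans_le hy)).2 hy), one_smul, add_sub_cancel]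

theorem dist_pushOut {c y : V} {ε : ℝ} (hy : dist y c ≤ ε) (hne : y ≠ c) :
    dist (pushOut c ε y) c = ε := by
  have hpos : 0 < dist y c := dist_pos.2 hne
  rw [pushOut, max_eq_left ((one_le_div hpos).2 hy), dist_eq_norm, add_sub_cancel_left, norm_smul,
    Real.norm_of_nonneg (div_nonneg (hpos.le.trans hy) hpos.le), ← dist_eq_norm,
    div_mul_cancel₀ _ hpos.ne']

theorem continuousOn_pushOut (c : V) (ε : ℝ) : ContinuousOn (pushOut c ε) {c}ᶜ := by
  refine continuousOn_const.add (ContinuousOn.smul (ContinuousOn.sup ?_ continuousOn_const)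
    (by fun_prop))
  exact continuousOn_const.div (by fun_prop) fun y hy => (dist_pos.2 hy).ne'

theorem exists_contDiff_dist_lt_ne_zero [FiniteDimensional ℝ V] [MeasurableSpace V] [BorelSpace V]
    (μ : Measure V) [μ.IsAddHaarMeasure] {G : V → V} (hG : Continuous G) {N : Set V}
    (hN : μ N = 0) {δ : ℝ} (hδ : 0 < δ) :
    ∃ P : V → V, ContDiff ℝ 1 P ∧ (∀ y, dist (P y) (G y) < δ) ∧ ∀ y ∈ N, P y ≠ 0 := by
  obtain ⟨P, hP, hPG, -⟩ := hG.exists_contDiff_approx 1 (ε := fun _ => δ / 2)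
    continuous_const fun _ => half_pos hδ
  -- a generic small translate of `P` avoids `0` on `N`
  have hnull : μ (P '' N) = 0 := addHaar_image_eq_zero_of_differentiableOn_of_addHaar_eq_zero _
    (hP.differentiable one_ne_zero).differentiableOn hN
  obtain ⟨w, hw, hwP⟩ : ∃ w ∈ ball (0 : V) (δ / 2), w ∉ P '' N := by
    by_contra! hall
    exact (measure_ball_pos μ (0 : V) (half_pos hδ)).ne' (measure_mono_null hall hnull)
  refine ⟨fun y => P y - w, hP.sub contDiff_const, fun y => ?_, fun y hy h => ?_⟩
  · have hshift : dist (P y - w) (P y) < δ / 2 := by simpa [dist_eq_norm] using hw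
    linarith [dist_triangle (P y - w) (P y) (G y), hPG y]
  · exact hwP ⟨y, hy, sub_eq_zero.1 h⟩

theorem exists_continuousOn_ne_zero_norm_sub_le [FiniteDimensional ℝ V] {Q : Set V}
    (hQ : IsCompact Q) {c : V} (hc : c ∉ Q) {G : V → V} (hG : Continuous G) {ε η : ℝ} (hε : 0 < ε)
    (hη : 0 < η) (hsmall : ∀ y, dist y c ≤ ε → ‖G y‖ < η)
    (hG0 : ∀ y ∈ Q, ε ≤ dist y c → G y ≠ 0) :
    ∃ H : V → V, ContinuousOn H Q ∧ (∀ y ∈ Q, ‖G y - H y‖ ≤ 3 * η) ∧ ∀ y ∈ Q, H y ≠ 0 := by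
  borelize V
  obtain ⟨δ, hδ, hδG⟩ : ∃ δ > 0, ∀ y ∈ Q ∩ {y | ε ≤ dist y c}, δ ≤ ‖G y‖ :=
    (hQ.inter_right (isClosed_le continuous_const (by fun_prop))).exists_forall_le'
      hG.norm.continuousOn fun y hy => norm_pos_iff.2 (hG0 y hy.1 hy.2)
  obtain ⟨P, hP, hPG, hPne⟩ := exists_contDiff_dist_lt_ne_zero Measure.addHaar hG
    (Measure.addHaar_sphere_of_ne_zero Measure.addHaar c hε.ne') (lt_min hδ hη)
  have hne : ∀ y ∈ Q, y ≠ c := fun y hy h => hc (h ▸ hy)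
  have hGP : ∀ y, ‖G y - P y‖ < δ ∧ ‖G y - P y‖ < η := fun y => by
    simpa [dist_eq_norm, norm_sub_rev] using hPG y
  refine ⟨P ∘ pushOut c ε,
    hP.continuous.comp_continuousOn ((continuousOn_pushOut c ε).mono hne), fun y hy => ?_,
    fun y hy h0 => ?_⟩
  · rw [Function.comp_apply]
    rcases le_total ε (dist y c) with h | h
    · rw [pushOut_of_le_dist hε h]
      linarith [(hGP y).2]
    · have hz := hsmall _ (dist_pushOut h (hne y hy)).le
      linarith [hsmall y h, (hGP (pushOut c ε y)).2, norm_sub_le (G y) (G (pushOut c ε y)),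
        norm_sub_le_norm_sub_add_norm_sub (G y) (G (pushOut c ε y)) (P (pushOut c ε y))]
  · rw [Function.comp_apply] at h0
    rcases le_or_gt ε (dist y c) with h | h
    · rw [pushOut_of_le_dist hε h] at h0
      have hlt := (hGP y).1
      rw [h0, sub_zero] at hlt
      exact not_le.2 hlt (hδG y ⟨hy, h⟩)
    · exact hPne _ (dist_pushOut h.le (hne y hy)) h0

theorem exists_continuous_leftInvOn {X : Type*} [TopologicalSpace X] [NormalSpace X] [T2Space X]
    [FiniteDimensional ℝ V] {K : Set V} (hK : IsCompact K) {f : V → X} (hf : ContinuousOn f K)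
    (hinj : InjOn f K) : ∃ G : X → V, Continuous G ∧ LeftInvOn G f K := by
  have : TietzeExtension V := .of_tvs ℝ
  have : CompactSpace K := isCompact_iff_compactSpace.1 hK
  obtain ⟨G, hG⟩ := ContinuousMap.exists_extension
    (hf.domRestrict.isClosedEmbedding (injOn_iff_injective.1 hinj))
    (⟨Subtype.val, continuous_subtype_val⟩ : C(K, V))
  exact ⟨G, G.continuous, fun x hx => congrArg (fun H : C(K, V) => H ⟨x, hx⟩) hG⟩

end

variable [InnerProductSpace ℝ V] [FiniteDimensional ℝ V]

/- `x - H (f x)` maps the ball into itself, and its fixed points are the zeros of `H ∘ f`. -/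
theorem exists_eq_zero_of_norm_sub_leftInvOn_le {X : Type*} [TopologicalSpace X] {f : V → X}
    (hf : ContinuousOn f (closedBall 0 1)) {G H : X → V} (hG : LeftInvOn G f (closedBall 0 1))
    (hH : ContinuousOn H (f '' closedBall 0 1))
    (hGH : ∀ y ∈ f '' closedBall 0 1, ‖G y - H y‖ ≤ 1) : ∃ y ∈ f '' closedBall 0 1, H y = 0 := by
  obtain ⟨x, hx, hfix⟩ := exists_fixedPoint_closedBall_of_continuousOn
    (f := fun x => x - H (f x)) (continuousOn_id.sub (hH.comp hf (mapsTo_image _ _)))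
    fun x hx => by simpa [hG hx] using hGH (f x) (mem_image_of_mem _ hx)
  exact ⟨f x, mem_image_of_mem _ hx, by simpa using hfix⟩

/- If the image `Q` of the ball were not a neighbourhood of `f 0`, it would miss a point `c` close
to `f 0`, and a small perturbation of the inverse `G` of `f`, composed with the radial projection
away from `c`, would be a zero-free map on `Q` at distance at most `1` from `G`. -/
theorem image_closedBall_mem_nhds {f : V → V} (hf : ContinuousOn f (closedBall 0 1))
    (hinj : InjOn f (closedBall 0 1)) : f '' closedBall 0 1 ∈ 𝓝 (f 0) := by
  have hcompact : IsCompact (closedBall (0 : V) 1) := isCompact_closedBall _ _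
  have h0 : (0 : V) ∈ closedBall (0 : V) 1 := by simp
  set Q := f '' closedBall 0 1
  have hQ : IsCompact Q := hcompact.image_of_continuousOn hf
  obtain ⟨G, hGc, hGf⟩ := exists_continuous_leftInvOn hcompact hf hinj
  by_contra hnot
  obtain ⟨ε, hε, hGε⟩ : ∃ ε > 0, ∀ y, dist y (f 0) < 2 * ε → ‖G y‖ < 1 / 10 := by
    obtain ⟨η, hη, hGη⟩ := Metric.continuousAt_iff.1 (hGc.continuousAt (x := f 0)) (1 / 10)
      (by norm_num)
    refine ⟨η / 2, half_pos hη, fun y hy => ?_⟩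
    simpa [hGf h0] using hGη (hy.trans_eq (by ring))
  obtain ⟨c, hcε, hcQ⟩ : ∃ c, dist c (f 0) < ε ∧ c ∉ Q := by
    by_contra! hall
    exact hnot (Metric.mem_nhds_iff.2 ⟨ε, hε, fun c hc => hall c hc⟩)
  have hsmall : ∀ y, dist y c ≤ ε → ‖G y‖ < 1 / 10 := fun y hy =>
    hGε y (by linarith [dist_triangle y c (f 0)])
  obtain ⟨H, hH, hGH, hH0⟩ := exists_continuousOn_ne_zero_norm_sub_le hQ hcQ hGc hε
    (by norm_num : (0 : ℝ) < 1 / 10) hsmall <| by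
      rintro _ ⟨x, hx, rfl⟩ hy h
      rw [hGf hx] at h
      rw [h, dist_comm] at hy
      exact not_lt.2 hy hcε
  obtain ⟨y, hy, hy0⟩ := exists_eq_zero_of_norm_sub_leftInvOn_le hf hGf hH fun y hy =>
    (hGH y hy).trans (by norm_num)
  exact hH0 y hy hy0

/-- **Invariance of domain**. -/
theorem isOpen_image_of_continuousOn_injOn {U : Set V} (hU : IsOpen U) {f : V → V}
    (hf : ContinuousOn f U) (hinj : InjOn f U) : IsOpen (f '' U) := by
  rw [isOpen_iff_mem_nhds]
  rintro _ ⟨x, hx, rfl⟩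
  obtain ⟨ε, hε, hεU⟩ := nhds_basis_closedBall.mem_iff.1 (hU.mem_nhds hx)
  have hmaps : MapsTo (fun z => x + ε • z) (closedBall 0 1) U := by
    intro z hz
    refine hεU ?_
    rw [mem_closedBall, dist_eq_norm, add_sub_cancel_left, norm_smul, Real.norm_of_nonneg hε.le]
    exact mul_le_of_le_one_right hε.le (by simpa using hz)
  have hnhds := image_closedBall_mem_nhds (f := fun z => f (x + ε • z))
    (hf.comp (by fun_prop) hmaps) fun a ha b hb hab =>
      smul_right_injective V hε.ne' (add_left_cancel (hinj (hmaps ha) (hmaps hb) hab))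
  simp only [smul_zero, add_zero] at hnhds
  refine mem_of_superset hnhds ?_
  rintro _ ⟨z, hz, rfl⟩
  exact mem_image_of_mem f (hmaps hz)

end InvarianceOfDomain

section Schwarz

open ComplexConjugate

theorem norm_add_lt_norm_one_add_conj_mul {b ζ : ℂ} (hb : ‖b‖ < 1) (hζ : ‖ζ‖ < 1) :
    ‖ζ + b‖ < ‖1 + conj b * ζ‖ := by
  have hdiff : ‖1 + conj b * ζ‖ ^ 2 - ‖ζ + b‖ ^ 2 = (1 - ‖b‖ ^ 2) * (1 - ‖ζ‖ ^ 2) := by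
    simp only [← Complex.normSq_eq_norm_sq, Complex.normSq_apply, Complex.add_re, Complex.add_im,
      Complex.mul_re, Complex.mul_im, Complex.conj_re, Complex.conj_im, Complex.one_re,
      Complex.one_im]
    ring
  have hb' : 0 < 1 - ‖b‖ ^ 2 := by nlinarith [norm_nonneg b]
  have hζ' : 0 < 1 - ‖ζ‖ ^ 2 := by nlinarith [norm_nonneg ζ]
  refine lt_of_pow_lt_pow_left₀ 2 (norm_nonneg _) ?_
  linarith [mul_pos hb' hζ']

theorem norm_sub_lt_norm_add_conj {z w : ℂ} (hz : 0 < z.re) (hw : 0 < w.re) :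
    ‖z - w‖ < ‖z + conj w‖ := by
  have hdiff : ‖z + conj w‖ ^ 2 - ‖z - w‖ ^ 2 = 4 * (z.re * w.re) := by
    simp only [← Complex.normSq_eq_norm_sq, Complex.normSq_apply, Complex.add_re, Complex.add_im,
      Complex.sub_re, Complex.sub_im, Complex.conj_re, Complex.conj_im]
    ring
  refine lt_of_pow_lt_pow_left₀ 2 (norm_nonneg _) ?_
  linarith [mul_pos hz hw]

/- Schwarz's lemma for the composition of `h` with the Cayley map
`w ↦ (w - h 0) / (w + conj (h 0))`. -/
theorem norm_deriv_zero_le_two_mul_re {h : ℂ → ℂ} (hd : DifferentiableOn ℂ h (ball 0 1))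
    (hpos : ∀ ζ ∈ ball (0 : ℂ) 1, 0 < (h ζ).re) : ‖deriv h 0‖ ≤ 2 * (h 0).re := by
  have h0 : (0 : ℂ) ∈ ball (0 : ℂ) 1 := mem_ball_self one_pos
  have hlt : ∀ ζ ∈ ball (0 : ℂ) 1, ‖h ζ - h 0‖ < ‖h ζ + conj (h 0)‖ := fun ζ hζ =>
    norm_sub_lt_norm_add_conj (hpos ζ hζ) (hpos 0 h0)
  have hne : ∀ ζ ∈ ball (0 : ℂ) 1, h ζ + conj (h 0) ≠ 0 := fun ζ hζ =>
    norm_pos_iff.1 ((norm_nonneg _).trans_lt (hlt ζ hζ))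
  set q : ℂ → ℂ := fun ζ => (h ζ - h 0) / (h ζ + conj (h 0)) with hq
  have hqd : DifferentiableOn ℂ q (ball 0 1) := (hd.sub_const _).div (hd.add_const _) hne
  have hqm : MapsTo q (ball 0 1) (closedBall (q 0) 1) := fun ζ hζ => by
    have hq0 : q 0 = 0 := by simp [hq]
    rw [hq0, mem_closedBall_zero_iff, norm_div]
    exact div_le_one_of_le₀ (hlt ζ hζ).le (norm_nonneg _)
  have hre : h 0 + conj (h 0) = ((2 * (h 0).re : ℝ) : ℂ) := Complex.add_conj _
  have hq' : deriv q 0 = deriv h 0 / ((2 * (h 0).re : ℝ) : ℂ) := by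
    have hd0 := (hd.differentiableAt (isOpen_ball.mem_nhds h0)).hasDerivAt
    have hne0 := hne 0 h0
    rw [((hd0.sub_const _).fun_div (hd0.add_const _) hne0).deriv, sub_self, zero_mul, sub_zero, sq,
      mul_div_mul_right _ _ hne0, hre]
  have hschwarz := Complex.norm_deriv_le_one_of_mapsTo_ball hqd hqm one_pos
  have hpos0 : 0 < 2 * (h 0).re := mul_pos two_pos (hpos 0 h0)
  rwa [hq', norm_div, Complex.norm_of_nonneg hpos0.le, div_le_one hpos0] at hschwarz

end Schwarz

section KobayashiMetric

open ComplexConjugate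

variable {n : ℕ} {Ω : Set (Cn n)}

theorem kobayashiMetric_le {x v : Cn n} {φ : ℂ → Cn n} {ξ : ℂ}
    (hφ : DifferentiableOn ℂ φ (ball 0 1)) (hm : MapsTo φ (ball 0 1) Ω) (h0 : φ 0 = x)
    (hv : ξ • deriv φ 0 = v) : kobayashiMetric Ω x v ≤ ‖ξ‖ₑ :=
  iInf_le_of_le φ <| iInf_le_of_le ξ <| iInf_le_of_le hφ <| iInf_le_of_le hm <|
    iInf_le_of_le h0 <| iInf_le_of_le hv le_rfl

theorem kobayashiMetric_smul_le {x v : Cn n} {a : ℂ} (ha : a ≠ 0) :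
    kobayashiMetric Ω x (a • v) ≤ ‖a‖ₑ * kobayashiMetric Ω x v := by
  simp only [kobayashiMetric, ENNReal.mul_iInf_of_ne (enorm_ne_zero.2 ha) enorm_ne_top]
  refine le_iInf fun φ => le_iInf fun ξ => le_iInf fun hφ => le_iInf fun hm => le_iInf fun h0 =>
    le_iInf fun hv => ?_
  rw [← enorm_mul]
  exact kobayashiMetric_le hφ hm h0 (by rw [mul_smul, hv])

/- The competitor is the disc centred at `c`, recentred at `t` by the Möbius map
`ζ ↦ (ζ + b) / (1 + conj b * ζ)` with `b = (t - c) / R`. -/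
theorem kobayashiMetric_le_of_disc {p w : Cn n} {c t : ℂ} {R : ℝ} (ht : ‖t - c‖ < R)
    (hΩ : ∀ z : ℂ, ‖z - c‖ < R → p + z • w ∈ Ω) (a : ℂ) :
    kobayashiMetric Ω (p + t • w) (a • w) ≤
      ENNReal.ofReal (‖a‖ * (R / (R ^ 2 - ‖t - c‖ ^ 2))) := by
  have hR : 0 < R := (norm_nonneg _).trans_lt ht
  have hRC : (R : ℂ) ≠ 0 := by exact_mod_cast hR.ne'
  set b : ℂ := (t - c) / R with hb
  have hbn : ‖b‖ = ‖t - c‖ / R := by rw [hb, norm_div, Complex.norm_of_nonneg hR.le]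
  have hb1 : ‖b‖ < 1 := by rwa [hbn, div_lt_one hR]
  have hden : ∀ ζ ∈ ball (0 : ℂ) 1, ‖ζ + b‖ < ‖1 + conj b * ζ‖ := fun ζ hζ =>
    norm_add_lt_norm_one_add_conj_mul hb1 (mem_ball_zero_iff.1 hζ)
  have hden0 : ∀ ζ ∈ ball (0 : ℂ) 1, 1 + conj b * ζ ≠ 0 := fun ζ hζ =>
    norm_pos_iff.1 ((norm_nonneg _).trans_lt (hden ζ hζ))
  have hmob' : HasDerivAt (fun ζ : ℂ => (ζ + b) / (1 + conj b * ζ)) ((1 - ‖b‖ ^ 2 : ℝ) : ℂ) 0 := by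
    refine (((hasDerivAt_id (0 : ℂ)).add_const b).fun_div
      (((hasDerivAt_id (0 : ℂ)).const_mul (conj b)).const_add 1) (by simp)).congr_deriv ?_
    simp [Complex.mul_conj']
  have hpos : 0 < R * (1 - ‖b‖ ^ 2) := by
    have : 0 < 1 - ‖b‖ ^ 2 := by nlinarith [norm_nonneg b]
    positivity
  refine (kobayashiMetric_le (φ := fun ζ => p + (c + R * ((ζ + b) / (1 + conj b * ζ))) • w)
    (ξ := a / ((R * (1 - ‖b‖ ^ 2) : ℝ) : ℂ)) (fun ζ hζ => ?_) (fun ζ hζ => hΩ _ ?_) ?_ ?_).trans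
    (le_of_eq ?_)
  · have := hden0 ζ hζ
    fun_prop (disch := assumption)
  · rw [add_sub_cancel_left, norm_mul, norm_div, Complex.norm_of_nonneg hR.le]
    exact mul_lt_of_lt_one_right hR ((div_lt_one (norm_pos_iff.2 (hden0 ζ hζ))).2 (hden ζ hζ))
  · simp [hb, mul_div_cancel₀ (t - c) hRC]
  · have hφ' := (((hmob'.const_mul (R : ℂ)).const_add c).smul_const w).const_add p
    rw [hφ'.deriv, smul_smul, ← Complex.ofReal_mul, div_mul_cancel₀]
    exact_mod_cast hpos.ne'
  · rw [← ofReal_norm, norm_div, Complex.norm_of_nonneg hpos.le, hbn]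
    congr 1
    field_simp

theorem kobayashiMetric_zero {z : Cn n} (hz : z ∈ Ω) : kobayashiMetric Ω z 0 = 0 :=
  le_antisymm ((kobayashiMetric_le (φ := fun _ => z) (ξ := 0) (differentiableOn_const _)
    (fun _ _ => hz) rfl (zero_smul _ _)).trans (by simp)) zero_le

theorem kobayashiMetric_le_of_ball {z v : Cn n} {r : ℝ} (hr : 0 < r) (hΩ : ball z r ⊆ Ω) :
    kobayashiMetric Ω z v ≤ ENNReal.ofReal (‖v‖ / r) := by
  rcases eq_or_ne v 0 with rfl | hv
  · simp [kobayashiMetric_zero (hΩ (mem_ball_self hr))]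
  have hv' : 0 < ‖v‖ := norm_pos_iff.2 hv
  have hdisc : ∀ ζ : ℂ, ‖ζ - 0‖ < r / ‖v‖ → z + ζ • v ∈ Ω := fun ζ hζ => hΩ <| by
    rwa [mem_ball, dist_eq_norm, add_sub_cancel_left, norm_smul, ← lt_div_iff₀ hv', ← sub_zero ζ]
  have h := kobayashiMetric_le_of_disc (t := 0) (by simpa using div_pos hr hv') hdisc 1
  rw [zero_smul, add_zero, one_smul] at h
  refine h.trans_eq (congrArg _ ?_)
  simp only [norm_one, sub_zero, norm_zero]
  field_simp
  simp

theorem le_kobayashiMetric_of_halfSpace {L : Cn n →L[ℂ] ℂ} {a : ℂ}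
    (hL : ∀ y ∈ Ω, 0 < (L y - a).re) (z v : Cn n) :
    ENNReal.ofReal (‖L v‖ / (2 * (L z - a).re)) ≤ kobayashiMetric Ω z v := by
  refine le_iInf fun φ => le_iInf fun ξ => le_iInf fun hφ => le_iInf fun hm => le_iInf fun h0 =>
    le_iInf fun hv => ?_
  subst h0 hv
  have hB : (0 : ℂ) ∈ ball (0 : ℂ) 1 := mem_ball_self one_pos
  have hderiv : deriv (fun ζ => L (φ ζ) - a) 0 = L (deriv φ 0) :=
    ((L.hasFDerivAt.comp_hasDerivAt 0
      (hφ.differentiableAt (isOpen_ball.mem_nhds hB)).hasDerivAt).sub_const a).deriv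
  have hschwarz : ‖L (deriv φ 0)‖ ≤ 2 * (L (φ 0) - a).re :=
    hderiv ▸ norm_deriv_zero_le_two_mul_re ((L.differentiable.comp_differentiableOn hφ).sub_const a)
      fun ζ hζ => hL _ (hm hζ)
  rw [← ofReal_norm, map_smul, smul_eq_mul, norm_mul, mul_div_assoc]
  exact ENNReal.ofReal_le_ofReal <| mul_le_of_le_one_right (norm_nonneg _) <|
    div_le_one_of_le₀ hschwarz (mul_pos two_pos (hL _ (hm hB))).le

end KobayashiMetric

section PiecewiseC1

variable {E : Type*} [NormedAddCommGroup E] [NormedSpace ℝ E] {γ γ' : ℝ → E} {a b c : ℝ}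

/-- Piecewise `C¹` curves on an arbitrary interval `[a, b]`, built up one smooth piece at a time;
for `[0, 1]` this is `IsPiecewiseC1`, see `isPiecewiseC1_iff`. -/
inductive IsPiecewiseC1On (γ : ℝ → E) (a : ℝ) : ℝ → Prop
  | refl : IsPiecewiseC1On γ a a
  | snoc {b c : ℝ} (h : IsPiecewiseC1On γ a b) (hbc : b ≤ c) (hC : ContDiffOn ℝ 1 γ (Icc b c)) :
      IsPiecewiseC1On γ a c

theorem isPiecewiseC1_iff {n : ℕ} {γ : ℝ → Cn n} : IsPiecewiseC1 γ ↔ IsPiecewiseC1On γ 0 1 := by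
  constructor
  · rintro ⟨N, t, hmono, h0, h1, hC⟩
    have hpieces : ∀ i ≤ N, IsPiecewiseC1On γ 0 (t i) := by
      intro i hi
      induction i with
      | zero => exact h0 ▸ .refl
      | succ i ih => exact (ih (by omega)).snoc (hmono i.le_succ) (hC i hi)
    exact h1 ▸ hpieces N le_rfl
  · suffices ∀ b, IsPiecewiseC1On γ 0 b → ∃ (N : ℕ) (t : ℕ → ℝ), Monotone t ∧ t 0 = 0 ∧ t N = b ∧
        ∀ i < N, ContDiffOn ℝ 1 γ (Icc (t i) (t (i + 1))) from this 1
    intro b h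
    induction h with
    | refl => exact ⟨0, fun _ => 0, monotone_const, rfl, rfl, by simp⟩
    | @snoc b c _ hbc hC ih =>
      obtain ⟨N, t, hmono, h0, hN, hpieces⟩ := ih
      refine ⟨N + 1, fun i => if i ≤ N then t i else c, fun i j hij => ?_, by simpa using h0,
        by simp, fun i hi => ?_⟩
      · dsimp only
        split_ifs with hi hj
        · exact hmono hij
        · exact (hmono hi).trans (hN.trans_le hbc)
        · omega
        · rfl
      · rcases (Nat.lt_succ_iff.1 hi).lt_or_eq with h | rfl
        · simpa only [h.le, Nat.succ_le_of_lt h, if_true] using hpieces i h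
        · simpa [hN] using hC

namespace IsPiecewiseC1On

theorem le (h : IsPiecewiseC1On γ a b) : a ≤ b := by
  induction h with
  | refl => exact le_rfl
  | snoc _ hbc _ ih => exact ih.trans hbc

theorem of_contDiffOn (hab : a ≤ b) (h : ContDiffOn ℝ 1 γ (Icc a b)) : IsPiecewiseC1On γ a b :=
  refl.snoc hab h

theorem trans (hab : IsPiecewiseC1On γ a b) (hbc : IsPiecewiseC1On γ b c) :
    IsPiecewiseC1On γ a c := by
  induction hbc with
  | refl => exact hab
  | snoc _ hle hC ih => exact ih.snoc hle hC

theorem congr (h : IsPiecewiseC1On γ a b) (heq : EqOn γ' γ (Icc a b)) :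
    IsPiecewiseC1On γ' a b := by
  induction h with
  | refl => exact refl
  | snoc h hbc hC ih =>
    exact (ih (heq.mono (Icc_subset_Icc_right hbc))).snoc hbc
      (hC.congr fun t ht => heq ⟨h.le.trans ht.1, ht.2⟩)

theorem restrict (h : IsPiecewiseC1On γ a b) {s t : ℝ} (hs : a ≤ s) (hst : s ≤ t) (ht : t ≤ b) :
    IsPiecewiseC1On γ s t := by
  induction h generalizing t with
  | refl => exact le_antisymm hst (ht.trans hs) ▸ refl
  | @snoc b c _ _ hC ih =>
    rcases le_total t b with htb | hbt
    · exact ih hst htb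
    rcases le_total b s with hbs | hsb
    · exact of_contDiffOn hst (hC.mono (Icc_subset_Icc hbs ht))
    · exact (ih hsb le_rfl).snoc hbt (hC.mono (Icc_subset_Icc_right ht))

theorem continuousOn (h : IsPiecewiseC1On γ a b) : ContinuousOn γ (Icc a b) := by
  induction h with
  | refl => simp
  | snoc h hbc hC ih =>
    rw [← Icc_union_Icc_eq_Icc h.le hbc]
    exact ih.union_of_isClosed hC.continuousOn isClosed_Icc isClosed_Icc

theorem comp_mul_add {p : ℝ} (hp : 0 < p) (q : ℝ) (h : IsPiecewiseC1On γ a b) :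
    IsPiecewiseC1On (fun t => γ (p * t + q)) ((a - q) / p) ((b - q) / p) := by
  induction h with
  | refl => exact refl
  | @snoc b c _ hbc hC ih =>
    refine ih.snoc (by gcongr) (hC.comp (by fun_prop) fun t ht => ?_)
    have h1 := (div_le_iff₀' hp).1 ht.1
    have h2 := (le_div_iff₀' hp).1 ht.2
    constructor <;> linarith

theorem comp_neg (h : IsPiecewiseC1On γ a b) :
    IsPiecewiseC1On (fun t => γ (-t)) (-b) (-a) := by
  induction h with
  | refl => exact refl
  | snoc _ hbc hC ih =>
    refine (of_contDiffOn (neg_le_neg hbc) (hC.comp (by fun_prop) fun t ht => ?_)).trans ih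
    exact ⟨le_neg.2 ht.2, neg_le.2 ht.1⟩

end IsPiecewiseC1On

end PiecewiseC1

section KobayashiLength

variable {n : ℕ} {Ω : Set (Cn n)} {γ γ' : ℝ → Cn n} {a b c : ℝ}

/-- The Kobayashi length of the restriction of a curve to `[a, b]`; on `[0, 1]` it is
`kobayashiLength` by definition. -/
noncomputable def kobayashiLengthOn (Ω : Set (Cn n)) (γ : ℝ → Cn n) (a b : ℝ) : ℝ≥0∞ :=
  ∫⁻ t in Icc a b, kobayashiMetric Ω (γ t) (deriv γ t)

theorem kobayashiLengthOn_add (hab : a ≤ b) (hbc : b ≤ c) :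
    kobayashiLengthOn Ω γ a b + kobayashiLengthOn Ω γ b c = kobayashiLengthOn Ω γ a c := by
  simp only [kobayashiLengthOn]
  rw [← Icc_union_Ioc_eq_Icc hab hbc, lintegral_union measurableSet_Ioc,
    setLIntegral_congr (Ioc_ae_eq_Icc (a := b) (b := c))]
  exact disjoint_left.2 fun t h1 h2 => absurd h1.2 (not_le.2 h2.1)

theorem kobayashiLengthOn_congr (h : EqOn γ' γ (Ioo a b)) :
    kobayashiLengthOn Ω γ' a b = kobayashiLengthOn Ω γ a b := by
  simp only [kobayashiLengthOn, ← restrict_Ioo_eq_restrict_Icc]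
  refine setLIntegral_congr_fun measurableSet_Ioo fun t ht => ?_
  have hev : γ' =ᶠ[𝓝 t] γ := h.eventuallyEq_of_mem (isOpen_Ioo.mem_nhds ht)
  simp only [h ht, hev.deriv_eq]

theorem setLIntegral_kobayashiMetric_comp_mul_add_le {p : ℝ} (hp : p ≠ 0) (q : ℝ) {s : Set ℝ}
    (hs : MeasurableSet s) :
    ∫⁻ t in s, kobayashiMetric Ω (γ (p * t + q)) (deriv (fun t => γ (p * t + q)) t) ≤
      ∫⁻ t in (fun t => p * t + q) '' s, kobayashiMetric Ω (γ t) (deriv γ t) := by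
  have hderiv : ∀ t, HasDerivAt (fun t => p * t + q) p t := fun t => by
    simpa using ((hasDerivAt_id t).const_mul p).add_const q
  have hinj : InjOn (fun t => p * t + q) s := fun t _ t' _ h => by simpa [hp] using h
  rw [lintegral_image_eq_lintegral_abs_deriv_mul hs (fun t _ => (hderiv t).hasDerivWithinAt) hinj]
  refine lintegral_mono fun t => ?_
  have hchain : deriv (fun t => γ (p * t + q)) t = (p : ℂ) • deriv γ (p * t + q) := by
    rw [deriv_comp_mul_left p (fun t => γ (t + q)), deriv_comp_add_const, Complex.coe_smul]
  rw [hchain, ← Real.norm_eq_abs, ← Complex.norm_real, ofReal_norm]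
  exact kobayashiMetric_smul_le (Complex.ofReal_ne_zero.2 hp)

theorem kobayashiLengthOn_comp_mul_add_le {p : ℝ} (hp : 0 < p) (q : ℝ) :
    kobayashiLengthOn Ω (fun t => γ (p * t + q)) a b ≤
      kobayashiLengthOn Ω γ (p * a + q) (p * b + q) := by
  refine (setLIntegral_kobayashiMetric_comp_mul_add_le hp.ne' q measurableSet_Icc).trans_eq ?_
  rw [kobayashiLengthOn, image_affine_Icc' hp]

theorem kobayashiLengthOn_comp_neg_le :
    kobayashiLengthOn Ω (fun t => γ (-t)) (-b) (-a) ≤ kobayashiLengthOn Ω γ a b := by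
  have h := setLIntegral_kobayashiMetric_comp_mul_add_le (Ω := Ω) (γ := γ)
    (neg_ne_zero.2 one_ne_zero) 0 (measurableSet_Icc (a := -b) (b := -a))
  simpa only [kobayashiLengthOn, neg_one_mul, add_zero, image_neg_Icc, neg_neg] using h

theorem enorm_sub_le_kobayashiLengthOn (hγ : IsPiecewiseC1On γ a b) {h : Cn n → ℝ}
    (hh : ∀ t ∈ Icc a b, ContDiffAt ℝ 1 h (γ t))
    (hle : ∀ t ∈ Icc a b, ∀ v, ‖fderiv ℝ h (γ t) v‖ₑ ≤ kobayashiMetric Ω (γ t) v) :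
    ‖h (γ b) - h (γ a)‖ₑ ≤ kobayashiLengthOn Ω γ a b := by
  induction hγ with
  | refl => simp
  | @snoc b c hab hbc hC ih =>
    have hleft : Icc a b ⊆ Icc a c := Icc_subset_Icc_right hbc
    have hright : Icc b c ⊆ Icc a c := Icc_subset_Icc_left hab.le
    have hpiece : ‖h (γ c) - h (γ b)‖ₑ ≤ kobayashiLengthOn Ω γ b c := by
      have hcomp : ContDiffOn ℝ 1 (h ∘ γ) (Icc b c) := fun t ht =>
        (hh t (hright ht)).comp_contDiffWithinAt t (hC t ht)
      refine (enorm_sub_le_lintegral_deriv_of_contDiffOn_Icc hcomp hbc).trans ?_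
      rw [kobayashiLengthOn, ← restrict_Ioo_eq_restrict_Icc]
      refine setLIntegral_mono' measurableSet_Ioo fun t ht => ?_
      have ht' : t ∈ Icc b c := Ioo_subset_Icc_self ht
      have hγd : DifferentiableAt ℝ γ t :=
        ((hC t ht').contDiffAt (Icc_mem_nhds ht.1 ht.2)).differentiableAt one_ne_zero
      have hhd := (hh t (hright ht')).differentiableAt one_ne_zero
      rw [(hhd.hasFDerivAt.comp_hasDerivAt t hγd.hasDerivAt).deriv]
      exact hle t (hright ht') _
    calc ‖h (γ c) - h (γ a)‖ₑ = ‖(h (γ b) - h (γ a)) + (h (γ c) - h (γ b))‖ₑ := by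
          rw [add_comm, sub_add_sub_cancel]
      _ ≤ ‖h (γ b) - h (γ a)‖ₑ + ‖h (γ c) - h (γ b)‖ₑ := enorm_add_le _ _
      _ ≤ kobayashiLengthOn Ω γ a b + kobayashiLengthOn Ω γ b c :=
          add_le_add (ih (fun t ht => hh t (hleft ht)) fun t ht => hle t (hleft ht)) hpiece
      _ = kobayashiLengthOn Ω γ a c := kobayashiLengthOn_add hab.le hbc

end KobayashiLength

section KobayashiDist

variable {n : ℕ} {Ω : Set (Cn n)} {x y : Cn n}

theorem kobayashiDist_le {γ : ℝ → Cn n} (hγ : IsPiecewiseC1 γ) (hm : MapsTo γ (Icc 0 1) Ω)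
    (h0 : γ 0 = x) (h1 : γ 1 = y) : kobayashiDist Ω x y ≤ kobayashiLength Ω γ :=
  iInf_le_of_le γ <| iInf_le_of_le hγ <| iInf_le_of_le hm <| iInf_le_of_le h0 <|
    iInf_le_of_le h1 le_rfl

theorem le_kobayashiDist {d : ℝ≥0∞} (h : ∀ γ : ℝ → Cn n, IsPiecewiseC1On γ 0 1 →
    MapsTo γ (Icc 0 1) Ω → γ 0 = x → γ 1 = y → d ≤ kobayashiLengthOn Ω γ 0 1) :
    d ≤ kobayashiDist Ω x y :=
  le_iInf fun γ => le_iInf fun hγ => le_iInf fun hm => le_iInf fun h0 => le_iInf fun h1 =>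
    h γ (isPiecewiseC1_iff.1 hγ) hm h0 h1

theorem kobayashiDist_le_kobayashiLengthOn {γ : ℝ → Cn n} {a b : ℝ} (hab : a < b)
    (hγ : IsPiecewiseC1On γ a b) (hm : MapsTo γ (Icc a b) Ω) :
    kobayashiDist Ω (γ a) (γ b) ≤ kobayashiLengthOn Ω γ a b := by
  have hp : 0 < b - a := sub_pos.2 hab
  have hb : (b - a) * 1 + a = b := by ring
  have hγ' : IsPiecewiseC1On (fun t => γ ((b - a) * t + a)) 0 1 := by
    simpa [hp.ne'] using hγ.comp_mul_add hp a
  refine (kobayashiDist_le (isPiecewiseC1_iff.2 hγ') (fun t ht => hm ?_) (by simp) (by simp)).trans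
    ((kobayashiLengthOn_comp_mul_add_le hp a).trans_eq (by rw [mul_zero, zero_add, hb]))
  exact ⟨by nlinarith [ht.1], by nlinarith [ht.2]⟩

theorem kobayashiDist_le_of_segment (hm : ∀ t ∈ Icc (0 : ℝ) 1, x + t • (y - x) ∈ Ω) :
    kobayashiDist Ω x y ≤
      ∫⁻ t in Icc (0 : ℝ) 1, kobayashiMetric Ω (x + t • (y - x)) (y - x) := by
  have hderiv : ∀ t : ℝ, HasDerivAt (fun t : ℝ => x + t • (y - x)) (y - x) t := fun t => by
    simpa using ((hasDerivAt_id t).smul_const (y - x)).const_add x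
  have hγ : IsPiecewiseC1On (fun t : ℝ => x + t • (y - x)) 0 1 :=
    .of_contDiffOn zero_le_one (by fun_prop)
  simpa [kobayashiLengthOn, (hderiv _).deriv] using
    kobayashiDist_le_kobayashiLengthOn zero_lt_one hγ hm

theorem kobayashiDist_self {x : Cn n} (hx : x ∈ Ω) : kobayashiDist Ω x x = 0 := by
  refine le_antisymm ((kobayashiDist_le_of_segment (by simpa using fun _ _ _ => hx)).trans ?_)
    zero_le
  simp [kobayashiMetric_zero hx]

theorem kobayashiDist_comm_le (x y : Cn n) : kobayashiDist Ω x y ≤ kobayashiDist Ω y x := by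
  refine le_kobayashiDist fun γ hγ hm h0 h1 => ?_
  have hrev := kobayashiDist_le_kobayashiLengthOn (neg_lt_neg zero_lt_one) hγ.comp_neg
    fun t ht => hm ⟨by linarith [ht.2], by linarith [ht.1]⟩
  rw [neg_neg, neg_zero, neg_zero, h0, h1] at hrev
  exact hrev.trans (by simpa using kobayashiLengthOn_comp_neg_le (a := (0 : ℝ)) (b := 1))

theorem kobayashiDist_comm (x y : Cn n) : kobayashiDist Ω x y = kobayashiDist Ω y x :=
  (kobayashiDist_comm_le x y).antisymm (kobayashiDist_comm_le y x)

theorem kobayashiDist_le_add_kobayashiLengthOn {γ₁ γ₂ : ℝ → Cn n} (h₁ : IsPiecewiseC1On γ₁ 0 1)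
    (hm₁ : MapsTo γ₁ (Icc 0 1) Ω) (h₂ : IsPiecewiseC1On γ₂ 0 1) (hm₂ : MapsTo γ₂ (Icc 0 1) Ω)
    (heq : γ₁ 1 = γ₂ 0) :
    kobayashiDist Ω (γ₁ 0) (γ₂ 1) ≤ kobayashiLengthOn Ω γ₁ 0 1 + kobayashiLengthOn Ω γ₂ 0 1 := by
  set γ : ℝ → Cn n := fun t => if t ≤ 1 then γ₁ t else γ₂ (1 * t + -1) with hγ
  have heq₁ : EqOn γ γ₁ (Icc 0 1) := fun t ht => if_pos ht.2
  have heq₂ : EqOn γ (fun t => γ₂ (1 * t + -1)) (Icc 1 2) := by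
    intro t ht
    rcases ht.1.eq_or_lt with rfl | h
    · simpa [hγ] using heq
    · exact if_neg (not_le.2 h)
  have hγ₂ : IsPiecewiseC1On (fun t => γ₂ (1 * t + -1)) 1 2 := by
    convert h₂.comp_mul_add one_pos (-1) using 1 <;> norm_num
  have hm : MapsTo γ (Icc 0 2) Ω := by
    intro t ht
    rcases le_total t 1 with h | h
    · rw [heq₁ ⟨ht.1, h⟩]
      exact hm₁ ⟨ht.1, h⟩
    · rw [heq₂ ⟨h, ht.2⟩]
      exact hm₂ ⟨by linarith, by linarith [ht.2]⟩
  have hlen₂ : kobayashiLengthOn Ω (fun t => γ₂ (1 * t + -1)) 1 2 ≤ kobayashiLengthOn Ω γ₂ 0 1 :=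
    (kobayashiLengthOn_comp_mul_add_le one_pos (-1)).trans_eq (by norm_num)
  have hend : γ 2 = γ₂ 1 := (heq₂ ⟨one_le_two, le_rfl⟩).trans (by norm_num)
  have hd := kobayashiDist_le_kobayashiLengthOn two_pos
    ((h₁.congr heq₁).trans (hγ₂.congr heq₂)) hm
  rw [heq₁ ⟨le_rfl, zero_le_one⟩, hend,
    ← kobayashiLengthOn_add zero_le_one one_le_two,
    kobayashiLengthOn_congr (heq₁.mono Ioo_subset_Icc_self),
    kobayashiLengthOn_congr (heq₂.mono Ioo_subset_Icc_self)] at hd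
  exact hd.trans (by gcongr)

theorem kobayashiDist_triangle (x y z : Cn n) :
    kobayashiDist Ω x z ≤ kobayashiDist Ω x y + kobayashiDist Ω y z := by
  conv_rhs => simp only [kobayashiDist, ENNReal.iInf_add, ENNReal.add_iInf]
  refine le_iInf fun γ₂ => le_iInf fun h₂ => le_iInf fun hm₂ => le_iInf fun h20 =>
    le_iInf fun h21 => le_iInf fun γ₁ => le_iInf fun h₁ => le_iInf fun hm₁ => le_iInf fun h10 =>
    le_iInf fun h11 => ?_
  rw [← h10, ← h21]
  exact kobayashiDist_le_add_kobayashiLengthOn (isPiecewiseC1_iff.1 h₁) hm₁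
    (isPiecewiseC1_iff.1 h₂) hm₂ (h11.trans h20.symm)

end KobayashiDist

section LowerBounds

variable {n : ℕ} {Ω : Set (Cn n)} {m : ℝ}

theorem notMem_of_mem_frontier (ho : IsOpen Ω) {p : Cn n} (hp : p ∈ frontier Ω) : p ∉ Ω := by
  rw [ho.frontier_eq] at hp
  exact hp.2

theorem ball_bdryDist_subset (ho : IsOpen Ω) {x : Cn n} (hx : x ∈ Ω) :
    ball x (bdryDist Ω x) ⊆ Ω := by
  rcases le_or_gt (bdryDist Ω x) 0 with h0 | h0
  · simp [ball_eq_empty.2 h0]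
  refine (convex_ball x _).isPreconnected.subset_of_closure_inter_subset ho
    ⟨x, mem_ball_self h0, hx⟩ fun y hy => ?_
  by_contra hyΩ
  exact disjoint_left.1 disjoint_ball_infDist hy.2 ⟨hy.1, by rwa [ho.interior_eq]⟩

theorem frontier_inter_line_nonempty (hb : Bornology.IsBounded Ω) {x v : Cn n} (hx : x ∈ Ω)
    (hv : v ≠ 0) : (frontier Ω ∩ range fun c : ℂ => x + c • v).Nonempty := by
  have hdiff : Differentiable ℂ fun c : ℂ => x + c • v := by fun_prop
  have hne : (fun c : ℂ => x + c • v) ⁻¹' Ω ≠ univ := fun huniv => by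
    have hrange := hb.subset (range_subset_iff.2 fun c => huniv.ge (mem_univ c))
    exact hv (by simpa using hdiff.apply_eq_apply_of_bounded hrange 1 0)
  obtain ⟨c, hc⟩ := nonempty_frontier_iff.2 ⟨⟨0, by simpa using hx⟩, hne⟩
  exact ⟨_, hdiff.continuous.frontier_preimage_subset Ω hc, c, rfl⟩

theorem frontier_nonempty_of_isBounded (hb : Bornology.IsBounded Ω) (hne : Ω.Nonempty)
    (hn : 0 < n) : (frontier Ω).Nonempty := by
  obtain ⟨x, hx⟩ := hne
  have hv : EuclideanSpace.single (⟨0, hn⟩ : Fin n) (1 : ℂ) ≠ 0 := by simp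
  exact (frontier_inter_line_nonempty hb hx hv).mono inter_subset_left

theorem bdryDist_pos (ho : IsOpen Ω) (hb : Bornology.IsBounded Ω) (hn : 0 < n) {x : Cn n}
    (hx : x ∈ Ω) : 0 < bdryDist Ω x :=
  (isClosed_frontier.notMem_iff_infDist_pos (frontier_nonempty_of_isBounded hb ⟨x, hx⟩ hn)).1
    fun hf => notMem_of_mem_frontier ho hf hx

theorem exists_bdryDist_le (hb : Bornology.IsBounded Ω) (hne : Ω.Nonempty) (hn : 0 < n) :
    ∃ D : ℝ, 0 < D ∧ ∀ z ∈ Ω, bdryDist Ω z ≤ D := by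
  obtain ⟨p, hp⟩ := frontier_nonempty_of_isBounded hb hne hn
  obtain ⟨R, hR0, hR⟩ := hb.exists_pos_norm_le
  refine ⟨R + ‖p‖, by positivity, fun z hz => (infDist_le_dist_of_mem hp).trans ?_⟩
  rw [dist_eq_norm]
  exact (norm_sub_le _ _).trans (by linarith [hR z hz])

section SupportingFunctional

theorem exists_support_of_mem_frontier (hc : Convex ℝ Ω) (ho : IsOpen Ω) {p : Cn n}
    (hp : p ∈ frontier Ω) :
    ∃ L : Cn n →L[ℂ] ℂ, ‖L‖ = 1 ∧ ∀ y ∈ Ω, 0 < (L y - L p).re := by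
  obtain ⟨f, hf⟩ := RCLike.geometric_hahn_banach_open_point (𝕜 := ℂ) hc ho
    (notMem_of_mem_frontier ho hp)
  simp only [RCLike.re_to_complex] at hf
  have hf0 : 0 < ‖f‖ := norm_pos_iff.2 <| by
    rintro rfl
    obtain ⟨x, hx⟩ := closure_nonempty_iff.1 ⟨p, frontier_subset_closure hp⟩
    simpa using hf x hx
  refine ⟨((-‖f‖⁻¹ : ℝ) : ℂ) • f, ?_, fun y hy => ?_⟩
  · rw [norm_smul, Complex.norm_real, norm_neg, norm_inv, norm_norm, inv_mul_cancel₀ hf0.ne']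
  · simp only [smul_apply, smul_eq_mul, Complex.sub_re, Complex.re_ofReal_mul]
    nlinarith [mul_pos (inv_pos.2 hf0) (sub_pos.2 (hf y hy))]

theorem norm_mul_le_of_forall_ball {L : Cn n →L[ℂ] ℂ} {a : ℂ} {y : Cn n} {r : ℝ} (hr : 0 < r)
    (hL : ∀ z ∈ ball y r, 0 < (L z - a).re) : ‖L‖ * r ≤ (L y - a).re := by
  by_contra! hlt
  have hpos := hL y (mem_ball_self hr)
  have hL0 : 0 < ‖L‖ := pos_of_mul_pos_left (hpos.trans hlt) hr.le
  -- moving against the gradient `w` of `L` decreases the real part of `L` as fast as possible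
  set w := (InnerProductSpace.toDual ℂ (Cn n)).symm L
  have hwn : ‖w‖ = ‖L‖ := LinearIsometryEquiv.norm_map _ _
  have hLw : L w = (‖L‖ : ℂ) ^ 2 := by
    rw [← hwn]
    exact InnerProductSpace.toDual_symm_apply.symm.trans (inner_self_eq_norm_sq_to_K w)
  set t : ℝ := (L y - a).re / ‖L‖ ^ 2 with ht
  have hmem : y - (t : ℂ) • w ∈ ball y r := by
    rw [mem_ball, dist_eq_norm, sub_sub_cancel_left, norm_neg, norm_smul, Complex.norm_real,
      Real.norm_of_nonneg (by positivity), hwn, ht, div_mul_eq_mul_div, div_lt_iff₀ (by positivity)]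
    nlinarith
  refine lt_irrefl (0 : ℝ) ((hL _ hmem).trans_eq ?_)
  rw [map_sub, map_smul, hLw, sub_right_comm, Complex.sub_re, smul_eq_mul]
  norm_cast
  rw [ht, div_mul_cancel₀ _ (by positivity), sub_self]

theorem exists_support_nearest (hc : Convex ℝ Ω) (ho : IsOpen Ω) (hb : Bornology.IsBounded Ω)
    (hn : 0 < n) {x : Cn n} (hx : x ∈ Ω) :
    ∃ (L : Cn n →L[ℂ] ℂ) (a : ℂ), (∀ y ∈ Ω, 0 < (L y - a).re) ∧
      (∀ y ∈ Ω, bdryDist Ω y ≤ (L y - a).re) ∧ (L x - a).re = bdryDist Ω x := by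
  obtain ⟨p, hp, hxp⟩ := isClosed_frontier.exists_infDist_eq_dist
    (frontier_nonempty_of_isBounded hb ⟨x, hx⟩ hn) x
  obtain ⟨L, hL1, hpos⟩ := exists_support_of_mem_frontier hc ho hp
  have hle : ∀ y ∈ Ω, bdryDist Ω y ≤ (L y - L p).re := fun y hy => by
    simpa [hL1] using norm_mul_le_of_forall_ball (bdryDist_pos ho hb hn hy) fun z hz =>
      hpos z (ball_bdryDist_subset ho hy hz)
  refine ⟨L, L p, hpos, hle, (hle x hx).antisymm' ?_⟩
  calc (L x - L p).re ≤ ‖L (x - p)‖ := by rw [map_sub]; exact Complex.re_le_norm _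
    _ ≤ ‖x - p‖ := by simpa [hL1] using L.le_opNorm (x - p)
    _ = bdryDist Ω x := by rw [bdryDist, hxp, dist_eq_norm]

end SupportingFunctional

section LengthEstimates

variable {γ : ℝ → Cn n} {a b : ℝ}

theorem enorm_half_log_sub_le_kobayashiLengthOn {L : Cn n →L[ℂ] ℂ} {α : ℂ}
    (hL : ∀ y ∈ Ω, 0 < (L y - α).re) (hγ : IsPiecewiseC1On γ a b) (hm : MapsTo γ (Icc a b) Ω) :
    ‖1 / 2 * Real.log ((L (γ b) - α).re) - 1 / 2 * Real.log ((L (γ a) - α).re)‖ₑ ≤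
      kobayashiLengthOn Ω γ a b := by
  have hd : ∀ z : Cn n, HasFDerivAt (fun z => (L z - α).re)
      (Complex.reCLM.comp (L.restrictScalars ℝ)) z := fun z =>
    Complex.reCLM.hasFDerivAt.comp z ((L.restrictScalars ℝ).hasFDerivAt.sub_const α)
  have hc : ContDiff ℝ 1 fun z : Cn n => (L z - α).re :=
    Complex.reCLM.contDiff.comp ((L.restrictScalars ℝ).contDiff.sub contDiff_const)
  refine enorm_sub_le_kobayashiLengthOn (h := fun z => 1 / 2 * Real.log ((L z - α).re)) hγ
    (fun t ht => contDiffAt_const.mul (hc.contDiffAt.log (hL _ (hm ht)).ne')) fun t ht v => ?_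
  have hpos := hL _ (hm ht)
  refine le_trans ?_ (le_kobayashiMetric_of_halfSpace hL (γ t) v)
  rw [(((hd (γ t)).log hpos.ne').const_mul (1 / 2)).fderiv, ← ofReal_norm]
  refine ENNReal.ofReal_le_ofReal ?_
  calc ‖1 / 2 * ((L (γ t) - α).re⁻¹ * (L v).re)‖
      = |(L v).re| / (2 * (L (γ t) - α).re) := by
        rw [Real.norm_eq_abs, abs_mul, abs_mul, abs_inv, abs_of_pos hpos, abs_of_pos one_half_pos]
        field_simp
    _ ≤ ‖L v‖ / (2 * (L (γ t) - α).re) := by gcongr; exact Complex.abs_re_le_norm _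

theorem norm_fderiv_log_norm_sub_le {x z : Cn n} (hz : z ≠ x) (v : Cn n) :
    ‖fderiv ℝ (fun z => Real.log ‖z - x‖) z v‖ ≤ ‖v‖ / ‖z - x‖ := by
  have hz0 : z - x ≠ 0 := sub_ne_zero.2 hz
  have hd : DifferentiableAt ℝ (fun z => ‖z - x‖) z :=
    (differentiableAt_id.sub_const x).norm ℝ hz0
  have hlip : LipschitzWith 1 fun z : Cn n => ‖z - x‖ := by
    simpa only [dist_eq_norm] using LipschitzWith.dist_left x
  have hle : ‖fderiv ℝ (fun z => ‖z - x‖) z v‖ ≤ ‖v‖ := by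
    simpa using (ContinuousLinearMap.le_opNorm _ v).trans
      (mul_le_mul_of_nonneg_right (norm_fderiv_le_of_lipschitz ℝ hlip) (norm_nonneg v))
  rw [(hd.hasFDerivAt.log (norm_ne_zero_iff.2 hz0)).fderiv, smul_apply,
    norm_smul, norm_inv, norm_norm, inv_mul_eq_div]
  gcongr

theorem enorm_log_norm_sub_le_kobayashiLengthOn {x : Cn n} {k : ℝ} (hk : 0 ≤ k)
    (hγ : IsPiecewiseC1On γ a b) (hne : ∀ t ∈ Icc a b, γ t ≠ x)
    (hle : ∀ t ∈ Icc a b, ∀ v, ENNReal.ofReal (k * (‖v‖ / ‖γ t - x‖)) ≤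
      kobayashiMetric Ω (γ t) v) :
    ‖k * Real.log ‖γ b - x‖ - k * Real.log ‖γ a - x‖‖ₑ ≤ kobayashiLengthOn Ω γ a b := by
  have hc : ∀ t ∈ Icc a b, ContDiffAt ℝ 1 (fun z => Real.log ‖z - x‖) (γ t) := fun t ht =>
    have h0 : γ t - x ≠ 0 := sub_ne_zero.2 (hne t ht)
    ((contDiffAt_id.sub contDiffAt_const).norm ℝ h0).log (norm_ne_zero_iff.2 h0)
  refine enorm_sub_le_kobayashiLengthOn (h := fun z => k * Real.log ‖z - x‖) hγ
    (fun t ht => contDiffAt_const.mul (hc t ht)) fun t ht v => le_trans ?_ (hle t ht v)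
  rw [(((hc t ht).differentiableAt one_ne_zero).hasFDerivAt.const_mul k).fderiv, ← ofReal_norm,
    smul_apply, norm_smul, Real.norm_of_nonneg hk]
  exact ENNReal.ofReal_le_ofReal
    (mul_le_mul_of_nonneg_left (norm_fderiv_log_norm_sub_le (hne t ht) v) hk)

theorem ofReal_mul_norm_sub_le_kobayashiDist {c : ℝ} (hc : 0 ≤ c)
    (hK : ∀ z ∈ Ω, ∀ v, ENNReal.ofReal (c * ‖v‖) ≤ kobayashiMetric Ω z v) (x y : Cn n) :
    ENNReal.ofReal (c * ‖x - y‖) ≤ kobayashiDist Ω x y := by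
  refine le_kobayashiDist fun γ hγ hm h0 h1 => ?_
  obtain ⟨L, hL1, hLe⟩ := exists_dual_vector'' ℝ (y - x)
  refine le_trans ?_ (enorm_sub_le_kobayashiLengthOn (h := fun z => c * L z) hγ
    (fun t _ => (contDiff_const.mul L.contDiff).contDiffAt) fun t ht v => ?_)
  · rw [h0, h1, ← mul_sub, ← map_sub, hLe, ← ofReal_norm, norm_sub_rev x y]
    exact ENNReal.ofReal_le_ofReal (le_abs_self _)
  · refine le_trans ?_ (hK _ (hm ht) v)
    rw [(L.hasFDerivAt.const_mul c).fderiv, ← ofReal_norm, smul_apply,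
      norm_smul, Real.norm_of_nonneg hc]
    have hLv : ‖L v‖ ≤ ‖v‖ := by
      simpa using L.le_of_opNorm_le hL1 v
    gcongr

end LengthEstimates

theorem exists_norm_sub_le_kobayashiDist (hb : Bornology.IsBounded Ω) :
    ∃ c : ℝ, 0 < c ∧ ∀ x y, ENNReal.ofReal (c * ‖x - y‖) ≤ kobayashiDist Ω x y := by
  obtain ⟨R, hR0, hR⟩ := hb.exists_pos_norm_lt
  refine ⟨1 / (4 * R), by positivity,
    ofReal_mul_norm_sub_le_kobayashiDist (by positivity) fun z hz v => ?_⟩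
  obtain ⟨L, hL1, hLv⟩ := exists_dual_vector'' ℂ v
  have habs : ∀ y ∈ Ω, |(L y).re| < R := fun y hy =>
    (Complex.abs_re_le_norm _).trans_lt
      ((L.le_of_opNorm_le hL1 y).trans_lt (by simpa using hR y hy))
  have hpos : ∀ y ∈ Ω, 0 < (L y - (-R : ℝ)).re := fun y hy => by
    have := (abs_lt.1 (habs y hy)).1
    rw [Complex.sub_re, Complex.ofReal_re]
    linarith
  refine le_trans (ENNReal.ofReal_le_ofReal ?_) (le_kobayashiMetric_of_halfSpace hpos z v)
  have hz4 : 2 * (L z - (-R : ℝ)).re ≤ 4 * R := by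
    rw [Complex.sub_re, Complex.ofReal_re]
    linarith [(abs_lt.1 (habs z hz)).2]
  rw [hLv, RCLike.norm_ofReal, abs_norm, one_div_mul_eq_div]
  have := hpos z hz
  gcongr

theorem half_log_bdryDist_sub_le_kobayashiDist (hc : Convex ℝ Ω) (ho : IsOpen Ω)
    (hb : Bornology.IsBounded Ω) (hn : 0 < n) {x y : Cn n} (hx : x ∈ Ω) (hy : y ∈ Ω) :
    ENNReal.ofReal (1 / 2 * Real.log (bdryDist Ω y) - 1 / 2 * Real.log (bdryDist Ω x)) ≤
      kobayashiDist Ω x y := by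
  obtain ⟨L, a, hpos, hle, hxe⟩ := exists_support_nearest hc ho hb hn hx
  refine le_kobayashiDist fun γ hγ hm h0 h1 => ?_
  refine le_trans ?_ (enorm_half_log_sub_le_kobayashiLengthOn hpos hγ hm)
  rw [h0, h1, hxe, ← ofReal_norm]
  refine ENNReal.ofReal_le_ofReal (le_trans ?_ (le_abs_self _))
  linarith [Real.log_le_log (bdryDist_pos ho hb hn hy) (hle y hy)]

theorem exists_last_le {f g : ℝ → ℝ} {a b : ℝ} (hab : a ≤ b) (hf : ContinuousOn f (Icc a b))
    (hg : ContinuousOn g (Icc a b)) (ha : f a ≤ g a) :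
    ∃ s ∈ Icc a b, f s ≤ g s ∧ (s < b → ∀ t ∈ Icc s b, g t ≤ f t) := by
  have hcpt : IsCompact {t ∈ Icc a b | f t ≤ g t} :=
    isCompact_Icc.of_isClosed_subset (isClosed_Icc.isClosed_le hf hg) fun t ht => ht.1
  obtain ⟨s, ⟨hs, hfg⟩, hmax⟩ := hcpt.exists_isGreatest ⟨a, left_mem_Icc.2 hab, ha⟩
  refine ⟨s, hs, hfg, fun hsb => ?_⟩
  have hsub : Icc s b ⊆ Icc a b := Icc_subset_Icc_left hs.1
  have hlt : ∀ t ∈ Ioc s b, g t ≤ f t := fun t ht => by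
    by_contra! hcon
    exact ht.1.not_ge (hmax ⟨hsub (Ioc_subset_Icc_self ht), hcon.le⟩)
  rw [← closure_Ioc hsb.ne] at hsub ⊢
  exact fun t ht => ContinuousWithinAt.closure_le ht
    ((hg t (hsub ht)).mono (subset_closure.trans hsub))
    ((hf t (hsub ht)).mono (subset_closure.trans hsub)) hlt

namespace IsMConvexDomain

theorem exists_le_kobayashiMetric (h : IsMConvexDomain m Ω) (hn : 0 < n) :
    ∃ c : ℝ, 0 < c ∧ ∀ z ∈ Ω, ∀ v,
    ENNReal.ofReal (c * ‖v‖ / bdryDist Ω z ^ (1 / m)) ≤ kobayashiMetric Ω z v := by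
  obtain ⟨C, hC, hle⟩ := h.exists_bound
  refine ⟨1 / (4 * C), by positivity, fun z hz v => ?_⟩
  by_cases hv : v = 0
  · simp [hv]
  have hdm : 0 < bdryDist Ω z ^ (1 / m) :=
    Real.rpow_pos_of_pos (bdryDist_pos h.isOpen h.isBounded hn hz) _
  have hlt : infDist z (frontier Ω ∩ range fun c : ℂ => z + c • v) <
      2 * C * bdryDist Ω z ^ (1 / m) := (hle z hz v hv).trans_lt (by nlinarith [mul_pos hC hdm])
  obtain ⟨_, ⟨hp, c, rfl⟩, hdist⟩ :=
    (infDist_lt_iff (frontier_inter_line_nonempty h.isBounded hz hv)).1 hlt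
  rw [dist_eq_norm, sub_add_cancel_left, norm_neg, norm_smul] at hdist
  obtain ⟨L, -, hpos⟩ := exists_support_of_mem_frontier h.convex h.isOpen hp
  refine le_trans (ENNReal.ofReal_le_ofReal ?_) (le_kobayashiMetric_of_halfSpace hpos z v)
  have hre : (L z - L (z + c • v)).re ≤ ‖c‖ * ‖L v‖ := by
    refine (Complex.re_le_norm _).trans (le_of_eq ?_)
    rw [← map_sub, sub_add_cancel_left, map_neg, norm_neg, map_smul, norm_smul]
  rw [div_le_div_iff₀ hdm (mul_pos two_pos (hpos z hz))]
  calc 1 / (4 * C) * ‖v‖ * (2 * (L z - L (z + c • v)).re)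
      ≤ 1 / (4 * C) * ‖v‖ * (2 * (‖c‖ * ‖L v‖)) := by gcongr
    _ = (‖c‖ * ‖v‖) * ‖L v‖ / (2 * C) := by ring
    _ ≤ (2 * C * bdryDist Ω z ^ (1 / m)) * ‖L v‖ / (2 * C) := by gcongr
    _ = ‖L v‖ * bdryDist Ω z ^ (1 / m) := by field_simp

end IsMConvexDomain

section CostOfDisplacement

variable {γ : ℝ → Cn n} {a b B : ℝ}

theorem le_kobayashiLengthOn_of_norm_sub_le (hm : 0 < m) (hB : 0 < B) {L : Cn n →L[ℂ] ℂ} {α : ℂ}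
    (hL : ∀ y ∈ Ω, 0 < (L y - α).re) (hγ : IsPiecewiseC1On γ a b) (hmaps : MapsTo γ (Icc a b) Ω)
    (hne : γ b ≠ γ a) (hle : ‖γ b - γ a‖ ≤ B * (L (γ b) - α).re ^ (1 / m)) :
    ENNReal.ofReal (m / 2 * Real.log (‖γ b - γ a‖ / B) - 1 / 2 * Real.log (L (γ a) - α).re) ≤
      kobayashiLengthOn Ω γ a b := by
  refine le_trans ?_ (enorm_half_log_sub_le_kobayashiLengthOn hL hγ hmaps)
  rw [← ofReal_norm]
  refine ENNReal.ofReal_le_ofReal (le_trans ?_ (le_abs_self _))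
  have hpos : 0 < ‖γ b - γ a‖ := norm_pos_iff.2 (sub_ne_zero.2 hne)
  have hlog : Real.log (‖γ b - γ a‖ / B) ≤ 1 / m * Real.log (L (γ b) - α).re := by
    rw [← Real.log_rpow (hL _ (hmaps (right_mem_Icc.2 hγ.le)))]
    exact Real.log_le_log (by positivity) (by rwa [div_le_iff₀' hB])
  have hmul : m / 2 * Real.log (‖γ b - γ a‖ / B) ≤ 1 / 2 * Real.log (L (γ b) - α).re :=
    (mul_le_mul_of_nonneg_left hlog (by positivity)).trans_eq (by field_simp)
  linarith

theorem le_kobayashiLengthOn_of_le_norm_sub (hm : 0 < m) (hB : 0 < B) {δ : Cn n → ℝ}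
    (hδ : ∀ z ∈ Ω, 0 < δ z)
    (hK : ∀ z ∈ Ω, ∀ v, ENNReal.ofReal (m / (2 * B) * ‖v‖ / δ z ^ (1 / m)) ≤
      kobayashiMetric Ω z v) {x : Cn n}
    (hγ : IsPiecewiseC1On γ a b) (hmaps : MapsTo γ (Icc a b) Ω)
    (hle : ∀ t ∈ Icc a b, B * δ (γ t) ^ (1 / m) ≤ ‖γ t - x‖) :
    ENNReal.ofReal (m / 2 * Real.log (‖γ b - x‖ / ‖γ a - x‖)) ≤ kobayashiLengthOn Ω γ a b := by
  have hpow : ∀ t ∈ Icc a b, 0 < B * δ (γ t) ^ (1 / m) := fun t ht =>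
    mul_pos hB (Real.rpow_pos_of_pos (hδ _ (hmaps ht)) _)
  have hpos : ∀ t ∈ Icc a b, 0 < ‖γ t - x‖ := fun t ht => (hpow t ht).trans_le (hle t ht)
  refine le_trans ?_ (enorm_log_norm_sub_le_kobayashiLengthOn (k := m / 2) (by positivity) hγ
    (fun t ht => sub_ne_zero.1 (norm_pos_iff.1 (hpos t ht)))
    fun t ht v => le_trans (ENNReal.ofReal_le_ofReal ?_) (hK _ (hmaps ht) v))
  · rw [Real.log_div (hpos b (right_mem_Icc.2 hγ.le)).ne' (hpos a (left_mem_Icc.2 hγ.le)).ne',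
      mul_sub, ← ofReal_norm]
    exact ENNReal.ofReal_le_ofReal (le_abs_self _)
  · have := hpow t ht
    calc m / 2 * (‖v‖ / ‖γ t - x‖) ≤ m / 2 * (‖v‖ / (B * δ (γ t) ^ (1 / m))) := by
          gcongr
          exact hle t ht
      _ = m / (2 * B) * ‖v‖ / δ (γ t) ^ (1 / m) := by
          have := Real.rpow_pos_of_pos (hδ _ (hmaps ht)) (1 / m)
          field_simp

/- Up to the last time at which the displacement is at most `B` times the `1 / m`-th power of the
distance to the hyperplane `Re L = Re α`, the logarithm of that distance pays for the length; after
it, the logarithm of the displacement does. -/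
theorem log_norm_sub_le_kobayashiLengthOn (hm : 0 < m) (hB : 0 < B) {L : Cn n →L[ℂ] ℂ} {α : ℂ}
    (hL : ∀ y ∈ Ω, 0 < (L y - α).re)
    (hK : ∀ z ∈ Ω, ∀ v, ENNReal.ofReal (m / (2 * B) * ‖v‖ / (L z - α).re ^ (1 / m)) ≤
      kobayashiMetric Ω z v)
    (hγ : IsPiecewiseC1On γ a b) (hmaps : MapsTo γ (Icc a b) Ω) (hne : γ b ≠ γ a) :
    ENNReal.ofReal (m / 2 * Real.log (‖γ b - γ a‖ / B) - 1 / 2 * Real.log (L (γ a) - α).re) ≤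
      kobayashiLengthOn Ω γ a b := by
  have hpow : ∀ t ∈ Icc a b, 0 < B * (L (γ t) - α).re ^ (1 / m) := fun t ht =>
    mul_pos hB (Real.rpow_pos_of_pos (hL _ (hmaps ht)) _)
  have hLγ : ContinuousOn (fun t => B * (L (γ t) - α).re ^ (1 / m)) (Icc a b) :=
    continuousOn_const.mul ((Complex.continuous_re.comp_continuousOn
      ((L.continuous.comp_continuousOn hγ.continuousOn).sub continuousOn_const)).rpow_const
        fun t ht => Or.inl (hL _ (hmaps ht)).ne')
  have hdispl : ContinuousOn (fun t => ‖γ t - γ a‖) (Icc a b) :=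
    (hγ.continuousOn.sub continuousOn_const).norm
  obtain ⟨s, hs, hsle, hlast⟩ := exists_last_le hγ.le hdispl hLγ
    (by simpa only [sub_self, norm_zero] using (hpow a (left_mem_Icc.2 hγ.le)).le)
  have hfirst := fun hne => le_kobayashiLengthOn_of_norm_sub_le hm hB hL
    (hγ.restrict le_rfl hs.1 hs.2) (hmaps.mono_left (Icc_subset_Icc_right hs.2)) hne hsle
  rcases hs.2.eq_or_lt with rfl | hsb
  · exact hfirst hne
  have hsecond := le_kobayashiLengthOn_of_le_norm_sub hm hB hL hK (hγ.restrict hs.1 hs.2 le_rfl)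
    (hmaps.mono_left (Icc_subset_Icc_left hs.1)) (hlast hsb)
  have hs0 : 0 < ‖γ s - γ a‖ := (hpow s hs).trans_le (hlast hsb s (left_mem_Icc.2 hs.2))
  have hb0 : 0 < ‖γ b - γ a‖ := norm_pos_iff.2 (sub_ne_zero.2 hne)
  rw [← kobayashiLengthOn_add hs.1 hs.2]
  refine le_trans ?_ (add_le_add (hfirst (sub_ne_zero.1 (norm_pos_iff.1 hs0))) hsecond)
  refine le_trans (ENNReal.ofReal_le_ofReal (le_of_eq ?_)) ENNReal.ofReal_add_le
  rw [Real.log_div hb0.ne' hB.ne', Real.log_div hs0.ne' hB.ne', Real.log_div hb0.ne' hs0.ne']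
  ring

end CostOfDisplacement

namespace IsMConvexDomain

theorem exists_log_norm_sub_le_kobayashiLengthOn (h : IsMConvexDomain m Ω) (hn : 0 < n) :
    ∃ B : ℝ, 0 < B ∧ ∀ (γ : ℝ → Cn n) (a b : ℝ), IsPiecewiseC1On γ a b →
    MapsTo γ (Icc a b) Ω → γ b ≠ γ a →
    ENNReal.ofReal (m / 2 * Real.log (‖γ b - γ a‖ / B) - 1 / 2 * Real.log (bdryDist Ω (γ a))) ≤
      kobayashiLengthOn Ω γ a b := by
  obtain ⟨c, hc, hK⟩ := h.exists_le_kobayashiMetric hn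
  have hm : 0 < m := zero_lt_one.trans h.one_lt
  refine ⟨m / (2 * c), by positivity, fun γ a b hγ hmaps hne => ?_⟩
  obtain ⟨L, α, hpos, hle, hxe⟩ := exists_support_nearest h.convex h.isOpen h.isBounded hn
    (hmaps (left_mem_Icc.2 hγ.le))
  rw [← hxe]
  refine log_norm_sub_le_kobayashiLengthOn hm (by positivity) hpos (fun z hz v => ?_) hγ hmaps hne
  have hδ := bdryDist_pos h.isOpen h.isBounded hn hz
  have := Real.rpow_pos_of_pos hδ (1 / m)
  have hmc : m / (2 * (m / (2 * c))) = c := by field_simp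
  refine le_trans (ENNReal.ofReal_le_ofReal ?_) (hK z hz v)
  rw [hmc]
  gcongr
  exact hle z hz

theorem exists_le_kobayashiDist (h : IsMConvexDomain m Ω) (hn : 0 < n) :
    ∃ C : ℝ, ∀ x ∈ Ω, ∀ y ∈ Ω, x ≠ y →
    ENNReal.ofReal (m * Real.log ‖x - y‖ - 1 / 2 * Real.log (bdryDist Ω x) -
      1 / 2 * Real.log (bdryDist Ω y) - C) ≤ kobayashiDist Ω x y := by
  obtain ⟨B, hB, hleave⟩ := h.exists_log_norm_sub_le_kobayashiLengthOn hn
  have hm0 : 0 < m := zero_lt_one.trans h.one_lt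
  refine ⟨m * Real.log (2 * B), fun x _ y _ hxy => le_kobayashiDist fun γ hγ hm h0 h1 => ?_⟩
  have hr : 0 < ‖x - y‖ := norm_pos_iff.2 (sub_ne_zero.2 hxy)
  obtain ⟨T, hT, hTx⟩ : ∃ T ∈ Icc (0 : ℝ) 1, ‖γ T - x‖ = ‖x - y‖ / 2 := by
    have hcont : ContinuousOn (fun t => ‖γ t - x‖) (Icc 0 1) :=
      (hγ.continuousOn.sub continuousOn_const).norm
    refine intermediate_value_Icc zero_le_one hcont ⟨?_, ?_⟩
    · simp only [h0, sub_self, norm_zero]; positivity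
    · simp only [h1, norm_sub_rev y x]; linarith
  have hTy : ‖x - y‖ / 2 ≤ ‖γ T - y‖ := by
    linarith [norm_sub_le_norm_sub_add_norm_sub x (γ T) y, norm_sub_rev x (γ T)]
  have hx : γ T ≠ x := sub_ne_zero.1 (norm_pos_iff.1 (hTx ▸ by positivity))
  have hy : γ T ≠ y := sub_ne_zero.1 (norm_pos_iff.1 (by linarith))
  have hlen₁ := hleave γ 0 T (hγ.restrict le_rfl hT.1 hT.2)
    (hm.mono_left (Icc_subset_Icc_right hT.2)) (by rwa [h0])
  have hlen₂ := (hleave (fun t => γ (-t)) (-1) (-T) (hγ.restrict hT.1 hT.2 le_rfl).comp_neg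
    (fun t ht => hm ⟨by linarith [hT.1, ht.2], by linarith [ht.1]⟩)
    (by simpa [h1] using hy)).trans (kobayashiLengthOn_comp_neg_le (a := T))
  simp only [neg_neg, h0, h1] at hlen₁ hlen₂
  rw [← kobayashiLengthOn_add hT.1 hT.2]
  refine le_trans ?_ (add_le_add hlen₁ hlen₂)
  refine le_trans (ENNReal.ofReal_le_ofReal ?_) ENNReal.ofReal_add_le
  have hlog : ∀ d, ‖x - y‖ / 2 ≤ d → m / 2 * (Real.log ‖x - y‖ - Real.log (2 * B)) ≤
      m / 2 * Real.log (d / B) := fun d hd => by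
    rw [← Real.log_div hr.ne' (by positivity), ← div_div]
    gcongr
  linarith [hlog _ hTx.ge, hlog _ hTy]

end IsMConvexDomain

end LowerBounds

theorem eventually_add_smul_mem {E : Type*} [AddCommGroup E] [TopologicalSpace E]
    [ContinuousAdd E] [Module ℝ E] [ContinuousSMul ℝ E] {U : Set E} (hU : IsOpen U) {p : E}
    (hp : p ∈ U) (v : E) : ∀ᶠ t : ℝ in 𝓝[>] 0, p + t • v ∈ U := by
  have hcont : ContinuousAt (fun t : ℝ => p + t • v) 0 := by fun_prop
  exact (hcont.eventually_mem (by simpa using hU.mem_nhds hp)).filter_mono nhdsWithin_le_nhds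

theorem exists_frontier_forall_inner_nonpos {E : Type*} [NormedAddCommGroup E]
    [InnerProductSpace ℝ E] [CompleteSpace E] {s : Set E} (ho : IsOpen s) (hc : Convex ℝ s)
    {p q : E} (hp : p ∈ closure s) (hq : q ∉ s) :
    ∃ p' ∈ frontier s, dist p' p ≤ dist q p ∧ ∀ w ∈ closure s, ⟪q - p', w - p'⟫ ≤ 0 := by
  obtain ⟨p', hp', hmin⟩ := exists_norm_eq_iInf_of_complete_convex ⟨p, hp⟩
    isClosed_closure.isComplete hc.closure q
  rw [norm_eq_iInf_iff_real_inner_le_zero hc.closure hp'] at hmin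
  refine ⟨p', ?_, ?_, hmin⟩
  · rw [ho.frontier_eq]
    refine ⟨hp', fun hp's => ?_⟩
    obtain ⟨t, hts, ht⟩ :=
      ((eventually_add_smul_mem ho hp's (q - p')).and self_mem_nhdsWithin).exists
    have hle := hmin _ (subset_closure hts)
    rw [add_sub_cancel_left, inner_smul_right, real_inner_self_eq_norm_sq] at hle
    have hpos : 0 < ‖q - p'‖ := norm_pos_iff.2 fun h0 => hq (sub_eq_zero.1 h0 ▸ hp's)
    exact absurd hle (not_le.2 (mul_pos ht (pow_pos hpos 2)))
  · rw [dist_comm p', dist_eq_norm, dist_eq_norm, ← sq_le_sq₀ (norm_nonneg _) (norm_nonneg _)]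
    have hexpand := norm_sub_sq_real (q - p') (p - p')
    rw [sub_sub_sub_cancel_right] at hexpand
    nlinarith [hmin p hp, sq_nonneg ‖q - p'‖]

section UnitNormal

variable {n : ℕ} {r : Cn n → ℝ} {x : Cn n}

theorem inner_realGradient (r : Cn n → ℝ) (x v : Cn n) :
    ⟪realGradient r x, v⟫ = fderiv ℝ r x v := by
  have hv : v = ∑ j, ((v j).re • EuclideanSpace.single j (1 : ℂ) +
      (v j).im • EuclideanSpace.single j Complex.I) := by
    ext i
    simp only [PiLp.add_apply, PiLp.smul_apply, WithLp.ofLp_sum, Finset.sum_apply]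
    rw [Finset.sum_eq_single i (fun j _ hj => by simp [hj.symm]) (by simp)]
    simp
  conv_rhs => rw [hv]
  rw [map_sum, PiLp.inner_apply]
  refine Finset.sum_congr rfl fun j _ => ?_
  rw [map_add, map_smul, map_smul, Complex.inner]
  simp [realGradient]

theorem norm_realGradient_pos (h : fderiv ℝ r x ≠ 0) : 0 < ‖realGradient r x‖ := by
  refine norm_pos_iff.2 fun h0 => h ?_
  ext v
  rw [← inner_realGradient, h0, inner_zero_left, zero_apply]

theorem norm_unitNormal (h : fderiv ℝ r x ≠ 0) : ‖unitNormal r x‖ = 1 := by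
  rw [unitNormal, norm_smul, norm_inv, norm_norm, inv_mul_cancel₀ (norm_realGradient_pos h).ne']

theorem inner_unitNormal (r : Cn n → ℝ) (x v : Cn n) :
    ⟪unitNormal r x, v⟫ = ‖realGradient r x‖⁻¹ * fderiv ℝ r x v := by
  rw [unitNormal, real_inner_smul_left, inner_realGradient]

end UnitNormal

namespace IsC1DefiningFunction

variable {n : ℕ} {Ω U : Set (Cn n)} {r : Cn n → ℝ} {p : Cn n}

theorem hasFDerivAt (hr : IsC1DefiningFunction Ω U r) (hU : IsOpen U) (hp : p ∈ U) :
    HasFDerivAt r (fderiv ℝ r p) p :=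
  ((hr.contDiffOn.contDiffAt (hU.mem_nhds hp)).differentiableAt one_ne_zero).hasFDerivAt

theorem mem_iff (hr : IsC1DefiningFunction Ω U r) (hp : p ∈ U) : p ∈ Ω ↔ r p < 0 := by
  have := Set.ext_iff.1 hr.inter_eq p
  simpa [hp] using this

theorem eq_zero (hr : IsC1DefiningFunction Ω U r) (hU : IsOpen U) (ho : IsOpen Ω)
    (hp : p ∈ U) (hpf : p ∈ frontier Ω) : r p = 0 := by
  refine le_antisymm (le_of_not_gt fun hpos => ?_)
    (le_of_not_gt fun hneg => notMem_of_mem_frontier ho hpf ((hr.mem_iff hp).2 hneg))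
  have hev : ∀ᶠ y in 𝓝 p, 0 < r y ∧ y ∈ U :=
    ((hr.hasFDerivAt hU hp).continuousAt.eventually (lt_mem_nhds hpos)).and (hU.mem_nhds hp)
  obtain ⟨y, ⟨hy, hyU⟩, hyΩ⟩ := mem_closure_iff_nhds.1 (frontier_subset_closure hpf) _ hev
  exact lt_asymm ((hr.mem_iff hyU).1 hyΩ) hy

theorem tendsto_inv_smul (hr : IsC1DefiningFunction Ω U r) (hU : IsOpen U) (ho : IsOpen Ω)
    (hp : p ∈ U) (hpf : p ∈ frontier Ω) (v : Cn n) :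
    Tendsto (fun t : ℝ => t⁻¹ * r (p + t • v)) (𝓝[>] 0) (𝓝 (fderiv ℝ r p v)) := by
  simpa [hr.eq_zero hU ho hp hpf] using
    ((hr.hasFDerivAt hU hp).hasLineDerivAt v).tendsto_slope_zero_right

theorem fderiv_sub_nonpos (hr : IsC1DefiningFunction Ω U r) (hU : IsOpen U) (ho : IsOpen Ω)
    (hc : Convex ℝ Ω) (hp : p ∈ U) (hpf : p ∈ frontier Ω) {y : Cn n}
    (hy : y ∈ closure Ω) : fderiv ℝ r p (y - p) ≤ 0 := by
  refine closure_minimal (s := Ω) (t := {y | fderiv ℝ r p (y - p) ≤ 0}) (fun y hy => ?_)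
    (isClosed_le (by fun_prop) continuous_const) hy
  refine le_of_tendsto (hr.tendsto_inv_smul hU ho hp hpf (y - p)) ?_
  filter_upwards [eventually_add_smul_mem hU hp (y - p), Ioo_mem_nhdsGT (zero_lt_one' ℝ)]
    with t htU ⟨ht0, ht1⟩
  have htΩ : p + t • (y - p) ∈ Ω := by
    rw [← ho.interior_eq] at hy ⊢
    exact hc.add_smul_sub_mem_interior' (frontier_subset_closure hpf) hy ⟨ht0, ht1.le⟩
  exact mul_nonpos_of_nonneg_of_nonpos (inv_nonneg.2 ht0.le) ((hr.mem_iff htU).1 htΩ).le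

theorem eventually_mem (hr : IsC1DefiningFunction Ω U r) (hU : IsOpen U) (ho : IsOpen Ω)
    (hp : p ∈ U) (hpf : p ∈ frontier Ω) {v : Cn n} (hv : fderiv ℝ r p v < 0) :
    ∀ᶠ t : ℝ in 𝓝[>] 0, p + t • v ∈ Ω := by
  filter_upwards [eventually_add_smul_mem hU hp v, self_mem_nhdsWithin,
    (hr.tendsto_inv_smul hU ho hp hpf v).eventually (gt_mem_nhds hv)] with t htU ht0 hlt
  exact (hr.mem_iff htU).2 (neg_of_mul_neg_right hlt (inv_nonneg.2 (le_of_lt ht0)))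

theorem fderiv_nonneg_of_forall_inner_nonpos (hr : IsC1DefiningFunction Ω U r) (hU : IsOpen U)
    (ho : IsOpen Ω) (hp : p ∈ U) (hpf : p ∈ frontier Ω) {v : Cn n}
    (hv : ∀ w ∈ Ω, ⟪v, w - p⟫ ≤ 0) : 0 ≤ fderiv ℝ r p v := by
  have hdescent : fderiv ℝ r p (-realGradient r p) < 0 := by
    have := norm_realGradient_pos (hr.fderiv_ne_zero p hp)
    rw [map_neg, ← inner_realGradient, real_inner_self_eq_norm_sq, neg_lt_zero]
    positivity
  obtain ⟨t, ht, ht0⟩ :=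
    ((hr.eventually_mem hU ho hp hpf hdescent).and self_mem_nhdsWithin).exists
  have hle := hv _ ht
  rw [add_sub_cancel_left, inner_smul_right, inner_neg_right, real_inner_comm,
    inner_realGradient] at hle
  exact nonneg_of_mul_nonneg_right (by linarith) (mem_Ioi.1 ht0)

/- Project the exterior point `q` to `closure Ω`: the foot `p'` is a boundary point at which
`q - p'` points outwards and `p - p'` inwards, so `q - p` points outwards at `p'`. -/
theorem exists_neg_dist_mul_le_inner_unitNormal (hr : IsC1DefiningFunction Ω U r)
    (hU : IsOpen U) (ho : IsOpen Ω) (hc : Convex ℝ Ω) {ρ : ℝ} (hpU : ball p ρ ⊆ U)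
    (hpf : p ∈ frontier Ω) {q : Cn n} (hq : q ∉ Ω) (hqp : dist q p < ρ) :
    ∃ p' ∈ frontier Ω ∩ U, dist p' p ≤ dist q p ∧
      -(dist (unitNormal r p) (unitNormal r p') * dist q p) ≤ ⟪unitNormal r p, q - p⟫ := by
  have hpc := frontier_subset_closure hpf
  obtain ⟨p', hp'f, hdist, hmin⟩ := exists_frontier_forall_inner_nonpos ho hc hpc hq
  have hp'U : p' ∈ U := hpU (mem_ball.2 (hdist.trans_lt hqp))
  refine ⟨p', ⟨hp'f, hp'U⟩, hdist, ?_⟩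
  have houter : 0 ≤ ⟪unitNormal r p', q - p⟫ := by
    have hqp' := hr.fderiv_nonneg_of_forall_inner_nonpos hU ho hp'U hp'f
      fun w hw => hmin w (subset_closure hw)
    have hpp' := hr.fderiv_sub_nonpos hU ho hc hp'U hp'f hpc
    rw [inner_unitNormal, ← sub_sub_sub_cancel_right q p p', map_sub]
    exact mul_nonneg (inv_nonneg.2 (norm_nonneg _)) (by linarith)
  have hcs := abs_le.1 (abs_real_inner_le_norm (unitNormal r p - unitNormal r p') (q - p))
  rw [inner_sub_left] at hcs
  rw [dist_eq_norm, dist_eq_norm]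
  linarith [hcs.1]

end IsC1DefiningFunction

theorem modulusOfContinuity_mono {n : ℕ} (N : Cn n → Cn n) (S : Set (Cn n)) :
    Monotone (modulusOfContinuity N S) := fun _ _ hst =>
  iSup₂_le fun x hx => iSup₂_le fun y hy => iSup_le fun hd =>
    le_iSup₂_of_le x hx (le_iSup₂_of_le y hy (le_iSup_of_le (hd.trans_le hst) le_rfl))

theorem tsum_dyadic_ne_top_of_monotone {W : ℝ → ℝ≥0∞} (hW : Monotone W)
    (hint : ∫⁻ t in Ioc (0 : ℝ) 1, W t / ENNReal.ofReal t < ∞) :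
    ∑' k : ℕ, W ((1 / 2) ^ (k + 1)) ≠ ∞ := by
  have hdisj : Pairwise (Function.onFun Disjoint fun k : ℕ =>
      Ioc ((1 / 2 : ℝ) ^ (k + 1)) ((1 / 2) ^ k)) :=
    (pow_right_anti₀ (by norm_num) (by norm_num)).pairwise_disjoint_on_Ioc_succ
  have hsub : (⋃ k : ℕ, Ioc ((1 / 2 : ℝ) ^ (k + 1)) ((1 / 2) ^ k)) ⊆ Ioc 0 1 :=
    iUnion_subset fun k t ht => ⟨(by positivity : (0 : ℝ) < (1 / 2) ^ (k + 1)).trans ht.1,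
      ht.2.trans (pow_le_one₀ (by norm_num) (by norm_num))⟩
  have hpiece (k : ℕ) : W ((1 / 2) ^ (k + 1)) * ENNReal.ofReal (1 / 2) ≤
      ∫⁻ t in Ioc ((1 / 2 : ℝ) ^ (k + 1)) ((1 / 2) ^ k), W t / ENNReal.ofReal t := by
    have hk : (0 : ℝ) < (1 / 2) ^ k := by positivity
    calc W ((1 / 2) ^ (k + 1)) * ENNReal.ofReal (1 / 2)
        = ∫⁻ _ in Ioc ((1 / 2 : ℝ) ^ (k + 1)) ((1 / 2) ^ k),
            W ((1 / 2) ^ (k + 1)) / ENNReal.ofReal ((1 / 2) ^ k) := by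
          rw [setLIntegral_const, Real.volume_Ioc, ENNReal.div_eq_inv_mul, mul_comm _ (W _),
            mul_assoc, ← ENNReal.ofReal_inv_of_pos hk, ← ENNReal.ofReal_mul (by positivity)]
          congr 2
          rw [pow_succ]
          field_simp
          norm_num
      _ ≤ _ := setLIntegral_mono' measurableSet_Ioc fun _ ht =>
          ENNReal.div_le_div (hW ht.1.le) (ENNReal.ofReal_le_ofReal ht.2)
  have hle : (∑' k : ℕ, W ((1 / 2) ^ (k + 1))) * ENNReal.ofReal (1 / 2) < ∞ :=
    calc (∑' k : ℕ, W ((1 / 2) ^ (k + 1))) * ENNReal.ofReal (1 / 2)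
        = ∑' k : ℕ, W ((1 / 2) ^ (k + 1)) * ENNReal.ofReal (1 / 2) := ENNReal.tsum_mul_right.symm
      _ ≤ ∑' k : ℕ, ∫⁻ t in Ioc ((1 / 2 : ℝ) ^ (k + 1)) ((1 / 2) ^ k), W t / ENNReal.ofReal t :=
          ENNReal.tsum_le_tsum hpiece
      _ ≤ ∫⁻ t in Ioc (0 : ℝ) 1, W t / ENNReal.ofReal t := by
          rw [← lintegral_iUnion (fun _ => measurableSet_Ioc) hdisj]
          exact lintegral_mono_set hsub
      _ < ∞ := hint
  intro htop
  rw [htop, ENNReal.top_mul (by simp)] at hle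
  exact lt_irrefl _ hle

theorem exists_summable_dyadic_majorant {W : ℝ → ℝ≥0∞} (hW : Monotone W)
    (hint : ∫⁻ t in Ioc (0 : ℝ) 1, W t / ENNReal.ofReal t < ∞) {δ : ℝ} (hδ : 0 < δ) :
    ∃ (ρ : ℝ) (ω : ℕ → ℝ), 0 < ρ ∧ ρ ≤ δ ∧ Antitone ω ∧ (∀ k, 0 ≤ ω k) ∧ Summable ω ∧
      ∀ k, W (ρ * (1 / 2) ^ k) ≤ ENNReal.ofReal (ω k) := by
  have hsum := tsum_dyadic_ne_top_of_monotone hW hint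
  obtain ⟨K, hK⟩ := exists_pow_lt_of_lt_one hδ (by norm_num : (1 / 2 : ℝ) < 1)
  have hfin (k : ℕ) : W ((1 / 2) ^ (k + K + 1)) ≠ ∞ := ENNReal.ne_top_of_tsum_ne_top hsum (k + K)
  have hanti : Antitone fun k : ℕ => (1 / 2 : ℝ) ^ k := pow_right_anti₀ (by norm_num) (by norm_num)
  refine ⟨(1 / 2) ^ (K + 1), fun k => (W ((1 / 2) ^ (k + K + 1))).toReal, by positivity,
    (hanti K.le_succ).trans hK.le,
    fun a b hab => ENNReal.toReal_mono (hfin a) (hW (hanti (by omega))),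
    fun k => ENNReal.toReal_nonneg, ?_, fun k => ?_⟩
  · exact (summable_nat_add_iff (f := fun k => (W ((1 / 2) ^ (k + 1))).toReal) K).2
      (ENNReal.summable_toReal hsum)
  · rw [ENNReal.ofReal_toReal (hfin k), ← pow_add, show K + 1 + k = k + K + 1 by ring]

section DiniNormal

variable {n : ℕ} {Ω : Set (Cn n)}

theorem HasDiniSmoothBoundary.exists_uniform_modulus (hs : HasDiniSmoothBoundary Ω)
    (hb : Bornology.IsBounded Ω) :
    ∃ (δ : ℝ) (W : ℝ → ℝ≥0∞), 0 < δ ∧ Monotone W ∧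
      ∫⁻ t in Ioc (0 : ℝ) 1, W t / ENNReal.ofReal t < ∞ ∧
      ∀ p ∈ frontier Ω, ∃ (U : Set (Cn n)) (r : Cn n → ℝ), IsOpen U ∧
        IsC1DefiningFunction Ω U r ∧ ball p δ ⊆ U ∧
        ∀ t, modulusOfContinuity (unitNormal r) (frontier Ω ∩ U) t ≤ W t := by
  choose! U r hU hpU hr hfin using hs
  have hcompact : IsCompact (frontier Ω) := isCompact_of_isClosed_isBounded isClosed_frontier
    (hb.closure.subset frontier_subset_closure)
  obtain ⟨s, hsf, hcov⟩ := hcompact.elim_nhds_subcover U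
    fun p hp => (hU p hp).mem_nhds (hpU p hp)
  obtain ⟨δ, hδ, hleb⟩ := lebesgue_number_lemma_of_metric (ι := s) (c := fun i => U i)
    hcompact (fun i => hU _ (hsf _ i.2))
    (hcov.trans (iUnion₂_subset fun i hi => subset_iUnion (fun j : s => U j) ⟨i, hi⟩))
  set M : Cn n → ℝ → ℝ≥0∞ := fun i =>
    modulusOfContinuity (unitNormal (r i)) (frontier Ω ∩ U i)
  have hM (i : Cn n) : Monotone (M i) := modulusOfContinuity_mono _ _
  have hmeas (i : Cn n) : Measurable fun t => M i t / ENNReal.ofReal t :=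
    (hM i).measurable.div ENNReal.measurable_ofReal
  refine ⟨δ, fun t => ∑ i ∈ s, M i t, hδ, fun a b hab => Finset.sum_le_sum fun i _ => hM i hab,
    ?_, fun p hp => ?_⟩
  · simp_rw [ENNReal.div_eq_inv_mul, Finset.mul_sum, ← ENNReal.div_eq_inv_mul]
    rw [lintegral_finsetSum _ fun i _ => hmeas i]
    exact ENNReal.sum_lt_top.2 fun i hi => hfin i (hsf i hi)
  · obtain ⟨⟨i, hi⟩, hball⟩ := hleb p hp
    exact ⟨U i, r i, hU i (hsf i hi), hr i (hsf i hi), hball, fun t =>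
      Finset.single_le_sum (f := fun i => M i t) (fun _ _ => zero_le) hi⟩

/-- `ν` is the inner unit normal of the convex domain `Ω` at its boundary point `p`, and at
distance less than `ρ 2⁻ᵏ` from `p` the domain contains the cone `⟪ν, q - p⟫ > ω k |q - p|`.
Summability of the `ω k` is the form in which Dini smoothness is used. -/
structure IsInnerDiniNormal (Ω : Set (Cn n)) (ρ : ℝ) (ω : ℕ → ℝ) (p ν : Cn n) : Prop where
  norm_eq_one : ‖ν‖ = 1
  inner_nonneg : ∀ y ∈ Ω, 0 ≤ ⟪ν, y - p⟫
  mem_of_lt_inner : ∀ k q, dist q p < ρ * (1 / 2) ^ k → dist q p * ω k < ⟪ν, q - p⟫ → q ∈ Ω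

theorem IsC1DefiningFunction.isInnerDiniNormal {U : Set (Cn n)} {r : Cn n → ℝ}
    (hr : IsC1DefiningFunction Ω U r) (hU : IsOpen U) (ho : IsOpen Ω) (hc : Convex ℝ Ω)
    {p : Cn n} {ρ : ℝ} (hρ : 0 < ρ) (hpU : ball p ρ ⊆ U) (hp : p ∈ frontier Ω) {ω : ℕ → ℝ}
    (hω : ∀ k, 0 ≤ ω k) (hmod : ∀ k, modulusOfContinuity (unitNormal r) (frontier Ω ∩ U)
      (ρ * (1 / 2) ^ k) ≤ ENNReal.ofReal (ω k)) :
    IsInnerDiniNormal Ω ρ ω p (-unitNormal r p) where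
  norm_eq_one := by
    rw [norm_neg, norm_unitNormal (hr.fderiv_ne_zero p (hpU (mem_ball_self hρ)))]
  inner_nonneg y hy := by
    rw [inner_neg_left, inner_unitNormal, ← mul_neg]
    exact mul_nonneg (inv_nonneg.2 (norm_nonneg _)) (neg_nonneg.2
      (hr.fderiv_sub_nonpos hU ho hc (hpU (mem_ball_self hρ)) hp (subset_closure hy)))
  mem_of_lt_inner k q hqp hlt := by
    by_contra hq
    have hqρ : dist q p < ρ :=
      hqp.trans_le (mul_le_of_le_one_right hρ.le (pow_le_one₀ (by norm_num) (by norm_num)))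
    obtain ⟨p', hp', hdist, hle⟩ :=
      hr.exists_neg_dist_mul_le_inner_unitNormal hU ho hc hpU hp hq hqρ
    have hosc : dist (unitNormal r p) (unitNormal r p') ≤ ω k := by
      rw [← ENNReal.ofReal_le_ofReal_iff (hω k), ← edist_dist]
      refine le_trans ?_ (hmod k)
      exact le_iSup₂_of_le p ⟨hp, hpU (mem_ball_self hρ)⟩ (le_iSup₂_of_le p' hp'
        (le_iSup_of_le (by rw [dist_comm]; exact hdist.trans_lt hqp) le_rfl))
    rw [inner_neg_left] at hlt
    nlinarith [dist_nonneg (x := q) (y := p)]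

theorem HasDiniSmoothBoundary.exists_isInnerDiniNormal (hs : HasDiniSmoothBoundary Ω)
    (ho : IsOpen Ω) (hb : Bornology.IsBounded Ω) (hc : Convex ℝ Ω) :
    ∃ (ρ : ℝ) (ω : ℕ → ℝ), 0 < ρ ∧ Antitone ω ∧ (∀ k, 0 ≤ ω k) ∧ Summable ω ∧
      ∀ p ∈ frontier Ω, ∃ ν, IsInnerDiniNormal Ω ρ ω p ν := by
  obtain ⟨δ, W, hδ, hW, hint, hloc⟩ := hs.exists_uniform_modulus hb
  obtain ⟨ρ, ω, hρ, hρδ, hω, hω0, hsum, hle⟩ := exists_summable_dyadic_majorant hW hint hδ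
  refine ⟨ρ, ω, hρ, hω, hω0, hsum, fun p hp => ?_⟩
  obtain ⟨U, r, hU, hr, hball, hmod⟩ := hloc p hp
  exact ⟨_, hr.isInnerDiniNormal hU ho hc hρ ((ball_subset_ball hρδ).trans hball) hp hω0
    fun k => (hmod _).trans (hle k)⟩

end DiniNormal

section DiniScale

/-- Summable apertures `e k ≤ 1/10` whose quotients `e (k + 1) / e k` stay in `[1/2, 3/2]`, so
that the heights `ρ 2⁻⁽ᵏ⁺¹⁾ e k` tend to zero geometrically. -/
structure IsRegularDiniScale (e : ℕ → ℝ) : Prop where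
  pos : ∀ k, 0 < e k
  le_tenth : ∀ k, e k ≤ 1 / 10
  half_le : ∀ k, e k / 2 ≤ e (k + 1)
  le_three_halves : ∀ k, e (k + 1) ≤ 3 / 2 * e k
  summable : Summable e

/-- A majorant of `ω` decaying at most geometrically; it is summable when `ω` is. -/
noncomputable def regularMajorant (ω : ℕ → ℝ) : ℕ → ℝ
  | 0 => 1 + ω 0
  | k + 1 => regularMajorant ω k / 2 + ω (k + 1)

section RegularMajorant

variable {ω : ℕ → ℝ}

theorem regularMajorant_pos (h0 : ∀ k, 0 ≤ ω k) (k : ℕ) : 0 < regularMajorant ω k := by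
  induction k with
  | zero => linarith [h0 0, show regularMajorant ω 0 = 1 + ω 0 from rfl]
  | succ k ih => exact add_pos_of_pos_of_nonneg (half_pos ih) (h0 _)

theorem le_regularMajorant (h0 : ∀ k, 0 ≤ ω k) (k : ℕ) : ω k ≤ regularMajorant ω k := by
  cases k with
  | zero => linarith [show regularMajorant ω 0 = 1 + ω 0 from rfl]
  | succ k => exact le_add_of_nonneg_left (half_pos (regularMajorant_pos h0 k)).le

theorem summable_regularMajorant (h0 : ∀ k, 0 ≤ ω k) (hs : Summable ω) :
    Summable (regularMajorant ω) := by
  have hsum (N : ℕ) : ∑ k ∈ Finset.range (N + 1), regularMajorant ω k + regularMajorant ω N =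
      2 * (1 + ∑ k ∈ Finset.range (N + 1), ω k) := by
    induction N with
    | zero => simp [regularMajorant]; ring
    | succ N ih =>
      rw [Finset.sum_range_succ, Finset.sum_range_succ (f := ω), regularMajorant]
      linarith
  refine summable_of_sum_range_le (c := 2 * (1 + ∑' k, ω k))
    (fun k => (regularMajorant_pos h0 k).le) fun N => ?_
  have htsum := hs.sum_le_tsum (Finset.range (N + 1)) fun k _ => h0 k
  have hN := hsum N
  rw [Finset.sum_range_succ] at hN
  linarith [regularMajorant_pos h0 N]

theorem exists_isRegularDiniScale (hanti : Antitone ω) (h0 : ∀ k, 0 ≤ ω k) (hs : Summable ω) :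
    ∃ (K : ℕ) (e : ℕ → ℝ), IsRegularDiniScale e ∧ ∀ k, ω (k + K) ≤ e k := by
  have hsum := summable_regularMajorant h0 hs
  obtain ⟨K, hK⟩ := (hsum.tendsto_atTop_zero.eventually
    (ge_mem_nhds (by norm_num : (0 : ℝ) < 1 / 10))).exists_forall_of_atTop
  have hsucc (k : ℕ) : regularMajorant ω (k + 1 + K) =
      regularMajorant ω (k + K) / 2 + ω (k + K + 1) := by
    rw [Nat.add_right_comm, regularMajorant]
  refine ⟨K, fun k => regularMajorant ω (k + K), ⟨fun k => regularMajorant_pos h0 _,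
    fun k => hK _ (by omega), fun k => ?_, fun k => ?_, (summable_nat_add_iff K).2 hsum⟩,
    fun k => le_regularMajorant h0 _⟩
  · rw [hsucc]
    linarith [h0 (k + K + 1)]
  · rw [hsucc]
    linarith [hanti (k + K).le_succ, le_regularMajorant h0 (k + K)]

end RegularMajorant

/-- The height `ρ 2⁻⁽ᵏ⁺¹⁾ e k` above the boundary at which a disc of radius `ρ 2⁻⁽ᵏ⁺¹⁾` in the
normal line is used to estimate the Kobayashi metric, with relative error `O(e k)`. -/
noncomputable def scaleHeight (ρ : ℝ) (e : ℕ → ℝ) (k : ℕ) : ℝ :=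
  ρ * (1 / 2) ^ (k + 1) * e k

namespace IsRegularDiniScale

variable {ρ : ℝ} {e : ℕ → ℝ}

theorem scaleHeight_pos (he : IsRegularDiniScale e) (hρ : 0 < ρ) (k : ℕ) :
    0 < scaleHeight ρ e k :=
  mul_pos (by positivity) (he.pos k)

theorem scaleHeight_div_four_le (he : IsRegularDiniScale e) (hρ : 0 < ρ) (k : ℕ) :
    scaleHeight ρ e k / 4 ≤ scaleHeight ρ e (k + 1) := by
  have hR : 0 < ρ * (1 / 2) ^ (k + 1) := by positivity
  rw [scaleHeight, scaleHeight, pow_succ _ (k + 1)]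
  nlinarith [he.half_le k]

theorem scaleHeight_succ_le (he : IsRegularDiniScale e) (hρ : 0 < ρ) (k : ℕ) :
    scaleHeight ρ e (k + 1) ≤ 3 / 4 * scaleHeight ρ e k := by
  have hR : 0 < ρ * (1 / 2) ^ (k + 1) := by positivity
  rw [scaleHeight, scaleHeight, pow_succ _ (k + 1)]
  nlinarith [he.le_three_halves k]

theorem antitone_scaleHeight (he : IsRegularDiniScale e) (hρ : 0 < ρ) :
    Antitone (scaleHeight ρ e) :=
  antitone_nat_of_succ_le fun k => by
    linarith [he.scaleHeight_succ_le hρ k, he.scaleHeight_pos hρ k]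

theorem exists_scaleHeight_le (he : IsRegularDiniScale e) (hρ : 0 < ρ) {s : ℝ} (hs : 0 < s) :
    ∃ k, scaleHeight ρ e k ≤ s := by
  have hgeom (k : ℕ) : scaleHeight ρ e k ≤ (3 / 4) ^ k * scaleHeight ρ e 0 := by
    induction k with
    | zero => simp
    | succ k ih => rw [pow_succ]; linarith [he.scaleHeight_succ_le hρ k]
  obtain ⟨k, hk⟩ := exists_pow_lt_of_lt_one (div_pos hs (he.scaleHeight_pos hρ 0))
    (by norm_num : (3 / 4 : ℝ) < 1)
  exact ⟨k, (hgeom k).trans ((lt_div_iff₀ (he.scaleHeight_pos hρ 0)).1 hk).le⟩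

end IsRegularDiniScale

end DiniScale

section NormalLine

variable {n : ℕ} {Ω : Set (Cn n)} {p ν : Cn n}

theorem real_inner_complex_smul_self (ν : Cn n) (z : ℂ) : ⟪ν, z • ν⟫ = z.re * ‖ν‖ ^ 2 := by
  rw [PiLp.inner_apply, EuclideanSpace.norm_sq_eq, Finset.mul_sum]
  refine Finset.sum_congr rfl fun i _ => ?_
  rw [Complex.inner, ← Complex.normSq_eq_norm_sq, Complex.normSq_apply]
  simp
  ring

theorem add_smul_mem_of_cone {R w : ℝ} (hR : 0 < R) (hν : ‖ν‖ = 1) (hw0 : 0 ≤ w) (hw1 : w ≤ 1)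
    (hcone : ∀ q, dist q p < 2 * R → dist q p * w < ⟪ν, q - p⟫ → q ∈ Ω) {z : ℂ}
    (hz : ‖z - R‖ < R * (1 - w ^ 2)) : p + z • ν ∈ Ω := by
  have hdist : dist (p + z • ν) p = ‖z‖ := by
    rw [dist_eq_norm, add_sub_cancel_left, norm_smul, hν, mul_one]
  refine hcone _ ?_ ?_
  · have htri := norm_add_le (z - R) (R : ℂ)
    rw [sub_add_cancel, Complex.norm_real, Real.norm_of_nonneg hR.le] at htri
    rw [hdist]
    nlinarith [sq_nonneg w]
  · rw [hdist, add_sub_cancel_left, real_inner_complex_smul_self, hν, one_pow, mul_one]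
    have hsq : ‖z - R‖ ^ 2 < (R * (1 - w ^ 2)) ^ 2 :=
      pow_lt_pow_left₀ hz (norm_nonneg _) two_ne_zero
    have hexpand : ‖z - R‖ ^ 2 = ‖z‖ ^ 2 - 2 * R * z.re + R ^ 2 := by
      rw [← Complex.normSq_eq_norm_sq, ← Complex.normSq_eq_norm_sq, Complex.normSq_apply,
        Complex.normSq_apply]
      simp
      ring
    have hw2 : 0 ≤ R ^ 2 * (w ^ 2 * (1 - w ^ 2)) := by
      have : 0 ≤ 1 - w ^ 2 := by nlinarith
      positivity
    have : 2 * R * (‖z‖ * w) < 2 * R * z.re := by nlinarith [sq_nonneg (‖z‖ - R * w)]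
    exact lt_of_mul_lt_mul_left this (by positivity)

theorem disc_ratio_le {R e t : ℝ} (hR : 0 < R) (he0 : 0 < e) (he : e ≤ 1 / 10)
    (ht1 : R * e / 4 ≤ t) (ht2 : t ≤ R * e) :
    R * (1 - e ^ 2) / ((R * (1 - e ^ 2)) ^ 2 - (t - R) ^ 2) ≤ (1 + 10 * e) / (2 * t) := by
  have hRe : 0 < R * e := mul_pos hR he0
  have ht0 : 0 < t := by linarith
  have hη : R * e ^ 2 ≤ 4 * t * e := by nlinarith
  have hη' : R * e ^ 2 ≤ R * e / 10 := by nlinarith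
  have hnear : t * (1 - 4 * e) ≤ t - R * e ^ 2 := by linarith
  have hfar : 2 * R * (1 - e) ≤ 2 * R - t - R * e ^ 2 := by linarith
  have hnear0 : 0 < t * (1 - 4 * e) := mul_pos ht0 (by linarith)
  have hfar0 : 0 < 2 * R * (1 - e) := mul_pos (by linarith) (by linarith)
  have hfac : (R * (1 - e ^ 2)) ^ 2 - (t - R) ^ 2 =
      (t - R * e ^ 2) * (2 * R - t - R * e ^ 2) := by ring
  rw [hfac, div_le_div_iff₀ (mul_pos (by linarith) (by linarith)) (by positivity)]
  calc R * (1 - e ^ 2) * (2 * t) ≤ 2 * R * t * 1 := by nlinarith [sq_nonneg e, mul_pos hR ht0]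
    _ ≤ 2 * R * t * ((1 + 10 * e) * ((1 - 4 * e) * (1 - e))) := by
        refine mul_le_mul_of_nonneg_left ?_ (by positivity)
        nlinarith [sq_nonneg e, pow_pos he0 3]
    _ = (1 + 10 * e) * ((t * (1 - 4 * e)) * (2 * R * (1 - e))) := by ring
    _ ≤ (1 + 10 * e) * ((t - R * e ^ 2) * (2 * R - t - R * e ^ 2)) := by
        gcongr
        exact hnear0.le.trans hnear

theorem kobayashiMetric_le_of_cone {R e t : ℝ} (hR : 0 < R) (hν : ‖ν‖ = 1) (he0 : 0 < e)
    (he : e ≤ 1 / 10) (hcone : ∀ q, dist q p < 2 * R → dist q p * e < ⟪ν, q - p⟫ → q ∈ Ω)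
    (ht1 : R * e / 4 ≤ t) (ht2 : t ≤ R * e) :
    kobayashiMetric Ω (p + t • ν) ν ≤ ENNReal.ofReal ((1 + 10 * e) / (2 * t)) := by
  have hnorm : ‖(t : ℂ) - R‖ = |t - R| := by
    rw [← Complex.ofReal_sub, Complex.norm_real, Real.norm_eq_abs]
  have hlt : ‖(t : ℂ) - R‖ < R * (1 - e ^ 2) := by
    rw [hnorm, abs_lt]
    constructor <;> nlinarith [mul_pos hR he0]
  have hdisc := kobayashiMetric_le_of_disc hlt
    (fun _ hz => add_smul_mem_of_cone hR hν he0.le (by linarith) hcone hz) 1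
  rw [hnorm, sq_abs, one_smul, norm_one, one_mul, Complex.coe_smul] at hdisc
  exact hdisc.trans (ENNReal.ofReal_le_ofReal (disc_ratio_le hR he0 he ht1 ht2))

theorem setLIntegral_Icc_const_div {s s' κ : ℝ} (hs : 0 < s) (hss : s ≤ s') (hκ : 0 ≤ κ) :
    ∫⁻ t in Icc s s', ENNReal.ofReal (κ / t) = ENNReal.ofReal (κ * Real.log (s' / s)) := by
  have hpos : ∀ t ∈ Icc s s', 0 < t := fun t ht => hs.trans_le ht.1
  have hcont : ContinuousOn (fun t : ℝ => κ / t) (Icc s s') :=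
    continuousOn_const.div continuousOn_id fun t ht => (hpos t ht).ne'
  have hnonneg : 0 ≤ᵐ[volume.restrict (Icc s s')] fun t => κ / t :=
    (ae_restrict_iff' measurableSet_Icc).2 (.of_forall fun t ht => div_nonneg hκ (hpos t ht).le)
  rw [← ofReal_integral_eq_lintegral_ofReal (hcont.integrableOn_compact isCompact_Icc) hnonneg,
    integral_Icc_eq_integral_Ioc, ← intervalIntegral.integral_of_le hss,
    ← integral_inv_of_pos hs (hs.trans_le hss), ← intervalIntegral.integral_const_mul]
  simp only [div_eq_mul_inv]

theorem kobayashiDist_add_smul_le {s s' κ : ℝ} (hs : 0 < s) (hss : s ≤ s') (hκ : 0 ≤ κ)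
    (hmem : ∀ t ∈ Icc s s', p + t • ν ∈ Ω)
    (hK : ∀ t ∈ Icc s s', kobayashiMetric Ω (p + t • ν) ν ≤ ENNReal.ofReal (κ / t)) :
    kobayashiDist Ω (p + s • ν) (p + s' • ν) ≤ ENNReal.ofReal (κ * Real.log (s' / s)) := by
  rcases hss.eq_or_lt with rfl | hlt
  · rw [kobayashiDist_self (hmem s ⟨le_rfl, le_rfl⟩)]
    exact zero_le
  have hderiv (t : ℝ) : HasDerivAt (fun t : ℝ => p + t • ν) ν t := by
    simpa using ((hasDerivAt_id t).smul_const ν).const_add p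
  have hγ : IsPiecewiseC1On (fun t : ℝ => p + t • ν) s s' := .of_contDiffOn hss (by fun_prop)
  have hlength := kobayashiDist_le_kobayashiLengthOn hlt hγ hmem
  simp only [kobayashiLengthOn, (hderiv _).deriv] at hlength
  exact hlength.trans ((setLIntegral_mono' measurableSet_Icc hK).trans_eq
    (setLIntegral_Icc_const_div hs hss hκ))

end NormalLine

namespace IsInnerDiniNormal

variable {n : ℕ} {Ω : Set (Cn n)} {ρ : ℝ} {e : ℕ → ℝ} {p ν : Cn n}

theorem shift_mono {ω : ℕ → ℝ} (h : IsInnerDiniNormal Ω ρ ω p ν) {K : ℕ}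
    (hle : ∀ k, ω (k + K) ≤ e k) : IsInnerDiniNormal Ω (ρ * (1 / 2) ^ K) e p ν where
  norm_eq_one := h.norm_eq_one
  inner_nonneg := h.inner_nonneg
  mem_of_lt_inner k q hq hlt := by
    rw [mul_assoc, ← pow_add, add_comm] at hq
    exact h.mem_of_lt_inner (k + K) q hq
      ((mul_le_mul_of_nonneg_left (hle k) dist_nonneg).trans_lt hlt)

theorem mem_of_dist_lt (h : IsInnerDiniNormal Ω ρ e p ν) (k : ℕ) (q : Cn n)
    (hq : dist q p < 2 * (ρ * (1 / 2) ^ (k + 1))) (hlt : dist q p * e k < ⟪ν, q - p⟫) : q ∈ Ω :=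
  h.mem_of_lt_inner k q (by rw [pow_succ] at hq; linarith) hlt

theorem eq_add_bdryDist_smul (h : IsInnerDiniNormal Ω ρ e p ν) (ho : IsOpen Ω) {x : Cn n}
    (hx : x ∈ Ω) (hxp : bdryDist Ω x = dist x p) : x = p + bdryDist Ω x • ν := by
  have hδ : 0 ≤ bdryDist Ω x := infDist_nonneg
  have hdepth : bdryDist Ω x ≤ ⟪ν, x - p⟫ := by
    refine le_of_forall_lt_imp_le_of_dense fun r hr => ?_
    rcases lt_or_ge r 0 with hr0 | hr0
    · exact hr0.le.trans (h.inner_nonneg x hx)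
    have hmem : x - r • ν ∈ Ω := ball_bdryDist_subset ho hx (by
      rwa [mem_ball, dist_eq_norm, sub_sub_cancel_left, norm_neg, norm_smul, h.norm_eq_one,
        mul_one, Real.norm_of_nonneg hr0])
    have hnonneg := h.inner_nonneg _ hmem
    rw [sub_right_comm, inner_sub_right, inner_smul_right, real_inner_self_eq_norm_sq,
      h.norm_eq_one] at hnonneg
    linarith
  have hexpand := norm_sub_sq_real (x - p) (bdryDist Ω x • ν)
  rw [inner_smul_right, real_inner_comm, norm_smul, h.norm_eq_one, Real.norm_of_nonneg hδ,
    mul_one, ← dist_eq_norm x p, ← hxp] at hexpand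
  have hzero : ‖x - p - bdryDist Ω x • ν‖ ^ 2 ≤ 0 := by nlinarith
  rw [sq_nonpos_iff, norm_eq_zero, sub_sub, sub_eq_zero] at hzero
  exact hzero

theorem ball_subset (h : IsInnerDiniNormal Ω ρ e p ν) (he : IsRegularDiniScale e) (hρ : 0 < ρ)
    {r : ℝ} (hr : 0 < r) (hrρ : r ≤ scaleHeight ρ e 0) : ball (p + r • ν) (r / 4) ⊆ Ω := by
  intro q hq
  rw [mem_ball, dist_eq_norm] at hq
  have hqe : q - p = r • ν + (q - (p + r • ν)) := by abel
  have hdist : dist q p < 5 / 4 * r := by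
    rw [dist_eq_norm, hqe]
    refine (norm_add_le _ _).trans_lt ?_
    rw [norm_smul, h.norm_eq_one, Real.norm_of_nonneg hr.le]
    linarith
  have hrρ' : r ≤ ρ / 20 := by
    rw [scaleHeight] at hrρ
    nlinarith [he.le_tenth 0]
  refine h.mem_of_dist_lt 0 q (by linarith) ?_
  have hinner : ⟪ν, q - p⟫ = r + ⟪ν, q - (p + r • ν)⟫ := by
    conv_lhs => rw [hqe]
    rw [inner_add_right, inner_smul_right, real_inner_self_eq_norm_sq, h.norm_eq_one]
    ring
  have hcs := (abs_le.1 (abs_real_inner_le_norm ν (q - (p + r • ν)))).1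
  rw [h.norm_eq_one, one_mul] at hcs
  rw [hinner]
  nlinarith [dist_nonneg (x := q) (y := p), he.le_tenth 0]

theorem add_smul_mem (h : IsInnerDiniNormal Ω ρ e p ν) (he : IsRegularDiniScale e) (hρ : 0 < ρ)
    {r : ℝ} (hr : 0 < r) (hrρ : r ≤ scaleHeight ρ e 0) : p + r • ν ∈ Ω :=
  h.ball_subset he hρ hr hrρ (mem_ball_self (by positivity))

theorem div_four_le_bdryDist (h : IsInnerDiniNormal Ω ρ e p ν) (he : IsRegularDiniScale e)
    (hρ : 0 < ρ) (ho : IsOpen Ω) (hp : p ∈ frontier Ω) {r : ℝ} (hr : 0 < r)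
    (hrρ : r ≤ scaleHeight ρ e 0) : r / 4 ≤ bdryDist Ω (p + r • ν) := by
  refine (le_infDist ⟨p, hp⟩).2 fun q hq => not_lt.1 fun hlt => ?_
  exact notMem_of_mem_frontier ho hq (h.ball_subset he hρ hr hrρ (by rwa [mem_ball, dist_comm]))

theorem kobayashiDist_le_of_mem_scale (h : IsInnerDiniNormal Ω ρ e p ν)
    (he : IsRegularDiniScale e) (hρ : 0 < ρ) {k : ℕ} {r r' : ℝ}
    (hr : scaleHeight ρ e (k + 1) ≤ r) (hrr' : r ≤ r') (hr' : r' ≤ scaleHeight ρ e k) :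
    kobayashiDist Ω (p + r • ν) (p + r' • ν) ≤
      ENNReal.ofReal (1 / 2 * Real.log (r' / r) + 5 * Real.log 4 * e k) := by
  have hr0 : 0 < r := (he.scaleHeight_pos hρ _).trans_le hr
  have hratio := he.scaleHeight_div_four_le hρ k
  have hmetric : ∀ t ∈ Icc r r', kobayashiMetric Ω (p + t • ν) ν ≤
      ENNReal.ofReal ((1 + 10 * e k) / 2 / t) := fun t ht => by
    rw [div_div]
    exact kobayashiMetric_le_of_cone (by positivity) h.norm_eq_one (he.pos k) (he.le_tenth k)
      (h.mem_of_dist_lt k) (hratio.trans (hr.trans ht.1)) (ht.2.trans hr')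
  refine (kobayashiDist_add_smul_le hr0 hrr' (by linarith [he.pos k])
    (fun t ht => h.add_smul_mem he hρ (hr0.trans_le ht.1)
      (ht.2.trans (hr'.trans (he.antitone_scaleHeight hρ k.zero_le)))) hmetric).trans
    (ENNReal.ofReal_le_ofReal ?_)
  have hlog : Real.log (r' / r) ≤ Real.log 4 :=
    Real.log_le_log (div_pos (hr0.trans_le hrr') hr0) ((div_le_iff₀ hr0).2 (by linarith))
  nlinarith [he.pos k]

theorem kobayashiDist_le_log_add_sum (h : IsInnerDiniNormal Ω ρ e p ν)
    (he : IsRegularDiniScale e) (hρ : 0 < ρ) (k : ℕ) {r r' : ℝ}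
    (hr : scaleHeight ρ e (k + 1) ≤ r) (hrr' : r ≤ r') (hr' : r' ≤ scaleHeight ρ e 0) :
    kobayashiDist Ω (p + r • ν) (p + r' • ν) ≤ ENNReal.ofReal
      (1 / 2 * Real.log (r' / r) + 5 * Real.log 4 * ∑ j ∈ Finset.range (k + 1), e j) := by
  have hlog4 : 0 ≤ Real.log 4 := Real.log_nonneg (by norm_num)
  induction k generalizing r r' with
  | zero => simpa using h.kobayashiDist_le_of_mem_scale he hρ hr hrr' hr'
  | succ k ih =>
    have hek := mul_nonneg hlog4 (he.pos (k + 1)).le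
    have hsum := mul_nonneg hlog4 (Finset.sum_nonneg fun j (_ : j ∈ Finset.range (k + 1)) =>
      (he.pos j).le)
    rw [Finset.sum_range_succ]
    set t := scaleHeight ρ e (k + 1)
    rcases le_total t r with htr | hrt
    · exact (ih htr hrr' hr').trans (ENNReal.ofReal_le_ofReal (by linarith))
    rcases le_total r' t with hr't | htr'
    · exact (h.kobayashiDist_le_of_mem_scale he hρ hr hrr' hr't).trans
        (ENNReal.ofReal_le_ofReal (by linarith))
    have ht0 : 0 < t := he.scaleHeight_pos hρ _
    have hr0 : 0 < r := (he.scaleHeight_pos hρ _).trans_le hr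
    have hr'0 : 0 < r' := hr0.trans_le hrr'
    have hlog₁ := Real.log_nonneg ((one_le_div hr0).2 hrt)
    have hlog₂ := Real.log_nonneg ((one_le_div ht0).2 htr')
    refine (kobayashiDist_triangle _ (p + t • ν) _).trans ((add_le_add
      (h.kobayashiDist_le_of_mem_scale he hρ hr hrt le_rfl) (ih le_rfl htr' hr')).trans ?_)
    rw [← ENNReal.ofReal_add (by linarith) (by linarith)]
    refine ENNReal.ofReal_le_ofReal (le_of_eq ?_)
    rw [Real.log_div ht0.ne' hr0.ne', Real.log_div hr'0.ne' ht0.ne', Real.log_div hr'0.ne' hr0.ne']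
    ring

theorem kobayashiDist_le_log_add (h : IsInnerDiniNormal Ω ρ e p ν) (he : IsRegularDiniScale e)
    (hρ : 0 < ρ) {r r' : ℝ} (hr : 0 < r) (hrr' : r ≤ r') (hr' : r' ≤ scaleHeight ρ e 0) :
    kobayashiDist Ω (p + r • ν) (p + r' • ν) ≤
      ENNReal.ofReal (1 / 2 * Real.log (r' / r) + 5 * Real.log 4 * ∑' k, e k) := by
  obtain ⟨k, hk⟩ := he.exists_scaleHeight_le hρ hr
  refine (h.kobayashiDist_le_log_add_sum he hρ k
    ((he.antitone_scaleHeight hρ k.le_succ).trans hk) hrr' hr').trans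
    (ENNReal.ofReal_le_ofReal ?_)
  have := Real.log_nonneg (by norm_num : (1 : ℝ) ≤ 4)
  gcongr
  exact he.summable.sum_le_tsum _ fun j _ => (he.pos j).le

end IsInnerDiniNormal

theorem HasDiniSmoothBoundary.exists_lift_of_small {n : ℕ} {Ω : Set (Cn n)}
    (hs : HasDiniSmoothBoundary Ω) (ho : IsOpen Ω) (hb : Bornology.IsBounded Ω)
    (hc : Convex ℝ Ω) (hn : 0 < n) :
    ∃ τ C : ℝ, 0 < τ ∧ 0 ≤ C ∧ ∀ x ∈ Ω, ∀ s, bdryDist Ω x ≤ s → s ≤ τ → ∃ x' ∈ Ω, ‖x' - x‖ ≤ s ∧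
      s / 4 ≤ bdryDist Ω x' ∧
      kobayashiDist Ω x x' ≤ ENNReal.ofReal (1 / 2 * Real.log (s / bdryDist Ω x) + C) := by
  obtain ⟨ρ₀, ω, hρ₀, hanti, hω0, hsum, hnormal⟩ := hs.exists_isInnerDiniNormal ho hb hc
  obtain ⟨K, e, he, hle⟩ := exists_isRegularDiniScale hanti hω0 hsum
  set ρ := ρ₀ * (1 / 2) ^ K
  have hρ : 0 < ρ := by positivity
  refine ⟨scaleHeight ρ e 0, 5 * Real.log 4 * ∑' k, e k, he.scaleHeight_pos hρ 0,
    mul_nonneg (by positivity) (tsum_nonneg fun k => (he.pos k).le), fun x hx s hxs hsτ => ?_⟩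
  obtain ⟨p, hp, hxp⟩ := isClosed_frontier.exists_infDist_eq_dist
    (frontier_nonempty_of_isBounded hb ⟨x, hx⟩ hn) x
  obtain ⟨ν, hν₀⟩ := hnormal p hp
  have hν : IsInnerDiniNormal Ω ρ e p ν := hν₀.shift_mono hle
  have hδ := bdryDist_pos ho hb hn hx
  have hs0 := hδ.trans_le hxs
  have hxe := hν.eq_add_bdryDist_smul ho hx hxp
  refine ⟨p + s • ν, hν.add_smul_mem he hρ hs0 hsτ, ?_,
    hν.div_four_le_bdryDist he hρ ho hp hs0 hsτ, ?_⟩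
  · conv_lhs => rw [hxe]
    rw [add_sub_add_left_eq_sub, ← sub_smul, norm_smul, hν.norm_eq_one, mul_one,
      Real.norm_of_nonneg (by linarith)]
    linarith
  · conv_lhs => rw [hxe]
    exact hν.kobayashiDist_le_log_add he hρ hδ hxs hsτ

section DistanceEstimates

variable {n : ℕ} {Ω : Set (Cn n)}

theorem ball_subset_of_convex (hc : Convex ℝ Ω) {x y : Cn n} {r : ℝ} (hx : ball x r ⊆ Ω)
    (hy : ball y r ⊆ Ω) {t : ℝ} (ht : t ∈ Icc (0 : ℝ) 1) : ball (x + t • (y - x)) r ⊆ Ω := by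
  intro z hz
  set v := z - (x + t • (y - x)) with hv
  have hvr : ‖v‖ < r := by rwa [mem_ball, dist_eq_norm] at hz
  have hxv : x + v ∈ Ω := hx (by rwa [mem_ball, dist_eq_norm, add_sub_cancel_left])
  have hyv : y + v ∈ Ω := hy (by rwa [mem_ball, dist_eq_norm, add_sub_cancel_left])
  have hz_eq : z = (1 - t) • (x + v) + t • (y + v) := by rw [hv]; module
  exact hz_eq ▸ hc hxv hyv (sub_nonneg.2 ht.2) ht.1 (by ring)

theorem kobayashiDist_le_of_balls (hc : Convex ℝ Ω) {x y : Cn n} {r : ℝ} (hr : 0 < r)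
    (hx : ball x r ⊆ Ω) (hy : ball y r ⊆ Ω) :
    kobayashiDist Ω x y ≤ ENNReal.ofReal (‖y - x‖ / r) := by
  have hball {t : ℝ} (ht : t ∈ Icc (0 : ℝ) 1) := ball_subset_of_convex hc hx hy ht
  calc kobayashiDist Ω x y
      ≤ ∫⁻ t in Icc (0 : ℝ) 1, kobayashiMetric Ω (x + t • (y - x)) (y - x) :=
        kobayashiDist_le_of_segment fun t ht => hball ht (mem_ball_self hr)
    _ ≤ ∫⁻ _ in Icc (0 : ℝ) 1, ENNReal.ofReal (‖y - x‖ / r) :=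
        setLIntegral_mono' measurableSet_Icc fun t ht => kobayashiMetric_le_of_ball hr (hball ht)
    _ = ENNReal.ofReal (‖y - x‖ / r) := by simp

theorem kobayashiDist_le_of_le_bdryDist (ho : IsOpen Ω) (hc : Convex ℝ Ω) {x y : Cn n}
    (hx : x ∈ Ω) (hy : y ∈ Ω) {r : ℝ} (hr : 0 < r) (hrx : r ≤ bdryDist Ω x)
    (hry : r ≤ bdryDist Ω y) : kobayashiDist Ω x y ≤ ENNReal.ofReal (‖y - x‖ / r) :=
  kobayashiDist_le_of_balls hc hr
    ((ball_subset_ball hrx).trans (ball_bdryDist_subset ho hx))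
    ((ball_subset_ball hry).trans (ball_bdryDist_subset ho hy))

theorem exists_norm_sub_add_bdryDist_le (hb : Bornology.IsBounded Ω) (hn : 0 < n) :
    ∃ S : ℝ, 0 < S ∧ ∀ x ∈ Ω, ∀ y ∈ Ω, ‖x - y‖ + bdryDist Ω x + bdryDist Ω y ≤ S := by
  rcases Ω.eq_empty_or_nonempty with rfl | hne
  · exact ⟨1, one_pos, by simp⟩
  obtain ⟨D, hD, hDle⟩ := exists_bdryDist_le hb hne hn
  obtain ⟨R, hR, hRle⟩ := hb.exists_pos_norm_le
  refine ⟨R + R + D + D, by positivity, fun x hx y hy => ?_⟩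
  gcongr
  · exact (norm_sub_le x y).trans (add_le_add (hRle x hx) (hRle y hy))
  · exact hDle x hx
  · exact hDle y hy

theorem norm_sub_le_three_mul {x y x' y' : Cn n} {s : ℝ} (hxy : ‖x - y‖ ≤ s)
    (hx : ‖x' - x‖ ≤ s) (hy : ‖y' - y‖ ≤ s) : ‖y' - x'‖ ≤ 3 * s := calc
  ‖y' - x'‖ = ‖(y' - y) - (x - y) - (x' - x)‖ := by congr 1; abel
  _ ≤ ‖y' - y‖ + ‖x - y‖ + ‖x' - x‖ := (norm_sub_le _ _).trans (by gcongr; exact norm_sub_le _ _)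
  _ ≤ 3 * s := by linarith

theorem half_log_add_half_log_le_log {δ δ' s : ℝ} (hδ : 0 < δ) (hδ' : 0 < δ') (hδs : δ ≤ s)
    (hδs' : δ' ≤ s) : 1 / 2 * Real.log δ + 1 / 2 * Real.log δ' ≤ Real.log s := by
  linarith [Real.log_le_log hδ hδs, Real.log_le_log hδ' hδs']

namespace HasDiniSmoothBoundary

theorem exists_lift (hs : HasDiniSmoothBoundary Ω) (ho : IsOpen Ω) (hb : Bornology.IsBounded Ω)
    (hc : Convex ℝ Ω) (hn : 0 < n) {S : ℝ} (hS : 0 < S) :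
    ∃ c C : ℝ, 0 < c ∧ 0 ≤ C ∧ ∀ x ∈ Ω, ∀ s, bdryDist Ω x ≤ s → s ≤ S →
      ∃ x' ∈ Ω, ‖x' - x‖ ≤ s ∧ c * s ≤ bdryDist Ω x' ∧
      kobayashiDist Ω x x' ≤ ENNReal.ofReal (1 / 2 * Real.log (s / bdryDist Ω x) + C) := by
  obtain ⟨τ, C, hτ, hC, hlift⟩ := hs.exists_lift_of_small ho hb hc hn
  set c := min (1 / 4) (τ / (4 * S))
  refine ⟨c, C, by positivity, hC, fun x hx s hxs hsS => ?_⟩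
  have hδ := bdryDist_pos ho hb hn hx
  have hs0 : 0 < s := hδ.trans_le hxs
  have hcs_quarter : c * s ≤ s / 4 := by
    nlinarith [min_le_left (1 / 4 : ℝ) (τ / (4 * S))]
  have hcs_τ : c * s ≤ τ / 4 := calc
    c * s ≤ τ / (4 * S) * S := by gcongr; exact min_le_right _ _
    _ = τ / 4 := by field_simp
  rcases le_total s τ with hsτ | hτs
  · obtain ⟨x', hx', hdist, hdepth, hK⟩ := hlift x hx s hxs hsτ
    exact ⟨x', hx', hdist, hcs_quarter.trans hdepth, hK⟩
  rcases le_total (bdryDist Ω x) τ with hxτ | hτx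
  · obtain ⟨x', hx', hdist, hdepth, hK⟩ := hlift x hx τ hxτ le_rfl
    exact ⟨x', hx', hdist.trans hτs, hcs_τ.trans hdepth, hK.trans (by gcongr)⟩
  · refine ⟨x, hx, by simpa using hs0.le, by linarith, ?_⟩
    rw [kobayashiDist_self hx]
    exact zero_le

/- Lift both points to depth comparable with `s = ‖x - y‖ + δ(x) + δ(y)`; the lifted points are
then joined by a segment of bounded Kobayashi length. -/
theorem exists_kobayashiDist_le (hs : HasDiniSmoothBoundary Ω) (ho : IsOpen Ω)
    (hb : Bornology.IsBounded Ω) (hc : Convex ℝ Ω) (hn : 0 < n) :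
    ∃ C : ℝ, 0 ≤ C ∧ ∀ x ∈ Ω, ∀ y ∈ Ω, kobayashiDist Ω x y ≤ ENNReal.ofReal
      (Real.log (‖x - y‖ + bdryDist Ω x + bdryDist Ω y) - 1 / 2 * Real.log (bdryDist Ω x) -
        1 / 2 * Real.log (bdryDist Ω y) + C) := by
  obtain ⟨S, hS, hle_S⟩ := exists_norm_sub_add_bdryDist_le hb hn
  obtain ⟨c, C, hc0, hC, hlift⟩ := hs.exists_lift ho hb hc hn hS
  refine ⟨2 * C + 3 / c, by positivity, fun x hx y hy => ?_⟩
  have hδx := bdryDist_pos ho hb hn hx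
  have hδy := bdryDist_pos ho hb hn hy
  set s := ‖x - y‖ + bdryDist Ω x + bdryDist Ω y
  have hxs : bdryDist Ω x ≤ s := by linarith [norm_nonneg (x - y)]
  have hys : bdryDist Ω y ≤ s := by linarith [norm_nonneg (x - y)]
  have hs0 : 0 < s := hδx.trans_le hxs
  have hsS : s ≤ S := hle_S x hx y hy
  obtain ⟨x', hx', hxx', hcx', hKx⟩ := hlift x hx s hxs hsS
  obtain ⟨y', hy', hyy', hcy', hKy⟩ := hlift y hy s hys hsS
  have hKmid : kobayashiDist Ω x' y' ≤ ENNReal.ofReal (3 / c) := by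
    refine (kobayashiDist_le_of_le_bdryDist ho hc hx' hy' (mul_pos hc0 hs0) hcx' hcy').trans
      (ENNReal.ofReal_le_ofReal ?_)
    have := norm_sub_le_three_mul (by linarith) hxx' hyy'
    calc ‖y' - x'‖ / (c * s) ≤ 3 * s / (c * s) := by gcongr
      _ = 3 / c := by field_simp
  have hlogx : 0 ≤ Real.log (s / bdryDist Ω x) := Real.log_nonneg ((one_le_div hδx).2 hxs)
  have hlogy : 0 ≤ Real.log (s / bdryDist Ω y) := Real.log_nonneg ((one_le_div hδy).2 hys)
  calc kobayashiDist Ω x y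
      ≤ kobayashiDist Ω x x' + (kobayashiDist Ω x' y' + kobayashiDist Ω y' y) :=
        (kobayashiDist_triangle x x' y).trans (by gcongr; exact kobayashiDist_triangle x' y' y)
    _ ≤ ENNReal.ofReal (1 / 2 * Real.log (s / bdryDist Ω x) + C) + (ENNReal.ofReal (3 / c) +
          ENNReal.ofReal (1 / 2 * Real.log (s / bdryDist Ω y) + C)) := by
        rw [kobayashiDist_comm y' y]; gcongr
    _ = _ := by
        rw [← ENNReal.ofReal_add (by positivity) (by positivity),
          ← ENNReal.ofReal_add (by positivity) (by positivity),
          Real.log_div hs0.ne' hδx.ne', Real.log_div hs0.ne' hδy.ne']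
        congr 1; ring

end HasDiniSmoothBoundary

/- Isometries are presented as pairs of families with equal mutual distances, so that the
estimates apply to a map and, with the roles of the families exchanged, to its inverse. -/
section EqualDistances

variable {ι : Type*} {Ω' : Set (Cn n)} {a b : ι → Cn n}

theorem exists_bdryDist_le_mul_bdryDist (hn : 0 < n) (hs : HasDiniSmoothBoundary Ω)
    (ho : IsOpen Ω) (hbd : Bornology.IsBounded Ω) (hc : Convex ℝ Ω) (ho' : IsOpen Ω')
    (hbd' : Bornology.IsBounded Ω') (hc' : Convex ℝ Ω') (ha : ∀ i, a i ∈ Ω) (hb : ∀ i, b i ∈ Ω')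
    (hab : ∀ i j, kobayashiDist Ω (a i) (a j) = kobayashiDist Ω' (b i) (b j)) :
    ∃ C : ℝ, 0 < C ∧ ∀ i, bdryDist Ω (a i) ≤ C * bdryDist Ω' (b i) := by
  rcases isEmpty_or_nonempty ι with _ | ⟨⟨o⟩⟩
  · exact ⟨1, one_pos, fun i => isEmptyElim i⟩
  obtain ⟨C, hC, hupper⟩ := hs.exists_kobayashiDist_le ho hbd hc hn
  obtain ⟨S, -, hle_S⟩ := exists_norm_sub_add_bdryDist_le hbd hn
  refine ⟨Real.exp (2 * Real.log S - Real.log (bdryDist Ω (a o)) + 2 * C -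
    Real.log (bdryDist Ω' (b o))), Real.exp_pos _, fun i => ?_⟩
  have hδ := bdryDist_pos ho hbd hn (ha i)
  have hδo := bdryDist_pos ho hbd hn (ha o)
  have hδ' := bdryDist_pos ho' hbd' hn (hb i)
  set s := ‖a i - a o‖ + bdryDist Ω (a i) + bdryDist Ω (a o)
  have hcompare := (half_log_bdryDist_sub_le_kobayashiDist hc' ho' hbd' hn (hb i) (hb o)).trans
    ((hab i o).symm.trans_le (hupper _ (ha i) _ (ha o)))
  have := half_log_add_half_log_le_log hδ hδo (s := s) (by linarith [norm_nonneg (a i - a o)])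
    (by linarith [norm_nonneg (a i - a o)])
  rw [ENNReal.ofReal_le_ofReal_iff (by linarith)] at hcompare
  have hlog_s : Real.log s ≤ Real.log S :=
    Real.log_le_log (by positivity) (hle_S _ (ha i) _ (ha o))
  rw [← Real.log_le_log_iff hδ (by positivity), Real.log_mul (Real.exp_pos _).ne' hδ'.ne',
    Real.log_exp]
  linarith

theorem exists_norm_sub_rpow_le {m' : ℝ} (hn : 0 < n) (hs : HasDiniSmoothBoundary Ω)
    (ho : IsOpen Ω) (hbd : Bornology.IsBounded Ω) (hc : Convex ℝ Ω) (h' : IsMConvexDomain m' Ω')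
    (hs' : HasDiniSmoothBoundary Ω') (ha : ∀ i, a i ∈ Ω) (hb : ∀ i, b i ∈ Ω')
    (hab : ∀ i j, kobayashiDist Ω (a i) (a j) = kobayashiDist Ω' (b i) (b j)) :
    ∃ C : ℝ, 0 < C ∧ ∀ i j, ‖b i - b j‖ ^ m' ≤
      C * (‖a i - a j‖ + bdryDist Ω (a i) + bdryDist Ω (a j)) := by
  obtain ⟨E, hE, hδE⟩ := exists_bdryDist_le_mul_bdryDist hn hs' h'.isOpen h'.isBounded h'.convex
    ho hbd hc hb ha fun i j => (hab i j).symm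
  obtain ⟨C, hC, hupper⟩ := hs.exists_kobayashiDist_le ho hbd hc hn
  obtain ⟨C', hlower⟩ := h'.exists_le_kobayashiDist hn
  refine ⟨Real.exp (C + C' + Real.log E), Real.exp_pos _, fun i j => ?_⟩
  have hδ i := bdryDist_pos ho hbd hn (ha i)
  have hδi := hδ i
  have hδj := hδ j
  set s := ‖a i - a j‖ + bdryDist Ω (a i) + bdryDist Ω (a j)
  have hs0 : 0 < s := by positivity
  by_cases hbij : b i = b j
  · rw [hbij, sub_self, norm_zero, Real.zero_rpow (by linarith [h'.one_lt])]
    positivity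
  have hpos : 0 < ‖b i - b j‖ := norm_pos_iff.2 (sub_ne_zero.2 hbij)
  have hcompare := (hlower _ (hb i) _ (hb j) hbij).trans
    ((hab i j).symm.trans_le (hupper _ (ha i) _ (ha j)))
  have := half_log_add_half_log_le_log hδi hδj (s := s) (by linarith [norm_nonneg (a i - a j)])
    (by linarith [norm_nonneg (a i - a j)])
  rw [ENNReal.ofReal_le_ofReal_iff (by linarith)] at hcompare
  have hlogδ k : Real.log (bdryDist Ω' (b k)) ≤ Real.log E + Real.log (bdryDist Ω (a k)) := by
    rw [← Real.log_mul hE.ne' (hδ k).ne']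
    exact Real.log_le_log (bdryDist_pos h'.isOpen h'.isBounded hn (hb k)) (hδE k)
  rw [← Real.log_le_log_iff (Real.rpow_pos_of_pos hpos _) (by positivity), Real.log_rpow hpos,
    Real.log_mul (Real.exp_pos _).ne' hs0.ne', Real.log_exp]
  linarith [hlogδ i, hlogδ j]

end EqualDistances

end DistanceEstimates

section BoundaryExtension

variable {n : ℕ} {m₁ m₂ C : ℝ} {Ω₁ Ω₂ s : Set (Cn n)} {g : Cn n → Cn n}

/-- A map of the ambient space whose restriction `Ω₁ → Ω₂` preserves the Kobayashi distances.
Working with a total map allows extension by continuity to the closure. -/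
structure IsKobayashiIsometryOn (g : Cn n → Cn n) (Ω₁ Ω₂ : Set (Cn n)) : Prop where
  mapsTo : MapsTo g Ω₁ Ω₂
  kobayashiDist_eq : ∀ x ∈ Ω₁, ∀ y ∈ Ω₁, kobayashiDist Ω₁ x y = kobayashiDist Ω₂ (g x) (g y)

/-- `g` is bi-Hölder on `s` up to errors of the size of the boundary distances, which it distorts
at most by the factor `C`. On `s = frontier Ω₁` the errors vanish. -/
structure IsBiHolderUpToBdryDist (m₁ m₂ C : ℝ) (Ω₁ Ω₂ : Set (Cn n)) (g : Cn n → Cn n)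
    (s : Set (Cn n)) : Prop where
  one_le : 1 ≤ C
  bdryDist_le : ∀ x ∈ s, bdryDist Ω₁ x ≤ C * bdryDist Ω₂ (g x)
  bdryDist_image_le : ∀ x ∈ s, bdryDist Ω₂ (g x) ≤ C * bdryDist Ω₁ x
  rpow_norm_sub_le : ∀ x ∈ s, ∀ y ∈ s,
    ‖x - y‖ ^ m₁ ≤ C * (‖g x - g y‖ + bdryDist Ω₂ (g x) + bdryDist Ω₂ (g y))
  rpow_norm_image_sub_le : ∀ x ∈ s, ∀ y ∈ s,
    ‖g x - g y‖ ^ m₂ ≤ C * (‖x - y‖ + bdryDist Ω₁ x + bdryDist Ω₁ y)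

theorem bdryDist_eq_zero_of_mem_frontier {Ω : Set (Cn n)} {x : Cn n} (hx : x ∈ frontier Ω) :
    bdryDist Ω x = 0 :=
  infDist_zero_of_mem hx

theorem mem_frontier_of_bdryDist_le {Ω Ω' : Set (Cn n)} (hne : (frontier Ω).Nonempty)
    {x y : Cn n} (hle : bdryDist Ω x ≤ C * bdryDist Ω' y) (hy : y ∈ frontier Ω') :
    x ∈ frontier Ω := by
  rw [bdryDist_eq_zero_of_mem_frontier hy, mul_zero] at hle
  exact (isClosed_frontier.mem_iff_infDist_zero hne).2 (le_antisymm hle infDist_nonneg)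

theorem continuous_bdryDist (Ω : Set (Cn n)) : Continuous (bdryDist Ω) :=
  continuous_infDist_pt _

theorem continuous_norm_sub_add_bdryDist (Ω : Set (Cn n)) :
    Continuous fun p : Cn n × Cn n => ‖p.1 - p.2‖ + bdryDist Ω p.1 + bdryDist Ω p.2 := by
  have := continuous_bdryDist Ω
  fun_prop

theorem mem_or_mem_frontier_of_mem_closure {Ω : Set (Cn n)} {x : Cn n} (hx : x ∈ closure Ω) :
    x ∈ Ω ∨ x ∈ frontier Ω :=
  or_iff_not_imp_left.2 fun hxΩ => ⟨hx, fun hint => hxΩ (interior_subset hint)⟩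

namespace IsKobayashiIsometryOn

theorem continuousOn (hg : IsKobayashiIsometryOn g Ω₁ Ω₂) (ho₁ : IsOpen Ω₁)
    (hc₁ : Convex ℝ Ω₁) (hb₂ : Bornology.IsBounded Ω₂) : ContinuousOn g Ω₁ := by
  obtain ⟨c, hc, hlower⟩ := exists_norm_sub_le_kobayashiDist hb₂
  intro x hx
  obtain ⟨r, hr, hball⟩ := Metric.isOpen_iff.1 ho₁ x hx
  have hlip : ∀ y ∈ ball x (r / 2), dist (g y) (g x) ≤ (c * (r / 2))⁻¹ * dist y x := by
    intro y hy
    have hballx : ball x (r / 2) ⊆ Ω₁ := (ball_subset_ball (by linarith)).trans hball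
    have hbally : ball y (r / 2) ⊆ Ω₁ :=
      (ball_subset_ball' (by rw [mem_ball] at hy; linarith)).trans hball
    have hdist : c * ‖g x - g y‖ ≤ ‖y - x‖ / (r / 2) := by
      refine (ENNReal.ofReal_le_ofReal_iff (by positivity)).1 ((hlower _ _).trans ?_)
      rw [← hg.kobayashiDist_eq x hx y (hballx hy)]
      exact kobayashiDist_le_of_balls hc₁ (half_pos hr) hballx hbally
    rw [dist_comm, dist_eq_norm, dist_eq_norm, inv_mul_eq_div, le_div_iff₀ (by positivity)]
    rw [le_div_iff₀ (by positivity)] at hdist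
    linarith
  exact (continuousAt_of_locally_lipschitz (half_pos hr) _ hlip).continuousWithinAt

theorem injOn (hg : IsKobayashiIsometryOn g Ω₁ Ω₂) (hb₁ : Bornology.IsBounded Ω₁) :
    InjOn g Ω₁ := by
  obtain ⟨c, hc, hlower⟩ := exists_norm_sub_le_kobayashiDist hb₁
  intro x hx y hy hxy
  have hzero : ENNReal.ofReal (c * ‖x - y‖) ≤ 0 := by
    simpa only [hg.kobayashiDist_eq x hx y hy, hxy, kobayashiDist_self (hg.mapsTo hy)]
      using hlower x y
  rw [nonpos_iff_eq_zero, ENNReal.ofReal_eq_zero] at hzero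
  exact sub_eq_zero.1 (norm_le_zero_iff.1 (nonpos_of_mul_nonpos_right hzero hc))

theorem congr {g' : Cn n → Cn n} (hg : IsKobayashiIsometryOn g Ω₁ Ω₂) (heq : EqOn g' g Ω₁) :
    IsKobayashiIsometryOn g' Ω₁ Ω₂ :=
  ⟨hg.mapsTo.congr heq.symm, fun x hx y hy => by
    rw [heq hx, heq hy, hg.kobayashiDist_eq x hx y hy]⟩

theorem exists_isBiHolderUpToBdryDist (hg : IsKobayashiIsometryOn g Ω₁ Ω₂) (hn : 0 < n)
    (h₁ : IsMConvexDomain m₁ Ω₁) (h₂ : IsMConvexDomain m₂ Ω₂)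
    (hs₁ : HasDiniSmoothBoundary Ω₁) (hs₂ : HasDiniSmoothBoundary Ω₂) :
    ∃ C, IsBiHolderUpToBdryDist m₁ m₂ C Ω₁ Ω₂ g Ω₁ := by
  have hmem₁ (i : Ω₁) : (i : Cn n) ∈ Ω₁ := i.2
  have hmem₂ (i : Ω₁) : g i ∈ Ω₂ := hg.mapsTo i.2
  have heq (i j : Ω₁) : kobayashiDist Ω₁ (i : Cn n) j = kobayashiDist Ω₂ (g i) (g j) :=
    hg.kobayashiDist_eq i i.2 j j.2
  obtain ⟨D₁, -, hδ₁⟩ := exists_bdryDist_le_mul_bdryDist hn hs₁ h₁.isOpen h₁.isBounded h₁.convex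
    h₂.isOpen h₂.isBounded h₂.convex hmem₁ hmem₂ heq
  obtain ⟨D₂, -, hδ₂⟩ := exists_bdryDist_le_mul_bdryDist hn hs₂ h₂.isOpen h₂.isBounded h₂.convex
    h₁.isOpen h₁.isBounded h₁.convex hmem₂ hmem₁ fun i j => (heq i j).symm
  obtain ⟨E₂, -, hnorm₂⟩ := exists_norm_sub_rpow_le hn hs₁ h₁.isOpen h₁.isBounded h₁.convex
    h₂ hs₂ hmem₁ hmem₂ heq
  obtain ⟨E₁, -, hnorm₁⟩ := exists_norm_sub_rpow_le hn hs₂ h₂.isOpen h₂.isBounded h₂.convex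
    h₁ hs₁ hmem₂ hmem₁ fun i j => (heq i j).symm
  have hsum {Ω : Set (Cn n)} (v x y : Cn n) : 0 ≤ ‖v‖ + bdryDist Ω x + bdryDist Ω y :=
    add_nonneg (add_nonneg (norm_nonneg v) infDist_nonneg) infDist_nonneg
  refine ⟨max 1 (max (max D₁ D₂) (max E₁ E₂)), le_max_left _ _,
    fun x hx => (hδ₁ ⟨x, hx⟩).trans (mul_le_mul_of_nonneg_right (by simp) infDist_nonneg),
    fun x hx => (hδ₂ ⟨x, hx⟩).trans (mul_le_mul_of_nonneg_right (by simp) infDist_nonneg),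
    fun x hx y hy => (hnorm₁ ⟨x, hx⟩ ⟨y, hy⟩).trans
      (mul_le_mul_of_nonneg_right (by simp) (hsum _ _ _)),
    fun x hx y hy => (hnorm₂ ⟨x, hx⟩ ⟨y, hy⟩).trans
      (mul_le_mul_of_nonneg_right (by simp) (hsum _ _ _))⟩

end IsKobayashiIsometryOn

namespace IsBiHolderUpToBdryDist

theorem exists_tendsto (hg : IsBiHolderUpToBdryDist m₁ m₂ C Ω₁ Ω₂ g Ω₁) (hm₂ : 0 < m₂)
    {a : Cn n} (ha : a ∈ frontier Ω₁) : ∃ b, Tendsto g (𝓝[Ω₁] a) (𝓝 b) := by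
  have hC : 0 < C := one_pos.trans_le hg.one_le
  have : NeBot (𝓝[Ω₁] a) := mem_closure_iff_nhdsWithin_neBot.1 (frontier_subset_closure ha)
  refine cauchy_map_iff_exists_tendsto.1 (Metric.cauchy_iff.2 ⟨inferInstance, fun ε hε => ?_⟩)
  set η := ε ^ m₂ / (4 * C) with hη
  have hη0 : 0 < η := by positivity
  refine ⟨g '' (Ω₁ ∩ ball a η), image_mem_map (inter_mem self_mem_nhdsWithin
    (mem_nhdsWithin_of_mem_nhds (ball_mem_nhds a hη0))), ?_⟩
  rintro _ ⟨x, ⟨hx, hxa⟩, rfl⟩ _ ⟨y, ⟨hy, hya⟩, rfl⟩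
  have hδx : bdryDist Ω₁ x < η := (infDist_le_dist_of_mem ha).trans_lt hxa
  have hδy : bdryDist Ω₁ y < η := (infDist_le_dist_of_mem ha).trans_lt hya
  have hxy : ‖x - y‖ < 2 * η := by
    rw [← dist_eq_norm]
    linarith [dist_triangle_right x y a, mem_ball.1 hxa, mem_ball.1 hya]
  have hpow : ‖g x - g y‖ ^ m₂ < ε ^ m₂ := calc
    ‖g x - g y‖ ^ m₂ ≤ C * (‖x - y‖ + bdryDist Ω₁ x + bdryDist Ω₁ y) :=
      hg.rpow_norm_image_sub_le x hx y hy
    _ < C * (4 * η) := by gcongr; linarith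
    _ = ε ^ m₂ := by rw [hη]; field_simp
  rw [dist_eq_norm]
  exact (Real.rpow_lt_rpow_iff (norm_nonneg _) hε.le hm₂).1 hpow

theorem congr {g' : Cn n → Cn n} (hg : IsBiHolderUpToBdryDist m₁ m₂ C Ω₁ Ω₂ g s)
    (heq : EqOn g' g s) : IsBiHolderUpToBdryDist m₁ m₂ C Ω₁ Ω₂ g' s where
  one_le := hg.one_le
  bdryDist_le x hx := heq hx ▸ hg.bdryDist_le x hx
  bdryDist_image_le x hx := heq hx ▸ hg.bdryDist_image_le x hx
  rpow_norm_sub_le x hx y hy := heq hx ▸ heq hy ▸ hg.rpow_norm_sub_le x hx y hy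
  rpow_norm_image_sub_le x hx y hy := heq hx ▸ heq hy ▸ hg.rpow_norm_image_sub_le x hx y hy

theorem closure_of_continuousOn (hg : IsBiHolderUpToBdryDist m₁ m₂ C Ω₁ Ω₂ g s) (hm₁ : 0 ≤ m₁)
    (hm₂ : 0 ≤ m₂) (hgc : ContinuousOn g (closure s)) :
    IsBiHolderUpToBdryDist m₁ m₂ C Ω₁ Ω₂ g (closure s) := by
  have hδ₁ : ContinuousOn (fun x => bdryDist Ω₁ x) (closure s) :=
    (continuous_bdryDist Ω₁).continuousOn
  have hδ₂ : ContinuousOn (fun x => bdryDist Ω₂ (g x)) (closure s) :=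
    (continuous_bdryDist Ω₂).comp_continuousOn' hgc
  have hgg : ContinuousOn (fun p : Cn n × Cn n => (g p.1, g p.2)) (closure (s ×ˢ s)) := by
    rw [closure_prod_eq]
    exact hgc.prodMap hgc
  have hmem {x y : Cn n} (hx : x ∈ closure s) (hy : y ∈ closure s) :
      (x, y) ∈ closure (s ×ˢ s) := closure_prod_eq.superset ⟨hx, hy⟩
  have hnorm : Continuous fun p : Cn n × Cn n => ‖p.1 - p.2‖ := by fun_prop
  have hsum₁ := (continuous_norm_sub_add_bdryDist Ω₁).continuousOn (s := closure (s ×ˢ s))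
  have hsum₂ := (continuous_norm_sub_add_bdryDist Ω₂).comp_continuousOn hgg
  refine ⟨hg.one_le, le_on_closure hg.bdryDist_le hδ₁ (hδ₂.const_mul C),
    le_on_closure hg.bdryDist_image_le hδ₂ (hδ₁.const_mul C), fun x hx y hy => ?_,
    fun x hx y hy => ?_⟩
  · have hle := fun p (hp : p ∈ s ×ˢ s) => hg.rpow_norm_sub_le p.1 hp.1 p.2 hp.2
    simpa only [Function.comp_apply] using le_on_closure hle
      (hnorm.continuousOn.rpow_const fun _ _ => Or.inr hm₁) (hsum₂.const_mul C) (hmem hx hy)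
  · have hle := fun p (hp : p ∈ s ×ˢ s) => hg.rpow_norm_image_sub_le p.1 hp.1 p.2 hp.2
    simpa only [Function.comp_apply] using le_on_closure hle
      ((hnorm.comp_continuousOn hgg).rpow_const fun _ _ => Or.inr hm₂) (hsum₁.const_mul C)
      (hmem hx hy)

theorem image_mem_frontier_iff (hg : IsBiHolderUpToBdryDist m₁ m₂ C Ω₁ Ω₂ g s)
    (hne₁ : (frontier Ω₁).Nonempty) (hne₂ : (frontier Ω₂).Nonempty) {a : Cn n} (ha : a ∈ s) :
    g a ∈ frontier Ω₂ ↔ a ∈ frontier Ω₁ :=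
  ⟨mem_frontier_of_bdryDist_le hne₁ (hg.bdryDist_le a ha),
    mem_frontier_of_bdryDist_le hne₂ (hg.bdryDist_image_le a ha)⟩

theorem rpow_norm_sub_le_of_mem_frontier (hg : IsBiHolderUpToBdryDist m₁ m₂ C Ω₁ Ω₂ g s)
    {a b : Cn n} (ha : a ∈ s) (hb : b ∈ s) (hga : g a ∈ frontier Ω₂) (hgb : g b ∈ frontier Ω₂) :
    ‖a - b‖ ^ m₁ ≤ C * ‖g a - g b‖ := by
  simpa only [bdryDist_eq_zero_of_mem_frontier hga, bdryDist_eq_zero_of_mem_frontier hgb,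
    add_zero] using hg.rpow_norm_sub_le a ha b hb

theorem norm_image_sub_le_of_mem_frontier (hg : IsBiHolderUpToBdryDist m₁ m₂ C Ω₁ Ω₂ g s)
    (hm₂ : 1 ≤ m₂) {a b : Cn n} (has : a ∈ s) (hbs : b ∈ s) (ha : a ∈ frontier Ω₁)
    (hb : b ∈ frontier Ω₁) : ‖g a - g b‖ ≤ C * ‖a - b‖ ^ (1 / m₂) := by
  have hm₂0 : 0 < m₂ := one_pos.trans_le hm₂
  have hC : 0 ≤ C := zero_le_one.trans hg.one_le
  have hpow : ‖g a - g b‖ ^ m₂ ≤ C * ‖a - b‖ := by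
    simpa only [bdryDist_eq_zero_of_mem_frontier ha, bdryDist_eq_zero_of_mem_frontier hb,
      add_zero] using hg.rpow_norm_image_sub_le a has b hbs
  calc ‖g a - g b‖ ≤ (C * ‖a - b‖) ^ (1 / m₂) := by
        rwa [one_div, Real.le_rpow_inv_iff_of_pos (norm_nonneg _) (by positivity) hm₂0]
    _ = C ^ (1 / m₂) * ‖a - b‖ ^ (1 / m₂) := Real.mul_rpow hC (norm_nonneg _)
    _ ≤ C * ‖a - b‖ ^ (1 / m₂) := by
        gcongr
        exact Real.rpow_le_self_of_one_le hg.one_le ((div_le_one hm₂0).2 hm₂)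

theorem injOn_closure (hg : IsBiHolderUpToBdryDist m₁ m₂ C Ω₁ Ω₂ g (closure Ω₁))
    (hne₁ : (frontier Ω₁).Nonempty) (hne₂ : (frontier Ω₂).Nonempty) (hinj : InjOn g Ω₁) :
    InjOn g (closure Ω₁) := by
  intro a ha b hb hab
  have hfrontier : a ∈ frontier Ω₁ ↔ b ∈ frontier Ω₁ := by
    rw [← hg.image_mem_frontier_iff hne₁ hne₂ ha, hab, hg.image_mem_frontier_iff hne₁ hne₂ hb]
  by_cases ha' : a ∈ frontier Ω₁
  · have hle := hg.rpow_norm_sub_le_of_mem_frontier ha hb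
      ((hg.image_mem_frontier_iff hne₁ hne₂ ha).2 ha')
      ((hg.image_mem_frontier_iff hne₁ hne₂ hb).2 (hfrontier.1 ha'))
    rw [hab, sub_self, norm_zero, mul_zero] at hle
    by_contra hne
    exact hle.not_gt (Real.rpow_pos_of_pos (norm_pos_iff.2 (sub_ne_zero.2 hne)) m₁)
  · exact hinj ((mem_or_mem_frontier_of_mem_closure ha).resolve_right ha')
      ((mem_or_mem_frontier_of_mem_closure hb).resolve_right (mt hfrontier.2 ha')) hab

/- The image of `Ω₁` is open in `Ω₂` by invariance of domain, and relatively closed because limit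
points of the image are images of points of `closure Ω₁`. -/
theorem surjOn (hg : IsBiHolderUpToBdryDist m₁ m₂ C Ω₁ Ω₂ g (closure Ω₁)) (ho₁ : IsOpen Ω₁)
    (hb₁ : Bornology.IsBounded Ω₁) (hΩ₁ : Ω₁.Nonempty) (ho₂ : IsOpen Ω₂)
    (hconn₂ : IsPreconnected Ω₂) (hne₂ : (frontier Ω₂).Nonempty) (hmaps : MapsTo g Ω₁ Ω₂)
    (hinj : InjOn g Ω₁) (hgc : ContinuousOn g (closure Ω₁)) : SurjOn g Ω₁ Ω₂ := by
  have hopen : IsOpen (g '' Ω₁) :=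
    isOpen_image_of_continuousOn_injOn ho₁ (hgc.mono subset_closure) hinj
  have hclosed : IsClosed (g '' closure Ω₁) :=
    (hb₁.isCompact_closure.image_of_continuousOn hgc).isClosed
  obtain ⟨x, hx⟩ := hΩ₁
  refine hconn₂.subset_of_closure_inter_subset hopen
    ⟨g x, hmaps hx, mem_image_of_mem g hx⟩ ?_
  rintro y ⟨hy, hyΩ⟩
  obtain ⟨a, ha, rfl⟩ := closure_minimal (image_mono subset_closure) hclosed hy
  rcases mem_or_mem_frontier_of_mem_closure ha with ha' | ha'
  · exact mem_image_of_mem g ha'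
  · exact absurd hyΩ (notMem_of_mem_frontier ho₂
      (mem_frontier_of_bdryDist_le hne₂ (hg.bdryDist_image_le a ha) ha'))

end IsBiHolderUpToBdryDist

theorem IsKobayashiIsometry.exists_isKobayashiIsometryOn {f : Ω₁ → Ω₂}
    (hf : IsKobayashiIsometry f) :
    ∃ g : Cn n → Cn n, IsKobayashiIsometryOn g Ω₁ Ω₂ ∧ ∀ x : Ω₁, g x = f x := by
  set g : Cn n → Cn n := Function.extend Subtype.val (fun x => (f x : Cn n)) 0
  have hgf (x : Ω₁) : g x = f x := Subtype.val_injective.extend_apply _ _ x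
  refine ⟨g, ⟨fun x hx => hgf ⟨x, hx⟩ ▸ (f ⟨x, hx⟩).2, fun x hx y hy => ?_⟩, hgf⟩
  rw [hgf ⟨x, hx⟩, hgf ⟨y, hy⟩]
  exact (hf ⟨x, hx⟩ ⟨y, hy⟩).symm

theorem IsKobayashiIsometryOn.exists_extension (hg : IsKobayashiIsometryOn g Ω₁ Ω₂) (hn : 0 < n)
    (h₁ : IsMConvexDomain m₁ Ω₁) (h₂ : IsMConvexDomain m₂ Ω₂)
    (hs₁ : HasDiniSmoothBoundary Ω₁) (hs₂ : HasDiniSmoothBoundary Ω₂) :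
    ∃ (G : Cn n → Cn n) (C : ℝ), EqOn G g Ω₁ ∧ ContinuousOn G (closure Ω₁) ∧
      IsBiHolderUpToBdryDist m₁ m₂ C Ω₁ Ω₂ G (closure Ω₁) := by
  have hm₁ : 0 < m₁ := one_pos.trans h₁.one_lt
  have hm₂ : 0 < m₂ := one_pos.trans h₂.one_lt
  have hgc := hg.continuousOn h₁.isOpen h₁.convex h₂.isBounded
  obtain ⟨C, hC⟩ := hg.exists_isBiHolderUpToBdryDist hn h₁ h₂ hs₁ hs₂
  have hlim : ∀ a ∈ closure Ω₁, ∃ b, Tendsto g (𝓝[Ω₁] a) (𝓝 b) := fun a ha =>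
    (mem_or_mem_frontier_of_mem_closure ha).elim (fun h => ⟨g a, hgc a h⟩)
      (hC.exists_tendsto hm₂)
  have heq : EqOn (extendFrom Ω₁ g) g Ω₁ := fun x hx => extendFrom_eq (subset_closure hx) (hgc x hx)
  have hGc : ContinuousOn (extendFrom Ω₁ g) (closure Ω₁) := continuousOn_extendFrom subset_rfl hlim
  exact ⟨extendFrom Ω₁ g, C, heq, hGc, (hC.congr heq).closure_of_continuousOn hm₁.le hm₂.le hGc⟩

theorem exists_homeomorph_of_bijOn {X Y : Type*} [TopologicalSpace X] [TopologicalSpace Y]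
    [T2Space Y] {s : Set X} {t : Set Y} {φ : X → Y} (hs : IsCompact s) (hφ : ContinuousOn φ s)
    (hbij : BijOn φ s t) : ∃ F : s ≃ₜ t, ∀ x : s, (F x : Y) = φ x := by
  have : CompactSpace s := isCompact_iff_compactSpace.1 hs
  have hcont : Continuous (hbij.equiv φ) := hφ.mapsToRestrict hbij.mapsTo
  exact ⟨hcont.homeoOfEquivCompactToT2, fun _ => rfl⟩

namespace IsBiHolderUpToBdryDist

theorem bijOn_closure (hg : IsBiHolderUpToBdryDist m₁ m₂ C Ω₁ Ω₂ g (closure Ω₁))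
    (hb₁ : Bornology.IsBounded Ω₁) (hne₁ : (frontier Ω₁).Nonempty)
    (hne₂ : (frontier Ω₂).Nonempty) (hbij : BijOn g Ω₁ Ω₂) (hgc : ContinuousOn g (closure Ω₁)) :
    BijOn g (closure Ω₁) (closure Ω₂) := by
  have hclosed : IsClosed (g '' closure Ω₁) :=
    (hb₁.isCompact_closure.image_of_continuousOn hgc).isClosed
  refine ⟨hbij.mapsTo.closure_of_continuousOn hgc, hg.injOn_closure hne₁ hne₂ hbij.injOn, ?_⟩
  exact closure_minimal (hbij.surjOn.trans (image_mono subset_closure)) hclosed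

theorem bijOn_frontier (hg : IsBiHolderUpToBdryDist m₁ m₂ C Ω₁ Ω₂ g (closure Ω₁))
    (hne₁ : (frontier Ω₁).Nonempty) (hne₂ : (frontier Ω₂).Nonempty)
    (hbij : BijOn g (closure Ω₁) (closure Ω₂)) : BijOn g (frontier Ω₁) (frontier Ω₂) := by
  refine ⟨fun a ha => (hg.image_mem_frontier_iff hne₁ hne₂ (frontier_subset_closure ha)).2 ha,
    hbij.injOn.mono frontier_subset_closure, fun b hb => ?_⟩
  obtain ⟨a, ha, rfl⟩ := hbij.surjOn (frontier_subset_closure hb)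
  exact ⟨a, (hg.image_mem_frontier_iff hne₁ hne₂ ha).1 hb, rfl⟩

end IsBiHolderUpToBdryDist

theorem theorem1p5_general (hn : 0 < n) (h₁ : IsMConvexDomain m₁ Ω₁) (h₂ : IsMConvexDomain m₂ Ω₂)
    (hs₁ : HasDiniSmoothBoundary Ω₁) (hs₂ : HasDiniSmoothBoundary Ω₂)
    (f : Ω₁ → Ω₂) (hf : IsKobayashiIsometry f) :
    ∃ (F : closure Ω₁ ≃ₜ closure Ω₂) (g : frontier Ω₁ → frontier Ω₂),
      (∀ x : Ω₁, (F ⟨x, subset_closure x.2⟩ : Cn n) = f x) ∧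
      (∀ p : frontier Ω₁, (F ⟨p, frontier_subset_closure p.2⟩ : Cn n) = g p) ∧
      Function.Bijective g ∧ ∃ Λ : ℝ, 1 ≤ Λ ∧ ∀ p q : frontier Ω₁,
        Λ⁻¹ * dist p q ^ m₁ ≤ dist (g p) (g q) ∧ dist (g p) (g q) ≤ Λ * dist p q ^ (1 / m₂) := by
  have hne₁ := frontier_nonempty_of_isBounded h₁.isBounded h₁.nonempty hn
  have hne₂ := frontier_nonempty_of_isBounded h₂.isBounded h₂.nonempty hn
  obtain ⟨g, hg, hgf⟩ := hf.exists_isKobayashiIsometryOn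
  obtain ⟨G, C, hGg, hGc, hG⟩ := hg.exists_extension hn h₁ h₂ hs₁ hs₂
  have hGmaps := (hg.congr hGg).mapsTo
  have hGinj := (hg.congr hGg).injOn h₁.isBounded
  have hbij : BijOn G Ω₁ Ω₂ := ⟨hGmaps, hGinj, hG.surjOn h₁.isOpen h₁.isBounded h₁.nonempty
    h₂.isOpen h₂.convex.isPreconnected hne₂ hGmaps hGinj hGc⟩
  have hbij_closure := hG.bijOn_closure h₁.isBounded hne₁ hne₂ hbij hGc
  have hbij_frontier := hG.bijOn_frontier hne₁ hne₂ hbij_closure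
  obtain ⟨F, hF⟩ := exists_homeomorph_of_bijOn h₁.isBounded.isCompact_closure hGc hbij_closure
  refine ⟨F, hbij_frontier.mapsTo.restrict G _ _, fun x => ?_, fun p => hF _,
    hbij_frontier.bijective, C, hG.one_le, fun p q => ?_⟩
  · rw [hF, hGg x.2, hgf]
  have hp := frontier_subset_closure p.2
  have hq := frontier_subset_closure q.2
  simp only [Subtype.dist_eq, dist_eq_norm]
  exact ⟨inv_mul_le_of_le_mul₀ (zero_le_one.trans hG.one_le) (norm_nonneg _)
      (hG.rpow_norm_sub_le_of_mem_frontier hp hq (hbij_frontier.mapsTo p.2)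
        (hbij_frontier.mapsTo q.2)),
    hG.norm_image_sub_le_of_mem_frontier h₂.one_lt.le hp hq p.2 q.2⟩

end BoundaryExtension

theorem theorem1p5 (n : ℕ) (hn : 2 ≤ n) (m : ℝ) (Ω₁ Ω₂ : Set (Cn n))
    (h₁ : IsMConvexDomain m Ω₁) (h₂ : IsMConvexDomain m Ω₂)
    (hs₁ : HasDiniSmoothBoundary Ω₁) (hs₂ : HasDiniSmoothBoundary Ω₂)
    (f : Ω₁ → Ω₂) (hf : IsKobayashiIsometry f) :
    ∃ (F : closure Ω₁ ≃ₜ closure Ω₂) (g : frontier Ω₁ → frontier Ω₂),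
      (∀ x : Ω₁, (F ⟨x, subset_closure x.2⟩ : Cn n) = f x) ∧
      (∀ p : frontier Ω₁, (F ⟨p, frontier_subset_closure p.2⟩ : Cn n) = g p) ∧
      IsBiHolder (1 / m) g := by
  obtain ⟨F, g, hF, hg, hbij, hΛ⟩ := theorem1p5_general (by omega) h₁ h₂ hs₁ hs₂ f hf
  have hm := h₁.one_lt
  exact ⟨F, g, hF, hg, by positivity, (div_lt_one (by positivity)).2 hm, hbij, by
    simpa only [one_div_one_div] using hΛ⟩
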